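/- Let $n\ge 1$, $p>1$, $|D|=\sqrt{-\Delta}$ on $\mathbb R^n$, $\langle x\rangle=(1+|x|^2)^{1/2}$, and write $\|\cdot\|_q$ for the norm of $L^q(\mathbb R^n)$. Let $h:\mathbb R^n\to\mathbb R$ be a nowhere vanishing Lipschitz function with $\frac1h\in L^\infty\cap L^2$ such that, for some constant $C$, $$\Big\|\frac1{h(\cdot)}\int_{\mathbb R^n}\langle\cdot-y\rangle^{-n-1}h(y)f(y)\,dy\Big\|_2\le C\|f\|_2\qquad\text{for all } f\in L^2(\mathbb R^n).$$ Let $A=\big\|\frac1h[|D|,h]\big\|\in[0,\infty]$ be the operator norm of $\frac1h[|D|,h]$ on $L^2(\mathbb R^n)$, that is, the least $C$ with $\|\frac1h(|D|(hf)-h|D|f)\|_2\le C\|f\|_2$ for all Schwartz functions $f$. Let $B=\|\frac1h\|_2$. Let $u_0\in hL^2=\{hw: w\in L^2(\mathbb R^n;\mathbb C)\}$ satisfy, with $y_0=\|\frac1h u_0\|_2$, $$y_0\ \ge\ A^{\frac1{p-1}}\,B .$$ Let $0<T\le\infty$ and let $u\in C([0,T);hL^2)$ be a solution of $$\partial_t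 u=-i|D|u+|u|^{p-1}u,\qquad u(0)=u_0,$$ in the following sense: $u\in L^{p+1}([0,s]\times K)$ for every $s\in[0,T)$ and every compact $K\subset\mathbb R^n$, and for all $\varphi\in C_c^\infty(\mathbb R^n;\mathbb C)$ and $t\in[0,T)$, $$\int u(t)\varphi\,dx=\int u_0\varphi\,dx+\int_0^t\Big(-i\int u(s)\,|D|\varphi\,dx+\int|u(s)|^{p-1}u(s)\varphi\,dx\Big)ds .$$ Then for all $t\in[0,T)$ the quantity $y_0^{-p+1}+A^{-1}B^{-p+1}\{e^{-A(p-1)t}-1\}$ is positive and $$\Big\|\frac1h u(t)\Big\|_2\ \ge\ e^{-2At}\Big(y_0^{-p+1}+A^{-1}B^{-p+1}\big\{e^{-A(p-1)t}-1\big\}\Big)^{-\frac1{p-1}} .$$ Consequently, if $y_0>A^{\frac1{p-1}}B$, then $$T\le-\frac{2}{p-1}\,A^{-1}\log\big(1-A\,B^{p-1}y_0^{-p+1}\big)$$ (when $y_0=A^{\frac1{p-1}}B$ the right-hand side is to be read as $+\infty$). -/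

import Mathlib

open MeasureTheory Filter Topology
open scoped ENNReal NNReal FourierTransform SchwartzMap ContDiff

noncomputable section

namespace FracGL

/-- The Euclidean space `ℝⁿ`. -/
abbrev Space (n : ℕ) : Type := EuclideanSpace ℝ (Fin n)

/-- The Japanese bracket `⟨x⟩ = (1 + |x|²)^(1/2)`. -/
def bracket {n : ℕ} (x : Space n) : ℝ := Real.sqrt (1 + ‖x‖ ^ 2)

/-- `|D| φ = √(-Δ) φ` for a rapidly decreasing smooth function `φ`. Mathlib's Fourier transform has
the kernel `exp (-2 π i x·ξ)`, so the symbol of `√(-Δ)` is `2 π |ξ|`. On less regular functions the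
operator `|D|` is used in the sense of distributions, that is, it is moved onto a test function by
`⟨|D| w, φ⟩ = ∫ w |D| φ`. -/
def absD {n : ℕ} (φ : Space n → ℂ) : Space n → ℂ :=
  𝓕⁻ (fun ξ : Space n => ((2 * Real.pi * ‖ξ‖ : ℝ) : ℂ) * 𝓕 φ ξ)

/-- The norm of `f / h` in `L²(ℝⁿ)`, with values in `[0, ∞]`. -/
def wnorm {n : ℕ} (h : Space n → ℝ) (f : Space n → ℂ) : ℝ≥0∞ :=
  eLpNorm (fun x => f x / (h x : ℂ)) 2 volume

/-- `f ∈ h L²(ℝⁿ)`. -/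
def MemWeighted {n : ℕ} (h : Space n → ℝ) (f : Space n → ℂ) : Prop :=
  MemLp (fun x => f x / (h x : ℂ)) 2 volume

/-- `g = (1/h) [|D|, h] f` with `g ∈ L²`, for a Schwartz function `f`: the identity
`h g = |D| (h f) - h |D| f` holds in the sense of (tempered) distributions. -/
def IsWeightedCommutator {n : ℕ} (h : Space n → ℝ) (f : 𝓢(Space n, ℂ)) (g : Space n → ℂ) : Prop :=
  MemLp g 2 volume ∧
    ∀ φ : 𝓢(Space n, ℂ),
      ∫ x, (h x : ℂ) * g x * φ x =
        (∫ x, (h x : ℂ) * f x * absD φ x) - ∫ x, (h x : ℂ) * absD f x * φ x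

/-- The operator norm `‖(1/h) [|D|, h]‖ ∈ [0, ∞]` of `(1/h) [|D|, h]` on `L²(ℝⁿ)`: the least `C`
such that `‖(1/h) [|D|, h] f‖₂ ≤ C ‖f‖₂` for all `f` in the dense subspace of Schwartz functions.
It is `∞` if the operator has no bounded extension to `L²(ℝⁿ)`. -/
def commNorm {n : ℕ} (h : Space n → ℝ) : ℝ≥0∞ :=
  sInf {C : ℝ≥0∞ | ∀ f : 𝓢(Space n, ℂ), ∃ g : Space n → ℂ,
    IsWeightedCommutator h f g ∧ eLpNorm g 2 volume ≤ C * eLpNorm f 2 volume}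

/-- The convolution bound
`‖(1/h) ∫ ⟨· - y⟩^(-n-1) h(y) f(y) dy‖₂ ≤ C ‖f‖₂` for all `f ∈ L²(ℝⁿ)`. -/
def ConvolutionBound {n : ℕ} (h : Space n → ℝ) : Prop :=
  ∃ C : ℝ≥0, ∀ f : Space n → ℂ, MemLp f 2 volume →
    eLpNorm (fun x => ((h x)⁻¹ : ℂ) *
        ∫ y, ((bracket (x - y) ^ (-(n : ℝ) - 1) : ℝ) : ℂ) * (h y : ℂ) * f y) 2 volume
      ≤ C * eLpNorm f 2 volume

/-- The nonlinearity `|z|^(p-1) z`. -/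
def nonlin (p : ℝ) (z : ℂ) : ℂ := ((‖z‖ ^ (p - 1) : ℝ) : ℂ) * z

/-- `u ∈ C([0,T); h L²)` is a solution of `∂_t u = -i |D| u + |u|^(p-1) u` with `u(0) = u₀`, where
`0 < T ≤ ∞`. The equation is understood in the sense of distributions (in the form integrated in
time, which for continuous `u` is the same), and `u` lies in `L^(p+1)` on `[0,s] × K` for all
`s < T` and all compact `K`, so that the nonlinearity is a locally integrable function and can be
paired locally with the complex conjugate of `u`. -/
structure IsSolution {n : ℕ} (p : ℝ) (h : Space n → ℝ) (T : EReal) (u₀ : Space n → ℂ)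
    (u : ℝ → Space n → ℂ) : Prop where
  memWeighted : ∀ t : ℝ, 0 ≤ t → (t : EReal) < T → MemWeighted h (u t)
  continuous : ∀ t : ℝ, 0 ≤ t → (t : EReal) < T →
    Tendsto (fun s : ℝ => wnorm h (fun x => u s x - u t x))
      (𝓝[{s : ℝ | 0 ≤ s ∧ (s : EReal) < T}] t) (𝓝 0)
  initial : u 0 =ᵐ[volume] u₀
  integrable : ∀ s : ℝ, 0 ≤ s → (s : EReal) < T → ∀ K : Set (Space n), IsCompact K →
    ∫⁻ t in Set.Icc 0 s, ∫⁻ x in K, ‖u t x‖ₑ ^ (p + 1) < ⊤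
  equation : ∀ φ : Space n → ℂ, ContDiff ℝ ∞ φ → HasCompactSupport φ →
    ∀ t : ℝ, 0 ≤ t → (t : EReal) < T →
      ∫ x, u t x * φ x = (∫ x, u₀ x * φ x) +
        ∫ s in (0 : ℝ)..t,
          (-Complex.I * (∫ x, u s x * absD φ x) + ∫ x, nonlin p (u s x) * φ x)

end FracGL

end

noncomputable section

namespace FracGL

variable {n : ℕ}

/-! Write `u = h w`. Formally `∂_t w = -i|D|w - i(1/h)[|D|,h]w + |hw|^(p-1) w`. In the real part of
the pairing with `w`, the term `|D|` disappears by self-adjointness, the commutator costs at most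
`A‖w‖²`, and the nonlinearity gives `∫ |hw|^(p+1) h⁻²`. Hölder's inequality against the finite
measure `h⁻² dx` bounds this integral below by `B^(1-p) ‖w‖^(p+1)` (`cutEnergy_rpow_le`). Hence `E =
‖w‖²` satisfies `E' ≥ -2AE + 2B^(1-p) E^((p+1)/2)`, and integrating this Bernoulli inequality
(`lower_bound_of_integral_le_sub`) yields the lower bound, even with `e^(-At)` in place of
`e^(-2At)`. The bracket must stay positive for as long as the solution lives, which bounds `T`.

The work lies in justifying the energy inequality for a distributional solution that is only a
continuous curve in `hL²`. There are three obstacles.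

The function `ψ / h` is not smooth, so it cannot be inserted directly into the equation. It is
approximated by test functions `φ k` for which `h φ k` has a uniform Lipschitz constant
(`exists_seq_isTest_div`). That constant bounds the functional `v ↦ ∫ v h|D|φ k` on `L²` uniformly
in `k`, so `w` may be replaced by a nearby test function, for which the commutator bound is
available (`im_integral_mul_absD_sub_le`).

The natural multiplier, the conjugate of `w`, is neither smooth nor constant in time. It is replaced
by `S` applied to this conjugate, where `S = JχJ` is symmetric: mollify, cut off at scale `R`,
mollify. Polarization turns an increment of the quadratic form of `S` into a pairing with the fixed
test function `S` of the conjugate of `w(t) + w(s)` (`regEnergy_sub`). The errors are small on short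
intervals and are summed over fine partitions (`integral_le_sub_of_partition`).

Since `S` does not commute with `|D|`, the `|D|` term no longer vanishes. Its imaginary part is
controlled by the commutator of `|D|` with the cutoff, which is `O(1/R)` uniformly in the
mollification (`abs_im_integral_mul_absD_le`, `cutoffConst_cutoffSchwartz`). The mollification is
removed first, using the local `L^(p+1)` bound for the nonlinear term, and then `R → ∞`.

Finally `A` is positive, since otherwise `h` would be constant and `1/h` not in `L²`
(`commNorm_ne_zero`), and it is finite by the size condition on the initial datum. -/

/-! ### The symbol `|ξ|` as an integral against the kernel `|y|^(-n-1)` -/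

/-- The radial kernel `|y|^(-n-1)`. -/
def rieszKernel {n : ℕ} (y : Space n) : ℝ := (‖y‖ ^ (n + 1))⁻¹

lemma rieszKernel_nonneg {n : ℕ} (y : Space n) : 0 ≤ rieszKernel y := by
  unfold rieszKernel; positivity

lemma measurable_rieszKernel {n : ℕ} : Measurable (rieszKernel (n := n)) := by
  unfold rieszKernel; fun_prop

/-- The factor `1 - cos` is `O(|y|²)` at the origin and at most `2` at infinity. In polar
coordinates the resulting majorant is `min 2 (c r²) / r²`, which is at most `(c + 2) / (1 + r²)`. -/
lemma integrable_one_sub_cos_mul_rieszKernel {n : ℕ} (hn : 1 ≤ n) (ξ : Space n) :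
    Integrable (fun y : Space n =>
      (1 - Real.cos (2 * Real.pi * inner ℝ ξ y)) * rieszKernel y) := by
  have : Nontrivial (Space n) := by
    have : Nonempty (Fin n) := ⟨⟨0, hn⟩⟩
    infer_instance
  set c : ℝ := 2 * Real.pi ^ 2 * ‖ξ‖ ^ 2 with hc
  have hc0 : 0 ≤ c := by positivity
  have key : Integrable (fun y : Space n => (fun r : ℝ => min 2 (c * r ^ 2) * (r ^ (n + 1))⁻¹) ‖y‖) := by
    rw [integrable_fun_norm_addHaar volume
      (f := fun r : ℝ => min 2 (c * r ^ 2) * (r ^ (n + 1))⁻¹)]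
    have hi : IntegrableOn (fun r : ℝ => (c + 2) * (1 + r ^ 2)⁻¹) (Set.Ioi 0) :=
      (integrable_inv_one_add_sq.const_mul _).integrableOn
    refine Integrable.mono' hi (by fun_prop) ?_
    filter_upwards [ae_restrict_mem measurableSet_Ioi] with r (hr : 0 < r)
    have hdim : Module.finrank ℝ (Space n) = n := by simp
    rw [hdim]
    have e : r ^ (n - 1) • (min 2 (c * r ^ 2) * (r ^ (n + 1))⁻¹) = min 2 (c * r ^ 2) / r ^ 2 := by
      obtain ⟨m, rfl⟩ := Nat.exists_eq_add_of_le' hn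
      simp only [Nat.add_sub_cancel, smul_eq_mul]
      field_simp
      ring
    rw [e, Real.norm_of_nonneg (by positivity), ← div_eq_mul_inv, div_le_div_iff₀ (by positivity) (by positivity)]
    have h1 : min 2 (c * r ^ 2) ≤ 2 := min_le_left _ _
    have h2 : min 2 (c * r ^ 2) ≤ c * r ^ 2 := min_le_right _ _
    nlinarith [sq_nonneg r]
  refine key.mono' ?_ (ae_of_all _ fun y => ?_)
  · exact (Measurable.mul (by fun_prop) measurable_rieszKernel).aestronglyMeasurable
  · have h1 : Real.cos (2 * Real.pi * inner ℝ ξ y) ≤ 1 := Real.cos_le_one _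
    rw [Real.norm_of_nonneg (mul_nonneg (by linarith) (rieszKernel_nonneg y))]
    refine mul_le_mul_of_nonneg_right (le_min (by linarith [Real.neg_one_le_cos (2 * Real.pi * inner ℝ ξ y)]) ?_) (rieszKernel_nonneg y)
    have h2 := Real.one_sub_sq_div_two_le_cos (x := 2 * Real.pi * inner ℝ ξ y)
    have h3 : (inner ℝ ξ y) ^ 2 ≤ (‖ξ‖ * ‖y‖) ^ 2 := by
      rw [sq_le_sq, abs_of_nonneg (a := ‖ξ‖ * ‖y‖) (by positivity)]
      exact abs_real_inner_le_norm ξ y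
    have h4 : 0 ≤ 2 * Real.pi ^ 2 := by positivity
    have := mul_le_mul_of_nonneg_left h3 h4
    rw [hc]; nlinarith

/-- The function `ξ ↦ ∫ (1 - cos (2 π ξ·y)) |y|^(-n-1) dy`, a multiple of `|ξ|`. -/
def cosSymbol {n : ℕ} (ξ : Space n) : ℝ :=
  ∫ y, (1 - Real.cos (2 * Real.pi * inner ℝ ξ y)) * rieszKernel y

/-- Substituting `a y` for `y`, the kernel contributes `a^(n+1)` and the volume element `a^(-n)`. -/
lemma cosSymbol_smul {n : ℕ} (ξ : Space n) {a : ℝ} (ha : 0 < a) :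
    cosSymbol (a • ξ) = a * cosSymbol ξ := by
  unfold cosSymbol
  have h := Measure.integral_comp_smul (volume : Measure (Space n))
    (fun y : Space n => (1 - Real.cos (2 * Real.pi * inner ℝ ξ y)) * rieszKernel y) a
  have e : ∀ y : Space n, (1 - Real.cos (2 * Real.pi * inner ℝ (a • ξ) y)) * rieszKernel y
      = a ^ (n + 1) * ((1 - Real.cos (2 * Real.pi * inner ℝ ξ (a • y))) * rieszKernel (a • y)) := by
    intro y
    have : rieszKernel y = a ^ (n + 1) * rieszKernel (a • y) := by
      unfold rieszKernel
      rw [norm_smul, Real.norm_of_nonneg ha.le, mul_pow, mul_inv, ← mul_assoc,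
        mul_inv_cancel₀ (by positivity), one_mul]
    rw [real_inner_smul_left, real_inner_smul_right, this]
    ring
  simp_rw [e]
  rw [integral_const_mul, h]
  have hdim : Module.finrank ℝ (Space n) = n := by simp
  rw [hdim, abs_of_pos (by positivity), smul_eq_mul, ← mul_assoc]
  congr 1
  field_simp
  ring

/-- The reflection exchanging the two vectors preserves both Lebesgue measure and the kernel. -/
lemma cosSymbol_eq_of_norm_eq {n : ℕ} {ξ η : Space n} (h : ‖ξ‖ = ‖η‖) :
    cosSymbol ξ = cosSymbol η := by
  set r := (ℝ ∙ (ξ - η))ᗮ.reflection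
  have hr : r ξ = η := Submodule.reflection_sub h
  unfold cosSymbol
  rw [← r.measurePreserving.integral_comp' (f := r.toHomeomorph.toMeasurableEquiv)
    (fun y => (1 - Real.cos (2 * Real.pi * inner ℝ η y)) * rieszKernel y)]
  refine integral_congr_ae (ae_of_all _ fun y => ?_)
  have e : (r.toHomeomorph.toMeasurableEquiv : Space n → Space n) y = r y := rfl
  have h2 : inner ℝ η (r y) = inner ℝ ξ y := by rw [← hr, r.inner_map_map]
  simp only [e, h2, rieszKernel, r.norm_map]

/-- A radial function that is homogeneous of degree one is a multiple of the norm. The multiple is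
its value at a unit vector `e`, positive because the integrand is nonnegative and does not vanish on
the open slab `0 < ⟨e, y⟩ < 1`. -/
lemma exists_cosSymbol_eq {n : ℕ} (hn : 1 ≤ n) :
    ∃ c : ℝ, 0 < c ∧ ∀ ξ : Space n, cosSymbol ξ = c * ‖ξ‖ := by
  set e : Space n := EuclideanSpace.single ⟨0, hn⟩ 1 with he
  have hen : ‖e‖ = 1 := by simp [he]
  refine ⟨cosSymbol e, ?_, fun ξ => ?_⟩
  · unfold cosSymbol
    rw [integral_pos_iff_support_of_nonneg _ (integrable_one_sub_cos_mul_rieszKernel hn e)]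
    · have ho : IsOpen {y : Space n | inner ℝ e y ∈ Set.Ioo (0 : ℝ) 1} :=
        isOpen_Ioo.preimage (by fun_prop)
      refine (ho.measure_pos volume ⟨(1 / 2 : ℝ) • e, ?_⟩).trans_le (measure_mono ?_)
      · simp only [Set.mem_ofPred_eq, real_inner_smul_right, real_inner_self_eq_norm_sq, hen]
        norm_num
      · intro y hy
        simp only [Set.mem_ofPred_eq] at hy
        have hy0 : y ≠ 0 := by rintro rfl; simp at hy
        have hcos : Real.cos (2 * Real.pi * inner ℝ e y) ≠ 1 := by
          intro hcos
          obtain ⟨k, hk⟩ := (Real.cos_eq_one_iff _).1 hcos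
          have : (k : ℝ) = inner ℝ e y := by
            have := Real.pi_pos
            field_simp at hk
            linarith
          rw [← this] at hy
          have h1 : (0 : ℤ) < k := by exact_mod_cast hy.1
          have h2 : k < (1 : ℤ) := by exact_mod_cast hy.2
          omega
        rw [Function.mem_support]
        refine mul_ne_zero (sub_ne_zero.2 hcos.symm) ?_
        unfold rieszKernel
        simp [hy0]
    · intro y
      exact mul_nonneg (sub_nonneg.2 (Real.cos_le_one _)) (rieszKernel_nonneg y)
  · rcases eq_or_ne ξ 0 with rfl | hξ
    · simp [cosSymbol]
    · have h1 : 0 < ‖ξ‖ := norm_pos_iff.2 hξ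
      rw [cosSymbol_eq_of_norm_eq (ξ := ξ) (η := ‖ξ‖ • e) (by simp [norm_smul, hen]), cosSymbol_smul e h1,
        mul_comm]

/-! ### The kernel formula for `|D| φ` off the support of `φ` -/

/-- The exponential `e^(2 π i s)`. -/
def wave (s : ℝ) : ℂ := Complex.exp (↑(2 * Real.pi * s) * Complex.I)

@[simp] lemma norm_wave (s : ℝ) : ‖wave s‖ = 1 := Complex.norm_exp_ofReal_mul_I _

lemma wave_add (s t : ℝ) : wave (s + t) = wave s * wave t := by
  unfold wave
  rw [← Complex.exp_add]
  push_cast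
  ring_nf

@[fun_prop] lemma continuous_wave : Continuous wave := by unfold wave; fun_prop

lemma absD_apply {n : ℕ} (φ : Space n → ℂ) (x : Space n) :
    absD φ x = ∫ ξ, wave (inner ℝ ξ x) *
      (((2 * Real.pi * ‖ξ‖ : ℝ) : ℂ) * 𝓕 φ ξ) := by
  unfold absD
  rw [Real.fourierInv_eq']
  rfl

lemma schwartz_fourierInv_fourier_apply {n : ℕ} (φ : 𝓢(Space n, ℂ)) (x : Space n) :
    ∫ ξ, wave (inner ℝ ξ x) * 𝓕 (φ : Space n → ℂ) ξ = φ x := by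
  have h : 𝓕⁻ (𝓕 φ) x = φ x := by simp
  rw [← h, SchwartzMap.fourierInv_coe, SchwartzMap.fourier_coe, Real.fourierInv_eq']
  rfl

lemma integrable_wave_mul {n : ℕ} (g : 𝓢(Space n, ℂ)) (x : Space n) :
    Integrable fun ξ => wave (inner ℝ ξ x) * g ξ := by
  refine g.integrable.norm.mono' ?_ (ae_of_all _ fun ξ => by simp)
  have : Continuous fun ξ : Space n => wave (inner ℝ ξ x) * g ξ := by
    have := g.continuous
    fun_prop
  exact this.aestronglyMeasurable

lemma integrable_shift_mul_rieszKernel {n : ℕ} {φ : 𝓢(Space n, ℂ)} {x : Space n}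
    (hx : x ∉ tsupport φ) :
    Integrable fun z => φ z * (rieszKernel (x - z) : ℂ) := by
  obtain ⟨δ, hδ, hb⟩ := Metric.isOpen_iff.1 (isClosed_tsupport φ).isOpen_compl x hx
  have hm : AEStronglyMeasurable (fun z => φ z * (rieszKernel (x - z) : ℂ)) volume := by
    refine φ.continuous.aestronglyMeasurable.mul ?_
    exact (Complex.measurable_ofReal.comp
      (measurable_rieszKernel.comp (measurable_const.sub measurable_id))).aestronglyMeasurable
  refine (φ.integrable.norm.mul_const ((δ ^ (n + 1))⁻¹)).mono' hm (ae_of_all _ fun z => ?_)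
  rw [norm_mul, Complex.norm_real, Real.norm_of_nonneg (rieszKernel_nonneg _)]
  by_cases hz : φ z = 0
  · simp [hz]
  · refine mul_le_mul_of_nonneg_left ?_ (norm_nonneg _)
    have : δ ≤ ‖x - z‖ := by
      by_contra hlt
      rw [not_le, ← dist_eq_norm, dist_comm] at hlt
      exact hb hlt (subset_tsupport _ hz)
    unfold rieszKernel
    gcongr

/-- Off the support of `φ`, the function `|D| φ` is given by the kernel `-κ |x-z|^(-n-1)`. -/
lemma exists_absD_eq_integral {n : ℕ} (hn : 1 ≤ n) :
    ∃ κ : ℝ, 0 < κ ∧ ∀ (φ : 𝓢(Space n, ℂ)) (x : Space n), x ∉ tsupport φ →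
      absD φ x = -(κ : ℂ) * ∫ z, φ z * (rieszKernel (x - z) : ℂ) := by
  obtain ⟨c, hc, hcos⟩ := exists_cosSymbol_eq hn
  -- This `κ` makes the symbol `2π|ξ|` equal to `κ` times `cosSymbol ξ`. Inserting that integral
  -- into the Fourier representation of `|D| φ` gives a double integral of `F`.
  refine ⟨2 * Real.pi / c, by positivity, fun φ x hx => ?_⟩
  set F : Space n → Space n → ℂ := fun ξ y => wave (inner ℝ ξ x) *
    𝓕 (φ : Space n → ℂ) ξ * (((1 - Real.cos (2 * Real.pi * inner ℝ ξ y)) * rieszKernel y : ℝ) : ℂ)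
    with hF
  have hcontF : Continuous (𝓕 (φ : Space n → ℂ)) := by
    rw [← SchwartzMap.fourier_coe]; exact (𝓕 φ).continuous
  have hFm : AEStronglyMeasurable (Function.uncurry F) (volume.prod volume) := by
    refine AEStronglyMeasurable.mul ?_ ?_
    · have : Continuous fun p : Space n × Space n => wave (inner ℝ p.1 x) *
        𝓕 (φ : Space n → ℂ) p.1 := by fun_prop
      exact this.aestronglyMeasurable
    · refine (Complex.measurable_ofReal.comp (Measurable.mul ?_ ?_)).aestronglyMeasurable
      · have : Continuous fun p : Space n × Space n =>
          1 - Real.cos (2 * Real.pi * inner ℝ p.1 p.2) := by fun_prop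
        exact this.measurable
      · exact measurable_rieszKernel.comp measurable_snd
  have hcosint : ∀ ξ : Space n, ∫ y, (((1 - Real.cos (2 * Real.pi * inner ℝ ξ y)) *
      rieszKernel y : ℝ) : ℂ) = ((c * ‖ξ‖ : ℝ) : ℂ) := by
    intro ξ; rw [integral_complex_ofReal, ← hcos ξ]; rfl
  have hFi : Integrable (Function.uncurry F) (volume.prod volume) := by
    rw [integrable_prod_iff hFm]
    constructor
    · refine ae_of_all _ fun ξ => ?_
      exact ((integrable_one_sub_cos_mul_rieszKernel hn ξ).ofReal (𝕜 := ℂ)).const_mul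
        (wave (inner ℝ ξ x) * 𝓕 (φ : Space n → ℂ) ξ)
    · have e : ∀ ξ, ∫ y, ‖Function.uncurry F (ξ, y)‖ = c * (‖ξ‖ * ‖𝓕 φ ξ‖) := by
        intro ξ
        have : ∀ y, ‖Function.uncurry F (ξ, y)‖ = ‖𝓕 φ ξ‖ *
            ((1 - Real.cos (2 * Real.pi * inner ℝ ξ y)) * rieszKernel y) := by
          intro y
          simp only [hF, Function.uncurry, norm_mul, norm_wave, one_mul, Complex.norm_real]
          rw [Real.norm_of_nonneg (sub_nonneg.2 (Real.cos_le_one _)),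
            Real.norm_of_nonneg (rieszKernel_nonneg y)]
          rfl
        simp_rw [this]
        rw [integral_const_mul]
        have := hcos ξ
        unfold cosSymbol at this
        rw [this]; ring
      simp_rw [e]
      have h1 := (𝓕 φ).integrable_pow_mul volume 1
      simp only [pow_one] at h1
      exact h1.const_mul c
  -- Integrating first in `y` produces the multiplier `c|ξ|`; integrating first in `ξ` produces, by
  -- Fourier inversion, a symmetric second difference of `φ` at `x`.
  have hswap := integral_integral_swap hFi
  have h1 : ∀ ξ, ∫ y, F ξ y = wave (inner ℝ ξ x) * 𝓕 (φ : Space n → ℂ) ξ *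
      ((c * ‖ξ‖ : ℝ) : ℂ) := by
    intro ξ
    simp only [hF]
    rw [integral_const_mul, hcosint]
  have h2 : ∀ y, ∫ ξ, F ξ y =
      (φ x - (1 / 2) * φ (x + y) - (1 / 2) * φ (x - y)) * (rieszKernel y : ℂ) := by
    intro y
    have e : ∀ ξ, F ξ y = (wave (inner ℝ ξ x) * 𝓕 (φ : Space n → ℂ) ξ
        - (1 / 2) * (wave (inner ℝ ξ (x + y)) * 𝓕 (φ : Space n → ℂ) ξ)
        - (1 / 2) * (wave (inner ℝ ξ (x - y)) * 𝓕 (φ : Space n → ℂ) ξ)) *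
          (rieszKernel y : ℂ) := by
      intro ξ
      simp only [hF]
      rw [inner_add_right, inner_sub_right, wave_add, sub_eq_add_neg (inner ℝ ξ x),
        wave_add]
      have hh : (((1 - Real.cos (2 * Real.pi * inner ℝ ξ y)) * rieszKernel y : ℝ) : ℂ)
          = (1 - (1/2) * wave (inner ℝ ξ y)
            - (1/2) * wave (-inner ℝ ξ y)) * (rieszKernel y : ℂ) := by
        unfold wave
        push_cast
        rw [Complex.cos]
        ring_nf
      rw [hh]
      ring
    simp_rw [e]
    have hint : ∀ z, Integrable fun ξ => wave (inner ℝ ξ z) *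
        𝓕 (φ : Space n → ℂ) ξ := fun z => integrable_wave_mul (𝓕 φ) z
    rw [integral_mul_const, integral_sub, integral_sub (hint x) ((hint _).const_mul _), integral_const_mul, integral_const_mul,
      schwartz_fourierInv_fourier_apply, schwartz_fourierInv_fourier_apply,
      schwartz_fourierInv_fourier_apply]
    · exact (hint x).sub ((hint _).const_mul _)
    · exact (hint _).const_mul _
  simp_rw [h1, h2] at hswap
  -- Since `φ` vanishes near `x`, the second difference splits into two separately integrable
  -- halves, each a translate or a reflection of the same kernel integral.
  have hx0 : φ x = 0 := image_eq_zero_of_notMem_tsupport hx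
  have hint := integrable_shift_mul_rieszKernel hx
  have hminus : ∀ z, φ (x - z) * (rieszKernel z : ℂ) =
      (fun z => φ z * (rieszKernel (x - z) : ℂ)) (x - z) := by intro z; simp
  have hplus : ∀ z, φ (x + z) * (rieszKernel z : ℂ) =
      (fun z => φ z * (rieszKernel (x - z) : ℂ)) (x + z) := by
    intro z; simp [rieszKernel]
  have hpi : Integrable fun z => φ (x + z) * (rieszKernel z : ℂ) := by
    simp_rw [hplus]; exact hint.comp_add_left x
  have hmi : Integrable fun z => φ (x - z) * (rieszKernel z : ℂ) := by
    simp_rw [hminus]; exact hint.comp_sub_left x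
  have hR : ∫ y, (φ x - (1 / 2) * φ (x + y) - (1 / 2) * φ (x - y)) * (rieszKernel y : ℂ)
      = - ∫ z, φ z * (rieszKernel (x - z) : ℂ) := by
    have e : ∀ y, (φ x - (1 / 2) * φ (x + y) - (1 / 2) * φ (x - y)) * (rieszKernel y : ℂ)
      = -(1 / 2) * (φ (x + y) * (rieszKernel y : ℂ)) + -(1 / 2) * (φ (x - y) * (rieszKernel y : ℂ)) := by
      intro y; rw [hx0]; ring
    simp_rw [e]
    rw [integral_add (hpi.const_mul _) (hmi.const_mul _), integral_const_mul, integral_const_mul]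
    simp_rw [hplus, hminus]
    rw [integral_add_left_eq_self (fun z => φ z * (rieszKernel (x - z) : ℂ)) x,
      integral_sub_left_eq_self (fun z => φ z * (rieszKernel (x - z) : ℂ)) volume x]
    ring
  rw [hR] at hswap
  rw [absD_apply]
  have e : ∀ ξ, wave (inner ℝ ξ x) *
      (((2 * Real.pi * ‖ξ‖ : ℝ) : ℂ) * 𝓕 (φ : Space n → ℂ) ξ) = ((2 * Real.pi / c : ℝ) : ℂ) *
      (wave (inner ℝ ξ x) * 𝓕 (φ : Space n → ℂ) ξ * ((c * ‖ξ‖ : ℝ) : ℂ)) := by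
    intro ξ
    push_cast
    have : (c : ℂ) ≠ 0 := by exact_mod_cast hc.ne'
    field_simp
  simp_rw [e]
  rw [integral_const_mul, hswap]
  ring

/-! ### The real-valued `L²` norm -/

/-- The `L²` norm as a real number. -/
def nrm {n : ℕ} (f : Space n → ℂ) : ℝ := (eLpNorm f 2 volume).toReal

lemma nrm_nonneg (f : Space n → ℂ) : 0 ≤ nrm f := ENNReal.toReal_nonneg

lemma nrm_sq {f : Space n → ℂ} (hf : MemLp f 2 volume) : nrm f ^ 2 = ∫ x, ‖f x‖ ^ 2 := by
  unfold nrm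
  rw [hf.eLpNorm_eq_integral_rpow_norm (by simp) (by simp)]
  have h0 : 0 ≤ ∫ x, ‖f x‖ ^ 2 := integral_nonneg fun x => by positivity
  simp only [ENNReal.toReal_ofNat, Real.rpow_ofNat]
  rw [ENNReal.toReal_ofReal (by positivity), ← Real.rpow_natCast, ← Real.rpow_mul h0]
  norm_num

lemma norm_integral_mul_le {f g : Space n → ℂ} (hf : MemLp f 2 volume) (hg : MemLp g 2 volume) :
    ‖∫ x, f x * g x‖ ≤ nrm f * nrm g := by
  have h1 : ∫ x, ‖f x‖ * ‖g x‖ ≤ nrm f * nrm g := by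
    refine (integral_mul_norm_le_Lp_mul_Lq (p := 2) (q := 2) Real.HolderConjugate.two_two
      (by simpa using hf) (by simpa using hg)).trans_eq ?_
    have e : ∀ {k : Space n → ℂ}, MemLp k 2 volume →
        (∫ x, ‖k x‖ ^ (2 : ℝ)) ^ (1 / 2 : ℝ) = nrm k := by
      intro k hk
      simp only [Real.rpow_ofNat]
      rw [← nrm_sq hk, ← Real.sqrt_eq_rpow, Real.sqrt_sq (nrm_nonneg k)]
    rw [e hf, e hg]
  refine (norm_integral_le_integral_norm _).trans (le_trans (le_of_eq ?_) h1)
  simp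

lemma nrm_add_le {f g : Space n → ℂ} (hf : MemLp f 2 volume) (hg : MemLp g 2 volume) :
    nrm (fun x => f x + g x) ≤ nrm f + nrm g := by
  unfold nrm
  rw [← ENNReal.toReal_add hf.eLpNorm_ne_top hg.eLpNorm_ne_top]
  exact ENNReal.toReal_mono (ENNReal.add_ne_top.2 ⟨hf.eLpNorm_ne_top, hg.eLpNorm_ne_top⟩)
    (eLpNorm_add_le hf.1 hg.1 (by norm_num))

lemma nrm_mono {f g : Space n → ℂ} (hg : MemLp g 2 volume) (h : ∀ᵐ x, ‖f x‖ ≤ ‖g x‖) :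
    nrm f ≤ nrm g :=
  ENNReal.toReal_mono hg.eLpNorm_ne_top (eLpNorm_mono_ae h)

lemma nrm_const_mul (c : ℂ) (f : Space n → ℂ) : nrm (fun x => c * f x) = ‖c‖ * nrm f := by
  unfold nrm
  have := eLpNorm_const_smul (μ := volume) c f 2
  simp only [Pi.smul_def, smul_eq_mul] at this
  rw [this, ENNReal.toReal_mul]
  simp

lemma nrm_neg (f : Space n → ℂ) : nrm (fun x => - f x) = nrm f := by
  have := nrm_const_mul (-1) f
  simpa using this

lemma nrm_sub_le {f g : Space n → ℂ} (hf : MemLp f 2 volume) (hg : MemLp g 2 volume) :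
    nrm (fun x => f x - g x) ≤ nrm f + nrm g := by
  have := nrm_add_le hf hg.neg
  simp only [Pi.neg_apply, ← sub_eq_add_neg] at this
  convert this using 2
  exact (nrm_neg g).symm

lemma nrm_conj (f : Space n → ℂ) : nrm (fun x => (starRingEnd ℂ) (f x)) = nrm f := by
  unfold nrm
  congr 1
  exact eLpNorm_congr_norm_ae (ae_of_all _ fun x => by simp)

lemma memLp_conj {p : ℝ≥0∞} {f : Space n → ℂ} (hf : MemLp f p volume) :
    MemLp (fun x => (starRingEnd ℂ) (f x)) p volume := hf.star

/-! ### Basic properties of `|D|` on Schwartz functions -/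

lemma integrable_symbol_mul_fourier (φ : 𝓢(Space n, ℂ)) :
    Integrable fun ξ => ((2 * Real.pi * ‖ξ‖ : ℝ) : ℂ) * 𝓕 (φ : Space n → ℂ) ξ := by
  have h1 := (𝓕 φ).integrable_pow_mul volume 1
  simp only [pow_one] at h1
  refine (h1.const_mul (2 * Real.pi)).mono' ?_ (ae_of_all _ fun ξ => ?_)
  · have : Continuous (𝓕 (φ : Space n → ℂ)) := (𝓕 φ).continuous
    exact (by fun_prop : Continuous fun ξ => ((2 * Real.pi * ‖ξ‖ : ℝ) : ℂ) *
      𝓕 (φ : Space n → ℂ) ξ).aestronglyMeasurable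
  · rw [norm_mul, Complex.norm_real, Real.norm_of_nonneg (by positivity), mul_assoc]
    exact le_rfl

lemma continuous_absD (φ : 𝓢(Space n, ℂ)) : Continuous (absD φ) := by
  have hc : Continuous (𝓕 (φ : Space n → ℂ)) := (𝓕 φ).continuous
  have : absD φ = fun x => ∫ ξ, wave (inner ℝ ξ x) *
      (((2 * Real.pi * ‖ξ‖ : ℝ) : ℂ) * 𝓕 (φ : Space n → ℂ) ξ) := funext (absD_apply φ)
  rw [this]
  refine continuous_of_dominated (bound := fun ξ => ‖((2 * Real.pi * ‖ξ‖ : ℝ) : ℂ) *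
    𝓕 (φ : Space n → ℂ) ξ‖) (fun x => ?_) (fun x => ae_of_all _ fun ξ => ?_)
    (integrable_symbol_mul_fourier φ).norm (ae_of_all _ fun ξ => ?_)
  · exact (by fun_prop : Continuous fun ξ => wave (inner ℝ ξ x) *
      (((2 * Real.pi * ‖ξ‖ : ℝ) : ℂ) * 𝓕 (φ : Space n → ℂ) ξ)).aestronglyMeasurable
  · rw [norm_mul, norm_wave, one_mul]
  · fun_prop

lemma norm_absD_le (φ : 𝓢(Space n, ℂ)) (x : Space n) :
    ‖absD φ x‖ ≤ ∫ ξ, ‖((2 * Real.pi * ‖ξ‖ : ℝ) : ℂ) * 𝓕 (φ : Space n → ℂ) ξ‖ := by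
  rw [absD_apply]
  refine (norm_integral_le_integral_norm _).trans_eq ?_
  simp

lemma absD_add (φ ψ : 𝓢(Space n, ℂ)) (x : Space n) :
    absD (fun y => φ y + ψ y) x = absD φ x + absD ψ x := by
  have hF : ∀ ξ, 𝓕 (fun y => φ y + ψ y) ξ = 𝓕 (φ : Space n → ℂ) ξ + 𝓕 (ψ : Space n → ℂ) ξ := by
    intro ξ
    have : 𝓕 (φ + ψ) ξ = 𝓕 φ ξ + 𝓕 ψ ξ := by rw [FourierTransform.fourier_add]; rfl
    exact this
  have hi : ∀ φ : 𝓢(Space n, ℂ), Integrable fun ξ => wave (inner ℝ ξ x) *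
      (((2 * Real.pi * ‖ξ‖ : ℝ) : ℂ) * 𝓕 (φ : Space n → ℂ) ξ) := by
    intro φ
    exact (integrable_symbol_mul_fourier φ).bdd_mul (c := 1)
      (by fun_prop : Continuous fun ξ : Space n => wave (inner ℝ ξ x)).aestronglyMeasurable
      (ae_of_all _ fun ξ => by simp)
  simp_rw [absD_apply, hF, mul_add]
  exact integral_add (hi φ) (hi ψ)

lemma absD_const_mul (c : ℂ) (φ : 𝓢(Space n, ℂ)) (x : Space n) :
    absD (fun y => c * φ y) x = c * absD φ x := by
  have hF : ∀ ξ, 𝓕 (fun y => c * φ y) ξ = c * 𝓕 (φ : Space n → ℂ) ξ := by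
    intro ξ
    have : 𝓕 (c • φ) ξ = c * 𝓕 φ ξ := by rw [FourierTransform.fourier_smul]; rfl
    exact this
  simp_rw [absD_apply, hF]
  rw [← integral_const_mul]
  congr 1
  ext ξ
  ring

/-- This is the self-duality of the Fourier integral. The inverse transform is treated as the
transform for the bilinear form `-⟨·,·⟩`, so that the general Fubini statement applies. -/
lemma integral_absD_mul_eq (f : 𝓢(Space n, ℂ)) {g : Space n → ℂ} (hg : Integrable g) :
    ∫ x, absD f x * g x = ∫ ξ, ((2 * Real.pi * ‖ξ‖ : ℝ) : ℂ) * 𝓕 (f : Space n → ℂ) ξ * 𝓕⁻ g ξ := by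
  have hi := integrable_symbol_mul_fourier f
  have := VectorFourier.integral_bilin_fourierIntegral_eq_flip (ContinuousLinearMap.mul ℂ ℂ)
    (L := -innerₗ (Space n)) (μ := volume) (ν := volume) Real.continuous_fourierChar
    (continuous_inner (𝕜 := ℝ) (E := Space n)).neg hi hg
  simp only [ContinuousLinearMap.mul_apply'] at this
  have h1 : ∀ x, VectorFourier.fourierIntegral Real.fourierChar volume (-innerₗ (Space n))
      (fun ξ => ((2 * Real.pi * ‖ξ‖ : ℝ) : ℂ) * 𝓕 (f : Space n → ℂ) ξ) x = absD f x := by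
    intro x
    unfold absD
    rw [Real.fourierInv_eq, VectorFourier.fourierIntegral]
    simp
  have h2 : ∀ ξ, VectorFourier.fourierIntegral Real.fourierChar volume (-innerₗ (Space n)).flip
      g ξ = 𝓕⁻ g ξ := by
    intro x
    rw [Real.fourierInv_eq, VectorFourier.fourierIntegral]
    simp [real_inner_comm]
  simp_rw [h1, h2] at this
  exact this

lemma fourierInv_schwartz_apply (g : 𝓢(Space n, ℂ)) (ξ : Space n) :
    𝓕⁻ (g : Space n → ℂ) ξ = 𝓕 (g : Space n → ℂ) (-ξ) :=
  Real.fourierInv_eq_fourier_neg _ _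

/-- The symbol is even, so `ξ ↦ -ξ` exchanges the two functions on the Fourier side. -/
lemma integral_absD_mul_comm (f g : 𝓢(Space n, ℂ)) :
    ∫ x, absD f x * g x = ∫ x, f x * absD g x := by
  have e : ∫ x, f x * absD g x = ∫ x, absD g x * f x := by simp_rw [mul_comm]
  rw [e, integral_absD_mul_eq f g.integrable, integral_absD_mul_eq g f.integrable,
    ← integral_neg_eq_self]
  congr 1
  ext ξ
  rw [fourierInv_schwartz_apply, fourierInv_schwartz_apply, neg_neg, norm_neg]
  ring

lemma memLp_fourierInv (f : 𝓢(Space n, ℂ)) : MemLp (𝓕⁻ (f : Space n → ℂ)) 2 volume := by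
  rw [← SchwartzMap.fourierInv_coe]
  exact (𝓕⁻ f).memLp 2

lemma nrm_fourierInv (f : 𝓢(Space n, ℂ)) : nrm (𝓕⁻ (f : Space n → ℂ)) = nrm f := by
  rw [← abs_of_nonneg (nrm_nonneg f), ← abs_of_nonneg (nrm_nonneg (𝓕⁻ (f : Space n → ℂ))),
    ← sq_eq_sq_iff_abs_eq_abs, nrm_sq (memLp_fourierInv f), nrm_sq (f.memLp 2),
    ← SchwartzMap.integral_norm_sq_fourier, ← integral_neg_eq_self]
  congr 1
  ext ξ
  rw [fourierInv_schwartz_apply, neg_neg]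
  rfl

-- By Plancherel in each coordinate: `|ξ|² = Σ ξ_j²`, so `|D| g` and the gradient of `g` have the
-- same `L²` norm.
open LineDeriv in
lemma integral_sq_symbol_mul_fourier (g : 𝓢(Space n, ℂ)) :
    ∫ ξ, ‖((2 * Real.pi * ‖ξ‖ : ℝ) : ℂ) * 𝓕 (g : Space n → ℂ) ξ‖ ^ 2 =
      ∑ j : Fin n, ∫ x, ‖fderiv ℝ g x (EuclideanSpace.single j 1)‖ ^ 2 := by
  have hj : ∀ j : Fin n, ∫ x, ‖fderiv ℝ g x (EuclideanSpace.single j 1)‖ ^ 2 =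
      ∫ ξ, (2 * Real.pi * ξ j) ^ 2 * ‖𝓕 (g : Space n → ℂ) ξ‖ ^ 2 := by
    intro j
    have h1 := SchwartzMap.integral_norm_sq_fourier (∂_{(EuclideanSpace.single j (1 : ℝ) : Space n)} g)
    simp_rw [SchwartzMap.lineDerivOp_apply_eq_fderiv] at h1
    rw [← h1]
    congr 1
    ext ξ
    have : (fun x : Space n => inner ℝ x (EuclideanSpace.single j (1 : ℝ))).HasTemperateGrowth :=
      ((innerSL ℝ).flip _).hasTemperateGrowth
    rw [SchwartzMap.fourier_lineDerivOp_eq]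
    simp only [smul_apply, SchwartzMap.smulLeftCLM_apply_apply this]
    rw [norm_smul, norm_smul, mul_pow, mul_pow, ← SchwartzMap.fourier_coe]
    simp only [EuclideanSpace.inner_single_right]
    simp [mul_pow, mul_assoc]
  simp_rw [hj]
  rw [← integral_finsetSum]
  · congr 1
    ext ξ
    rw [norm_mul, Complex.norm_real, mul_pow, Real.norm_of_nonneg (by positivity), mul_pow,
      EuclideanSpace.norm_sq_eq, Finset.mul_sum, Finset.sum_mul]
    simp [mul_pow]
  · intro j _
    have h2 := (𝓕 g).integrable_pow_mul volume 2
    obtain ⟨C, hC⟩ : ∃ C, ∀ ξ, ‖𝓕 (g : Space n → ℂ) ξ‖ ≤ C :=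
      ⟨_, fun ξ => SchwartzMap.norm_le_seminorm ℝ (𝓕 g) ξ⟩
    have hc : Continuous (𝓕 (g : Space n → ℂ)) := (𝓕 g).continuous
    refine (h2.const_mul ((2 * Real.pi) ^ 2 * C)).mono' ?_ (ae_of_all _ fun ξ => ?_)
    · have : Continuous fun ξ : Space n => ξ j := by fun_prop
      exact (by fun_prop : Continuous fun ξ : Space n =>
        (2 * Real.pi * ξ j) ^ 2 * ‖𝓕 (g : Space n → ℂ) ξ‖ ^ 2).aestronglyMeasurable
    · have h3 : |ξ j| ≤ ‖ξ‖ := by simpa using PiLp.norm_apply_le ξ j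
      have h4 : (ξ j) ^ 2 ≤ ‖ξ‖ ^ 2 := by rw [← sq_abs]; gcongr
      have h5 := hC ξ
      rw [Real.norm_of_nonneg (by positivity), mul_pow]
      have e : (𝓕 g) ξ = 𝓕 (g : Space n → ℂ) ξ := rfl
      rw [e]
      have h6 : ‖𝓕 (g : Space n → ℂ) ξ‖ ^ 2 ≤ C * ‖𝓕 (g : Space n → ℂ) ξ‖ := by
        rw [sq]; gcongr
      calc (2 * Real.pi) ^ 2 * ξ j ^ 2 * ‖𝓕 (g : Space n → ℂ) ξ‖ ^ 2
          ≤ (2 * Real.pi) ^ 2 * ‖ξ‖ ^ 2 * (C * ‖𝓕 (g : Space n → ℂ) ξ‖) := by gcongr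
        _ = _ := by ring

lemma norm_integral_absD_mul_le (f g : 𝓢(Space n, ℂ)) :
    ‖∫ x, absD f x * g x‖ ≤
      √(∑ j : Fin n, ∫ x, ‖fderiv ℝ g x (EuclideanSpace.single j 1)‖ ^ 2) * nrm f := by
  have e : ∫ x, absD f x * g x = ∫ x, absD g x * f x := by
    rw [integral_absD_mul_comm]; simp_rw [mul_comm]
  rw [e, integral_absD_mul_eq g f.integrable, ← nrm_fourierInv f, ← integral_sq_symbol_mul_fourier]
  have hm : MemLp (fun ξ => ((2 * Real.pi * ‖ξ‖ : ℝ) : ℂ) * 𝓕 (g : Space n → ℂ) ξ) 2 volume := by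
    have hc : Continuous (𝓕 (g : Space n → ℂ)) := (𝓕 g).continuous
    have hc2 : Continuous fun ξ => ((2 * Real.pi * ‖ξ‖ : ℝ) : ℂ) * 𝓕 (g : Space n → ℂ) ξ := by
      fun_prop
    obtain ⟨C, hC⟩ := (𝓕 g).decay 1 0
    have hbd : ∀ᵐ ξ, ‖((2 * Real.pi * ‖ξ‖ : ℝ) : ℂ) * 𝓕 (g : Space n → ℂ) ξ‖ ≤ 2 * Real.pi * C := by
      refine ae_of_all _ fun ξ => ?_
      have := hC.2 ξ
      simp only [pow_one, norm_iteratedFDeriv_zero] at this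
      rw [norm_mul, Complex.norm_real, Real.norm_of_nonneg (by positivity), mul_assoc]
      gcongr
      exact this
    rw [memLp_two_iff_integrable_sq_norm hc2.aestronglyMeasurable]
    refine ((integrable_symbol_mul_fourier g).norm.const_mul (2 * Real.pi * C)).mono'
      (by fun_prop) ?_
    filter_upwards [hbd] with ξ hξ
    rw [Real.norm_of_nonneg (by positivity), sq]
    gcongr
  refine (norm_integral_mul_le hm (memLp_fourierInv f)).trans_eq ?_
  rw [← nrm_sq hm, Real.sqrt_sq (nrm_nonneg _)]

/-- Moving `|D|` onto `g` costs only the `L²` norm of the gradient of `g`. The bound depends on a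
Lipschitz constant and a support radius, both of which remain under control when `g` is mollified.
-/
lemma norm_integral_absD_mul_le_of_lipschitz (f g : 𝓢(Space n, ℂ)) {K : ℝ≥0} {R : ℝ}
    (hK : LipschitzWith K g) (hR : tsupport g ⊆ Metric.closedBall 0 R) :
    ‖∫ x, absD f x * g x‖ ≤
      √(n * (K ^ 2 * volume.real (Metric.closedBall (0 : Space n) R))) * nrm f := by
  refine (norm_integral_absD_mul_le f g).trans ?_
  gcongr
  · exact nrm_nonneg f
  have : ∀ j : Fin n, ∫ x, ‖fderiv ℝ g x (EuclideanSpace.single j 1)‖ ^ 2 ≤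
      K ^ 2 * volume.real (Metric.closedBall (0 : Space n) R) := by
    intro j
    have hle : ∀ x, ‖fderiv ℝ g x (EuclideanSpace.single j 1)‖ ^ 2 ≤
        (Metric.closedBall (0 : Space n) R).indicator (fun _ => (K : ℝ) ^ 2) x := by
      intro x
      by_cases hx : x ∈ Metric.closedBall (0 : Space n) R
      · rw [Set.indicator_of_mem hx]
        have h1 := (fderiv ℝ g x).le_opNorm (EuclideanSpace.single j 1)
        have h2 := norm_fderiv_le_of_lipschitz ℝ hK (x₀ := x)
        simp only [PiLp.norm_single, norm_one, mul_one] at h1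
        gcongr
        exact h1.trans h2
      · rw [Set.indicator_of_notMem hx]
        have : fderiv ℝ g x = 0 := by
          by_contra hne
          exact hx (hR (support_fderiv_subset ℝ hne))
        simp [this]
    have hi : Integrable ((Metric.closedBall (0 : Space n) R).indicator (fun _ => (K : ℝ) ^ 2)) := by
      rw [integrable_indicator_iff Metric.isClosed_closedBall.measurableSet]
      exact integrableOn_const (isCompact_closedBall _ _).measure_lt_top.ne
    refine (integral_mono_of_nonneg (ae_of_all _ fun x => by positivity) hi
      (ae_of_all _ hle)).trans_eq ?_
    rw [integral_indicator Metric.isClosed_closedBall.measurableSet, setIntegral_const, smul_eq_mul,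
      mul_comm]
  refine (Finset.sum_le_sum fun j _ => this j).trans_eq ?_
  simp

/-! ### The commutator of `|D|` with a cutoff -/

/-- The complex conjugate of a Schwartz function. -/
def conjSchwartz (f : 𝓢(Space n, ℂ)) : 𝓢(Space n, ℂ) where
  toFun x := (starRingEnd ℂ) (f x)
  smooth' := Complex.conjCLE.contDiff.comp f.smooth'
  decay' k m := by
    obtain ⟨C, hC⟩ := f.decay' k m
    refine ⟨C, fun x => ?_⟩
    have := Complex.conjLIE.norm_iteratedFDeriv_comp_left (𝕜 := ℝ) f.toFun x m
    exact (congrArg (‖x‖ ^ k * ·) this).trans_le (hC x)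

@[simp] lemma conjSchwartz_apply (f : 𝓢(Space n, ℂ)) (x : Space n) :
    conjSchwartz f x = (starRingEnd ℂ) (f x) := rfl

/-- The product of two Schwartz functions. -/
def mulSchwartz (f g : 𝓢(Space n, ℂ)) : 𝓢(Space n, ℂ) :=
  SchwartzMap.pairing (ContinuousLinearMap.mul ℂ ℂ) f g

lemma fourier_fourier_apply (f : 𝓢(Space n, ℂ)) (x : Space n) :
    𝓕 (𝓕 (f : Space n → ℂ)) x = f (-x) := by
  have h := fourierInv_schwartz_apply (𝓕 f) (-x)
  rw [neg_neg] at h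
  rw [← SchwartzMap.fourier_coe, ← h, ← SchwartzMap.fourierInv_coe]
  simp

open Convolution in
lemma fourier_mulSchwartz (f g : 𝓢(Space n, ℂ)) (ξ : Space n) :
    𝓕 (mulSchwartz f g : Space n → ℂ) ξ =
      ∫ η, 𝓕 (f : Space n → ℂ) (ξ - η) * 𝓕 (g : Space n → ℂ) η := by
  set c := SchwartzMap.convolution (ContinuousLinearMap.mul ℂ ℂ) (𝓕 f) (𝓕 g) with hc
  have h1 : c ξ = ∫ η, 𝓕 (f : Space n → ℂ) (ξ - η) * 𝓕 (g : Space n → ℂ) η := by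
    rw [hc, SchwartzMap.convolution_apply, convolution_eq_swap]
    rfl
  have h2 : ∀ x, 𝓕 (c : Space n → ℂ) x = mulSchwartz f g (-x) := by
    intro x
    rw [← SchwartzMap.fourier_coe, hc, SchwartzMap.fourier_convolution_apply,
      Real.fourier_bilin_convolution_eq _ (𝓕 f).integrable (𝓕 g).integrable]
    rw [SchwartzMap.fourier_coe, SchwartzMap.fourier_coe, fourier_fourier_apply,
      fourier_fourier_apply]
    rfl
  rw [← h1, ← schwartz_fourierInv_fourier_apply c ξ, Real.fourier_eq', ← integral_neg_eq_self]
  congr 1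
  ext x
  rw [h2, smul_eq_mul, wave]
  congr 2
  simp only [inner_neg_left]
  push_cast
  ring

/-- Conjugation reverses the sign in the exponential. For real `χ` this makes the transform of `χ`
Hermitian, which the commutator estimate uses. -/
lemma conj_fourier_apply (f : 𝓢(Space n, ℂ)) (ξ : Space n) :
    (starRingEnd ℂ) (𝓕 (f : Space n → ℂ) ξ) = 𝓕⁻ (conjSchwartz f : Space n → ℂ) ξ := by
  rw [Real.fourier_eq', Real.fourierInv_eq', ← integral_conj]
  congr 1
  ext x
  simp only [smul_eq_mul, map_mul, conjSchwartz_apply, ← Complex.exp_conj, Complex.conj_I,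
    Complex.conj_ofReal]
  congr 2
  push_cast
  ring

/-- The `L¹` norm of `|ζ| χ̂(ζ)`, which controls the commutator of `|D|` with `χ`. -/
def cutoffConst (χ : 𝓢(Space n, ℂ)) : ℝ := ∫ ζ, ‖ζ‖ * ‖𝓕 (χ : Space n → ℂ) ζ‖

/-- On the Fourier side the pairing is a double integral, and its complex conjugate is the same
integral with `|ξ|` replaced by `|η|`, because `χ` is real. The difference carries the factor `|ξ| -
|η|`, bounded by `|ξ - η|`, which combines with the transform of `χ` into an `L¹` convolution
kernel. The Schur test concludes. -/
lemma abs_im_integral_mul_absD_le (χ f : 𝓢(Space n, ℂ))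
    (hχ : ∀ x, (starRingEnd ℂ) (χ x) = χ x) :
    |(∫ x, f x * absD (fun y => χ y * (starRingEnd ℂ) (f y)) x).im| ≤
      Real.pi * cutoffConst χ * nrm f ^ 2 := by
  set X : Space n → ℂ := 𝓕 (χ : Space n → ℂ) with hX
  set a : Space n → ℂ := 𝓕 (conjSchwartz f : Space n → ℂ) with ha
  have hXc : Continuous X := (𝓕 χ).continuous
  have hac : Continuous a := (𝓕 (conjSchwartz f)).continuous
  have hXi : Integrable X := (𝓕 χ).integrable
  have hai : Integrable a := (𝓕 (conjSchwartz f)).integrable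
  have hXneg : ∀ ζ, (starRingEnd ℂ) (X ζ) = X (-ζ) := by
    intro ζ
    have h0 : conjSchwartz χ = χ := by ext x; simp [hχ]
    rw [hX, conj_fourier_apply, h0, fourierInv_schwartz_apply]
  have hfinv : ∀ ξ, 𝓕⁻ (f : Space n → ℂ) ξ = (starRingEnd ℂ) (a ξ) := by
    intro ξ
    have h0 : conjSchwartz (conjSchwartz f) = f := by ext x; simp
    rw [ha, conj_fourier_apply, h0]
  set G : Space n × Space n → ℂ := fun p =>
    (((2 * Real.pi * ‖p.1‖ : ℝ) : ℂ) * (starRingEnd ℂ) (a p.1)) * (X (p.1 - p.2) * a p.2) with hG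
  have hI : ∫ x, f x * absD (fun y => χ y * (starRingEnd ℂ) (f y)) x = ∫ ξ, ∫ η, G (ξ, η) := by
    have e1 : (fun y => χ y * (starRingEnd ℂ) (f y)) = mulSchwartz χ (conjSchwartz f) := rfl
    have e2 : ∫ x, f x * absD (fun y => χ y * (starRingEnd ℂ) (f y)) x =
      ∫ x, absD (mulSchwartz χ (conjSchwartz f)) x * f x := by simp_rw [e1, mul_comm]
    rw [e2, integral_absD_mul_eq _ f.integrable]
    congr 1
    ext ξ
    rw [fourier_mulSchwartz, hfinv]
    simp only [hG]
    rw [integral_const_mul]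
    ring
  obtain ⟨C, hC⟩ := (𝓕 (conjSchwartz f)).decay 1 0
  have hab : ∀ ξ, ‖((2 * Real.pi * ‖ξ‖ : ℝ) : ℂ) * (starRingEnd ℂ) (a ξ)‖ ≤ 2 * Real.pi * C := by
    intro ξ
    have := hC.2 ξ
    simp only [pow_one, norm_iteratedFDeriv_zero] at this
    rw [norm_mul, Complex.norm_real, Real.norm_of_nonneg (by positivity), mul_assoc, RCLike.norm_conj]
    gcongr
    exact this
  have hGi : Integrable G (volume.prod volume) := by
    have h1 : Integrable (fun p : Space n × Space n => X (p.1 - p.2) * a p.2) := by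
      have := hai.convolution_integrand (ContinuousLinearMap.mul ℂ ℂ) hXi
      simpa [mul_comm] using! this
    refine h1.bdd_mul (c := 2 * Real.pi * C) ?_ (ae_of_all _ fun p => hab p.1)
    have hcc : Continuous (starRingEnd ℂ) := Complex.continuous_conj
    exact (by fun_prop : Continuous fun p : Space n × Space n =>
      ((2 * Real.pi * ‖p.1‖ : ℝ) : ℂ) * (starRingEnd ℂ) (a p.1)).aestronglyMeasurable
  set G' : Space n × Space n → ℂ := fun p =>
    (((2 * Real.pi * ‖p.2‖ : ℝ) : ℂ) * (starRingEnd ℂ) (a p.1)) * (X (p.1 - p.2) * a p.2) with hG'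
  -- Here the Hermitian symmetry of `X` enters: after the swap, conjugation moves only the weight,
  -- from the first frequency to the second.
  have hGG : ∀ p, (starRingEnd ℂ) (G p.swap) = G' p := by
    intro p
    simp only [hG, hG', map_mul, Complex.conj_ofReal, hXneg, Complex.conj_conj, Prod.fst_swap,
      Prod.snd_swap, neg_sub]
    ring
  have hG'i : Integrable G' (volume.prod volume) := by
    have : G' = fun p => (starRingEnd ℂ) (G p.swap) := funext fun p => (hGG p).symm
    rw [this]
    exact (LinearIsometryEquiv.integrable_comp_iff Complex.conjLIE).2 hGi.swap
  have hconj : (starRingEnd ℂ) (∫ p, G p ∂(volume.prod volume)) = ∫ p, G' p ∂(volume.prod volume) := by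
    rw [← integral_prod_swap, ← integral_conj]
    simp_rw [hGG]
  set k : Space n → ℝ := fun ζ => ‖ζ‖ * ‖X ζ‖ with hk
  have hki : Integrable k := by
    have := (𝓕 χ).integrable_pow_mul volume 1
    simp only [pow_one] at this
    exact this
  have hkneg : ∀ ζ, k (-ζ) = k ζ := by
    intro ζ; simp only [hk, norm_neg, ← hXneg, RCLike.norm_conj]
  have ha2 : Integrable fun ξ => ‖a ξ‖ ^ 2 := by
    have : MemLp (⇑(𝓕 (conjSchwartz f) : 𝓢(Space n, ℂ))) 2 volume :=
      (𝓕 (conjSchwartz f)).memLp 2 volume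
    exact this.norm.integrable_sq
  have hki2 : Integrable (fun p : Space n × Space n => ‖a p.2‖ ^ 2 * k (p.1 - p.2))
      (volume.prod volume) := ha2.convolution_integrand (ContinuousLinearMap.mul ℝ ℝ) hki
  have hkint : ∫ p : Space n × Space n, ‖a p.2‖ ^ 2 * k (p.1 - p.2) ∂(volume.prod volume) =
      cutoffConst χ * nrm f ^ 2 := by
    rw [integral_prod_symm _ hki2]
    simp only [integral_const_mul]
    simp_rw [integral_sub_right_eq_self k]
    rw [integral_mul_const, mul_comm, nrm_sq (f.memLp 2)]
    congr 1
    have := SchwartzMap.integral_norm_sq_fourier (conjSchwartz f)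
    simp only [conjSchwartz_apply, RCLike.norm_conj] at this
    exact this
  have hki3 : Integrable (fun p : Space n × Space n => ‖a p.1‖ ^ 2 * k (p.1 - p.2))
      (volume.prod volume) := by
    refine hki2.swap.congr (ae_of_all _ fun p => ?_)
    simp only [Function.comp, Prod.fst_swap, Prod.snd_swap]
    rw [← hkneg, neg_sub]
  have hkint3 : ∫ p : Space n × Space n, ‖a p.1‖ ^ 2 * k (p.1 - p.2) ∂(volume.prod volume) =
      cutoffConst χ * nrm f ^ 2 := by
    rw [← hkint, ← integral_prod_swap]
    congr 1
    ext p
    simp only [Prod.fst_swap, Prod.snd_swap]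
    rw [← hkneg, neg_sub]
  have hmain : ‖∫ p, G p ∂(volume.prod volume) - (starRingEnd ℂ) (∫ p, G p ∂(volume.prod volume))‖ ≤
      2 * Real.pi * (cutoffConst χ * nrm f ^ 2) := by
    rw [hconj, ← integral_sub hGi hG'i]
    -- The Schur test in its simplest form: `2|a(ξ)||a(η)|` is split into squares, and each square
    -- is integrated against `k` in the other variable.
    have hbound : ∀ p, ‖G p - G' p‖ ≤ Real.pi * (‖a p.1‖ ^ 2 * k (p.1 - p.2)) +
        Real.pi * (‖a p.2‖ ^ 2 * k (p.1 - p.2)) := by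
      intro p
      have e : G p - G' p = ((2 * Real.pi * (‖p.1‖ - ‖p.2‖) : ℝ) : ℂ) *
          ((starRingEnd ℂ) (a p.1) * (X (p.1 - p.2) * a p.2)) := by
        simp only [hG, hG']; push_cast; ring
      rw [e, norm_mul, Complex.norm_real, Real.norm_eq_abs, abs_mul,
        abs_of_pos (by positivity : 0 < 2 * Real.pi), norm_mul, norm_mul, RCLike.norm_conj]
      have h1 := abs_norm_sub_norm_le p.1 p.2
      have h2 : 2 * (‖a p.1‖ * ‖a p.2‖) ≤ ‖a p.1‖ ^ 2 + ‖a p.2‖ ^ 2 := by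
        nlinarith [sq_nonneg (‖a p.1‖ - ‖a p.2‖)]
      calc 2 * Real.pi * |‖p.1‖ - ‖p.2‖| * (‖a p.1‖ * (‖X (p.1 - p.2)‖ * ‖a p.2‖))
          ≤ 2 * Real.pi * ‖p.1 - p.2‖ * (‖a p.1‖ * (‖X (p.1 - p.2)‖ * ‖a p.2‖)) := by gcongr
        _ = Real.pi * (k (p.1 - p.2)) * (2 * (‖a p.1‖ * ‖a p.2‖)) := by simp only [hk]; ring
        _ ≤ Real.pi * (k (p.1 - p.2)) * (‖a p.1‖ ^ 2 + ‖a p.2‖ ^ 2) := by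
            have : 0 ≤ k (p.1 - p.2) := by simp only [hk]; positivity
            gcongr
        _ = _ := by ring
    refine (norm_integral_le_of_norm_le ((hki3.const_mul _).add (hki2.const_mul _))
      (ae_of_all _ hbound)).trans_eq ?_
    simp only [Pi.add_apply]
    rw [integral_add (hki3.const_mul _) (hki2.const_mul _), integral_const_mul, integral_const_mul,
      hkint, hkint3]
    ring
  rw [hI, ← integral_prod _ hGi]
  set I := ∫ p, G p ∂(volume.prod volume)
  have h3 : I - (starRingEnd ℂ) I = (2 * I.im : ℝ) * Complex.I := by
    rw [Complex.sub_conj]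
  rw [h3, norm_mul, Complex.norm_I, mul_one, Complex.norm_real, Real.norm_eq_abs, abs_mul] at hmain
  norm_num at hmain
  linarith

/-! ### Smooth cutoffs at scale `R` -/

/-- A smooth bump function equal to `1` on the unit ball. -/
def unitBump : ContDiffBump (0 : Space n) := ⟨1, 2, one_pos, one_lt_two⟩

/-- The smooth cutoff at scale `R`. -/
def cutoff (R : ℝ) (x : Space n) : ℝ := unitBump (R⁻¹ • x)

lemma cutoff_nonneg (R : ℝ) (x : Space n) : 0 ≤ cutoff R x := unitBump.nonneg

lemma cutoff_le_one (R : ℝ) (x : Space n) : cutoff R x ≤ 1 := unitBump.le_one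

lemma contDiff_cutoff (R : ℝ) : ContDiff ℝ ∞ (cutoff (n := n) R) :=
  unitBump.contDiff.comp (contDiff_const_smul _)

lemma hasCompactSupport_cutoff {R : ℝ} (hR : 0 < R) : HasCompactSupport (cutoff (n := n) R) :=
  (unitBump (n := n)).hasCompactSupport.comp_smul (inv_ne_zero hR.ne')

lemma tendsto_cutoff (x : Space n) : Tendsto (fun R => cutoff R x) atTop (𝓝 1) := by
  refine tendsto_const_nhds.congr' ?_
  filter_upwards [eventually_gt_atTop 0, eventually_ge_atTop ‖x‖] with R hR hx
  symm
  refine unitBump.one_of_mem_closedBall ?_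
  rw [mem_closedBall_zero_iff, norm_smul, norm_inv, Real.norm_of_nonneg hR.le]
  change R⁻¹ * ‖x‖ ≤ 1
  rw [inv_mul_le_iff₀ hR]
  linarith

/-- The smooth cutoff at scale `R` as a complex-valued Schwartz function. -/
def cutoffSchwartz {R : ℝ} (hR : 0 < R) : 𝓢(Space n, ℂ) :=
  HasCompactSupport.toSchwartzMap (f := fun x : Space n => (cutoff R x : ℂ))
    ((hasCompactSupport_cutoff hR).comp_left (g := ((↑) : ℝ → ℂ)) Complex.ofReal_zero)
    (Complex.ofRealCLM.contDiff.comp (contDiff_cutoff R))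

@[simp] lemma cutoffSchwartz_apply {R : ℝ} (hR : 0 < R) (x : Space n) :
    cutoffSchwartz hR x = (cutoff R x : ℂ) := rfl

/-- The transform of the dilated cutoff is `R^n` times the original one at `R ξ`, and the extra
factor `|ζ|` scales like `R⁻¹`. This makes the commutator with the cutoff vanish as `R → ∞`. -/
lemma cutoffConst_cutoffSchwartz {R : ℝ} (hR : 0 < R) :
    cutoffConst (cutoffSchwartz (n := n) hR) = R⁻¹ * cutoffConst (cutoffSchwartz (n := n) one_pos) := by
  have hF : ∀ ξ, 𝓕 (cutoffSchwartz (n := n) hR : Space n → ℂ) ξ =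
      (R ^ n : ℝ) * 𝓕 (cutoffSchwartz (n := n) one_pos : Space n → ℂ) (R • ξ) := by
    intro ξ
    rw [Real.fourier_eq', Real.fourier_eq']
    have h := Measure.integral_comp_smul (volume : Measure (Space n)) (fun v : Space n =>
      Complex.exp (↑(-2 * Real.pi * inner ℝ v (R • ξ)) * Complex.I) •
        cutoffSchwartz (n := n) one_pos v) R⁻¹
    have hdim : Module.finrank ℝ (Space n) = n := by simp
    rw [hdim, abs_of_pos (by positivity), inv_pow, inv_inv, Complex.real_smul] at h
    rw [← h]
    congr 1
    ext v
    rw [inner_smul_left, inner_smul_right]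
    simp only [conj_trivial, cutoffSchwartz_apply, cutoff, inv_one, one_smul]
    rw [← mul_assoc R⁻¹, inv_mul_cancel₀ hR.ne', one_mul]
  unfold cutoffConst
  have h := Measure.integral_comp_smul (volume : Measure (Space n)) (fun v : Space n =>
      ‖v‖ * ‖𝓕 (cutoffSchwartz (n := n) one_pos : Space n → ℂ) v‖) R
  have hdim : Module.finrank ℝ (Space n) = n := by simp
  rw [hdim, abs_of_pos (by positivity), smul_eq_mul] at h
  have e : ∀ ξ, ‖ξ‖ * ‖𝓕 (cutoffSchwartz (n := n) hR : Space n → ℂ) ξ‖ = R⁻¹ * R ^ n * (‖R • ξ‖ *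
      ‖𝓕 (cutoffSchwartz (n := n) one_pos : Space n → ℂ) (R • ξ)‖) := by
    intro ξ
    rw [hF, norm_mul, Complex.norm_real, norm_smul, Real.norm_of_nonneg (by positivity),
      Real.norm_of_nonneg hR.le]
    field_simp
  simp_rw [e]
  rw [integral_const_mul, h]
  field_simp

/-! ### Decay of `|D| φ` -/

/-- The symbol is not smooth at the origin, so `|D| φ` need not decay rapidly. Far from the support
the kernel formula gives the rate `|x|^(-n-1)`, and on a bounded set the sup bound suffices. -/
lemma exists_norm_absD_le_rpow (hn : 1 ≤ n) (φ : 𝓢(Space n, ℂ)) (hφ : HasCompactSupport φ) :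
    ∃ C : ℝ, 0 ≤ C ∧ ∀ x, ‖absD φ x‖ ≤ C * ((1 + ‖x‖) ^ (n + 1))⁻¹ := by
  obtain ⟨κ, hκ, hK⟩ := exists_absD_eq_integral hn
  obtain ⟨R, hR⟩ := hφ.isBounded.subset_closedBall (0 : Space n)
  set R' := max R 1 with hR'
  have hR1 : 1 ≤ R' := le_max_right _ _
  set C₁ : ℝ := ∫ ξ, ‖((2 * Real.pi * ‖ξ‖ : ℝ) : ℂ) * 𝓕 (φ : Space n → ℂ) ξ‖ with hC₁
  have hC₁0 : 0 ≤ C₁ := integral_nonneg fun _ => norm_nonneg _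
  set C₂ : ℝ := ∫ z, ‖φ z‖ with hC₂
  have hC₂0 : 0 ≤ C₂ := integral_nonneg fun _ => norm_nonneg _
  refine ⟨C₁ * (1 + 2 * R') ^ (n + 1) + κ * C₂ * 4 ^ (n + 1), by positivity, fun x => ?_⟩
  rw [add_mul]
  rcases le_or_gt ‖x‖ (2 * R') with hx | hx
  · have h1 := norm_absD_le φ x
    have h2 : C₁ ≤ C₁ * (1 + 2 * R') ^ (n + 1) * ((1 + ‖x‖) ^ (n + 1))⁻¹ := by
      rw [mul_assoc]
      refine le_mul_of_one_le_right hC₁0 ?_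
      rw [← div_eq_mul_inv, one_le_div (by positivity)]
      gcongr
    have : 0 ≤ κ * C₂ * 4 ^ (n + 1) * ((1 + ‖x‖) ^ (n + 1))⁻¹ := by positivity
    linarith
  · have hxs : x ∉ tsupport φ := by
      intro h
      have := hR h
      rw [mem_closedBall_zero_iff] at this
      have := le_max_left R 1
      linarith
    rw [hK φ x hxs, norm_mul, norm_neg, Complex.norm_real, Real.norm_of_nonneg hκ.le]
    have hb : ∀ z, ‖φ z * (rieszKernel (x - z) : ℂ)‖ ≤ ‖φ z‖ * (4 ^ (n + 1) * ((1 + ‖x‖) ^ (n + 1))⁻¹) := by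
      intro z
      rw [norm_mul, Complex.norm_real, Real.norm_of_nonneg (rieszKernel_nonneg _)]
      by_cases hz : φ z = 0
      · simp [hz]
      · have hz' := hR (subset_tsupport _ hz)
        rw [mem_closedBall_zero_iff] at hz'
        have h3 : ‖x‖ - ‖z‖ ≤ ‖x - z‖ := norm_sub_norm_le x z
        -- For `|x| > 2R'` and `|z| ≤ R'` one has `|x - z| ≥ |x|/2`, and `|x| ≥ 1` because `R' ≥ 1`.
        -- This accounts for the factor `4^(n+1)`.
        have h4 : (1 + ‖x‖) / 4 ≤ ‖x - z‖ := by
          have := le_max_left R 1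
          linarith
        gcongr
        unfold rieszKernel
        calc (‖x - z‖ ^ (n + 1))⁻¹ ≤ (((1 + ‖x‖) / 4) ^ (n + 1))⁻¹ := by gcongr
          _ = _ := by rw [div_pow, inv_div, div_eq_mul_inv]
    have h5 : ‖∫ z, φ z * (rieszKernel (x - z) : ℂ)‖ ≤ C₂ * (4 ^ (n + 1) * ((1 + ‖x‖) ^ (n + 1))⁻¹) := by
      refine (norm_integral_le_of_norm_le (φ.integrable.norm.mul_const _) (ae_of_all _ hb)).trans_eq ?_
      rw [integral_mul_const]
    have h6 := mul_le_mul_of_nonneg_left h5 hκ.le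
    have : 0 ≤ C₁ * (1 + 2 * R') ^ (n + 1) * ((1 + ‖x‖) ^ (n + 1))⁻¹ := by positivity
    linarith [h6]

lemma norm_le_of_lipschitz {h : Space n → ℝ} {K : ℝ≥0} (hLip : LipschitzWith K h) (x : Space n) :
    |h x| ≤ (|h 0| + K) * (1 + ‖x‖) := by
  have h1 := hLip.dist_le_mul x 0
  rw [Real.dist_eq, dist_zero_right] at h1
  have h2 : |h x| ≤ |h 0| + |h x - h 0| := by
    have := abs_add_le (h 0) (h x - h 0)
    simpa using this
  nlinarith [abs_nonneg (h 0), norm_nonneg x, K.coe_nonneg]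

/-- The weight grows at most linearly, so the product decays like `|x|^(-n)`, whose square is
integrable since `2n > n`. Consequently `u ↦ ∫ u |D| φ` is a bounded functional on `hL²`. -/
lemma memLp_weight_mul_absD (hn : 1 ≤ n) {h : Space n → ℝ} {K : ℝ≥0} (hLip : LipschitzWith K h)
    (φ : 𝓢(Space n, ℂ)) (hφ : HasCompactSupport φ) :
    MemLp (fun x => (h x : ℂ) * absD φ x) 2 volume := by
  obtain ⟨C, hC0, hC⟩ := exists_norm_absD_le_rpow hn φ hφ
  have hm : Continuous fun x => (h x : ℂ) * absD φ x := by
    have := hLip.continuous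
    have := continuous_absD φ
    fun_prop
  rw [memLp_two_iff_integrable_sq_norm hm.aestronglyMeasurable]
  have hi : Integrable fun x : Space n => (1 + ‖x‖) ^ (-(2 * n : ℝ)) := by
    refine integrable_one_add_norm ?_
    have : (1 : ℝ) ≤ n := by exact_mod_cast hn
    simp only [finrank_euclideanSpace, Fintype.card_fin]
    linarith
  refine (hi.const_mul (((|h 0| + K) * C) ^ 2)).mono' (hm.norm.pow 2).aestronglyMeasurable (ae_of_all _ fun x => ?_)
  have h0 : 0 < 1 + ‖x‖ := by positivity
  have h1 : ‖(h x : ℂ) * absD φ x‖ ≤ (|h 0| + K) * C * ((1 + ‖x‖) ^ n)⁻¹ := by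
    rw [norm_mul, Complex.norm_real, Real.norm_eq_abs]
    calc |h x| * ‖absD φ x‖ ≤ ((|h 0| + K) * (1 + ‖x‖)) * (C * ((1 + ‖x‖) ^ (n + 1))⁻¹) := by
          gcongr
          · exact norm_le_of_lipschitz hLip x
          · exact hC x
      _ = _ := by
          rw [pow_succ]
          field_simp
  rw [Real.norm_of_nonneg (by positivity)]
  calc ‖(h x : ℂ) * absD φ x‖ ^ 2 ≤ ((|h 0| + K) * C * ((1 + ‖x‖) ^ n)⁻¹) ^ 2 := by gcongr
    _ = _ := by
      rw [mul_pow, Real.rpow_neg h0.le, inv_pow, ← pow_mul]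
      congr 2
      rw [← Real.rpow_natCast]
      congr 1
      push_cast
      ring

/-! ### The commutator norm -/

lemma IsWeightedCommutator.norm_le {h : Space n → ℝ} {f : 𝓢(Space n, ℂ)} {g : Space n → ℂ}
    (hg : IsWeightedCommutator h f g) (φ : 𝓢(Space n, ℂ))
    (hφ : MemLp (fun x => (h x : ℂ) * φ x) 2 volume) :
    ‖(∫ x, (h x : ℂ) * f x * absD φ x) - ∫ x, (h x : ℂ) * absD f x * φ x‖ ≤
      nrm g * nrm (fun x => (h x : ℂ) * φ x) := by
  rw [← hg.2 φ]
  have : ∀ x, (h x : ℂ) * g x * φ x = g x * ((h x : ℂ) * φ x) := fun x => by ring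
  simp_rw [this]
  exact norm_integral_mul_le hg.1 hφ

/-- Attainment of the infimum is never needed: a nearly optimal constant is used, and the slack is
sent to zero in the bilinear bound. -/
lemma exists_mem_commNorm_set_lt {h : Space n → ℝ} (hA : commNorm h ≠ ⊤) {δ : ℝ} (hδ : 0 < δ) :
    ∃ C : ℝ, 0 ≤ C ∧ C ≤ (commNorm h).toReal + δ ∧ ∀ f : 𝓢(Space n, ℂ), ∃ g : Space n → ℂ,
      IsWeightedCommutator h f g ∧ nrm g ≤ C * nrm f := by
  have hlt : commNorm h < commNorm h + ENNReal.ofReal δ :=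
    ENNReal.lt_add_right hA (by simpa using hδ)
  obtain ⟨C, hC, hClt⟩ := sInf_lt_iff.1 hlt
  have hCtop : C ≠ ⊤ := ne_top_of_lt hClt
  refine ⟨C.toReal, ENNReal.toReal_nonneg, ?_, fun f => ?_⟩
  · have := ENNReal.toReal_mono (ENNReal.add_ne_top.2 ⟨hA, ENNReal.ofReal_ne_top⟩) hClt.le
    rwa [ENNReal.toReal_add hA ENNReal.ofReal_ne_top, ENNReal.toReal_ofReal hδ.le] at this
  · obtain ⟨g, hg, hgC⟩ := hC f
    refine ⟨g, hg, ?_⟩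
    have hft : eLpNorm f 2 volume ≠ ⊤ := (f.memLp 2 volume).eLpNorm_ne_top
    have := ENNReal.toReal_mono (ENNReal.mul_ne_top hCtop hft) hgC
    rw [ENNReal.toReal_mul] at this
    exact this

lemma norm_commutator_le {h : Space n → ℝ} (hA : commNorm h ≠ ⊤) (f φ : 𝓢(Space n, ℂ))
    (hφ : MemLp (fun x => (h x : ℂ) * φ x) 2 volume) :
    ‖(∫ x, (h x : ℂ) * f x * absD φ x) - ∫ x, (h x : ℂ) * absD f x * φ x‖ ≤
      (commNorm h).toReal * nrm f * nrm (fun x => (h x : ℂ) * φ x) := by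
  refine le_of_forall_pos_le_add fun ε hε => ?_
  generalize hN : nrm (fun x => (h x : ℂ) * φ x) = N
  have hN0 : 0 ≤ N := hN ▸ nrm_nonneg _
  have hf0 : 0 ≤ nrm f := nrm_nonneg f
  have hδ0 : 0 < ε / (nrm f * N + 1) := by positivity
  obtain ⟨C, hC0, hC, hg⟩ := exists_mem_commNorm_set_lt hA hδ0
  obtain ⟨g, hg, hgC⟩ := hg f
  refine (hg.norm_le φ hφ).trans ?_
  rw [hN]
  have h3 : ε / (nrm f * N + 1) * (nrm f * N) ≤ ε := by
    rw [div_mul_eq_mul_div, div_le_iff₀ (by positivity)]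
    nlinarith
  calc nrm g * N ≤ ((commNorm h).toReal + ε / (nrm f * N + 1)) * nrm f * N := by
        refine mul_le_mul_of_nonneg_right (hgC.trans ?_) hN0
        exact mul_le_mul_of_nonneg_right hC hf0
    _ = (commNorm h).toReal * nrm f * N + ε / (nrm f * N + 1) * (nrm f * N) := by ring
    _ ≤ _ := by linarith

/-- The commutator of `|D|` with a Lipschitz weight whose inverse is square integrable is nonzero. -/
lemma commNorm_ne_zero (hn : 1 ≤ n) {h : Space n → ℝ} {K : ℝ≥0} (hLip : LipschitzWith K h)
    (hne : ∀ x, h x ≠ 0) (htwo : MemLp (fun x => (h x)⁻¹) 2 volume) : commNorm h ≠ 0 := by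
  intro h0
  have hnt : Nontrivial (Space n) := by
    have : Nonempty (Fin n) := ⟨⟨0, hn⟩⟩
    infer_instance
  have hcont := hLip.continuous
  -- A vanishing commutator forces `h` to be constant, and a nonzero constant is not square
  -- integrable on a space of infinite volume.
  have hconst : ∀ x y, h x ≤ h y := by
    by_contra! hcon
    obtain ⟨x₀, y₀, hxy⟩ := hcon
    obtain ⟨κ, hκ, hker⟩ := exists_absD_eq_integral hn
    -- A level strictly between the two values: `h > c` on the support of `b₁` and `h < c` on the
    -- support of `b₂`, so these supports are disjoint and `h p.1 - h p.2` is positive on their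
    -- product.
    obtain ⟨c, hc1, hc2⟩ := exists_between hxy
    obtain ⟨r₁, hr₁, hb₁⟩ := Metric.isOpen_iff.1 (isOpen_lt continuous_const hcont :
      IsOpen {x | c < h x}) x₀ hc2
    obtain ⟨r₂, hr₂, hb₂⟩ := Metric.isOpen_iff.1 (isOpen_lt hcont continuous_const :
      IsOpen {x | h x < c}) y₀ hc1
    set b₁ : ContDiffBump x₀ := ⟨r₁ / 4, r₁ / 2, by positivity, by linarith⟩ with hb₁'
    set b₂ : ContDiffBump y₀ := ⟨r₂ / 4, r₂ / 2, by positivity, by linarith⟩ with hb₂'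
    have hs₁ : ∀ x ∈ tsupport b₁, c < h x := by
      intro x hx
      rw [b₁.tsupport_eq] at hx
      exact hb₁ (Metric.closedBall_subset_ball (by simp only [hb₁']; linarith) hx)
    have hs₂ : ∀ x ∈ tsupport b₂, h x < c := by
      intro x hx
      rw [b₂.tsupport_eq] at hx
      exact hb₂ (Metric.closedBall_subset_ball (by simp only [hb₂']; linarith) hx)
    have hsupp : ∀ {z : Space n} (b : ContDiffBump z),
        tsupport (fun x => (b x : ℂ)) ⊆ tsupport b := by
      intro z b
      exact closure_mono (Function.support_comp_subset Complex.ofReal_zero b)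
    have hcs : ∀ {z : Space n} (b : ContDiffBump z), HasCompactSupport fun x => (b x : ℂ) :=
      fun b => b.hasCompactSupport.comp_left (g := ((↑) : ℝ → ℂ)) Complex.ofReal_zero
    have hcd : ∀ {z : Space n} (b : ContDiffBump z), ContDiff ℝ ∞ fun x => (b x : ℂ) :=
      fun b => Complex.ofRealCLM.contDiff.comp b.contDiff
    set f : 𝓢(Space n, ℂ) := (hcs b₁).toSchwartzMap (hcd b₁) with hf
    set φ : 𝓢(Space n, ℂ) := (hcs b₂).toSchwartzMap (hcd b₂) with hφ
    have hfx : ∀ x, f x = (b₁ x : ℂ) := fun x => rfl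
    have hφx : ∀ x, φ x = (b₂ x : ℂ) := fun x => rfl
    have hL2 : MemLp (fun x => (h x : ℂ) * φ x) 2 volume := by
      refine Continuous.memLp_of_hasCompactSupport ?_ ((hcs b₂).mul_left)
      have := φ.continuous
      fun_prop
    have hzero := norm_commutator_le (by rw [h0]; simp) f φ hL2
    rw [h0, ENNReal.toReal_zero, zero_mul, zero_mul, norm_le_zero_iff, sub_eq_zero] at hzero
    -- the double integrals
    set P : Space n × Space n → ℝ := fun p => b₁ p.1 * (b₂ p.2 * rieszKernel (p.1 - p.2)) with hP
    have hdisj : ∀ x ∈ tsupport b₁, x ∉ tsupport φ := fun x hx hx' =>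
      lt_asymm (hs₁ x hx) (hs₂ x (hsupp b₂ hx'))
    have hdisj' : ∀ x ∈ tsupport b₂, x ∉ tsupport f := fun x hx hx' =>
      lt_asymm (hs₂ x hx) (hs₁ x (hsupp b₁ hx'))
    -- The kernel is singular only on the diagonal, near which one of the two bumps vanishes
    -- identically.
    have hPc : Continuous P := by
      rw [continuous_iff_continuousAt]
      rintro ⟨x, y⟩
      by_cases hxy' : x = y
      · subst hxy'
        have : x ∉ tsupport b₁ ∨ x ∉ tsupport b₂ := by
          by_contra! hh
          exact lt_asymm (hs₁ x hh.1) (hs₂ x hh.2)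
        have hz : P =ᶠ[𝓝 (x, x)] fun _ => 0 := by
          rcases this with hx | hx
          · have := (isClosed_tsupport b₁).isOpen_compl.mem_nhds hx
            filter_upwards [continuous_fst.continuousAt.preimage_mem_nhds this] with p hp
            simp [hP, image_eq_zero_of_notMem_tsupport hp]
          · have := (isClosed_tsupport b₂).isOpen_compl.mem_nhds hx
            filter_upwards [continuous_snd.continuousAt.preimage_mem_nhds this] with p hp
            simp [hP, image_eq_zero_of_notMem_tsupport hp]
        exact (continuousAt_const.congr hz.symm)
      · have hk : ContinuousAt (fun p : Space n × Space n => rieszKernel (p.1 - p.2)) (x, y) := by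
          unfold rieszKernel
          refine ContinuousAt.inv₀ (by fun_prop) ?_
          have : ‖x - y‖ ≠ 0 := norm_ne_zero_iff.2 (sub_ne_zero.2 hxy')
          positivity
        exact (b₁.continuous.continuousAt.comp continuousAt_fst).mul
          ((b₂.continuous.continuousAt.comp continuousAt_snd).mul hk)
    have hPs : HasCompactSupport P := by
      refine HasCompactSupport.intro (b₁.hasCompactSupport.isCompact.prod
        b₂.hasCompactSupport.isCompact) fun p hp => ?_
      simp only [Set.mem_prod, not_and_or] at hp
      rcases hp with hp | hp <;> simp [hP, image_eq_zero_of_notMem_tsupport hp]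
    have hint1 : Integrable (fun p : Space n × Space n => h p.1 * P p) (volume.prod volume) :=
      Continuous.integrable_of_hasCompactSupport (by fun_prop) hPs.mul_left
    have hint2 : Integrable (fun p : Space n × Space n => h p.2 * P p) (volume.prod volume) :=
      Continuous.integrable_of_hasCompactSupport (by fun_prop) hPs.mul_left
    have hrk : ∀ x y : Space n, rieszKernel (x - y) = rieszKernel (y - x) := by
      intro x y; simp [rieszKernel, norm_sub_rev x y]
    have e1 : ∫ x, (h x : ℂ) * f x * absD φ x =
        ((-κ * ∫ p, h p.1 * P p ∂(volume.prod volume) : ℝ) : ℂ) := by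
      rw [integral_prod _ hint1]
      push_cast
      rw [← integral_complex_ofReal, ← integral_const_mul]
      congr 1
      ext x
      by_cases hx : x ∈ tsupport b₁
      · rw [hker φ x (hdisj x hx), hfx]
        simp only [hP, integral_const_mul]
        push_cast
        rw [← integral_complex_ofReal]
        push_cast
        simp only [hφx]
        ring
      · have hz := image_eq_zero_of_notMem_tsupport hx
        simp [hfx, hP, hz]
    have e2 : ∫ x, (h x : ℂ) * absD f x * φ x =
        ((-κ * ∫ p, h p.2 * P p ∂(volume.prod volume) : ℝ) : ℂ) := by
      rw [integral_prod_symm _ hint2]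
      push_cast
      rw [← integral_complex_ofReal, ← integral_const_mul]
      congr 1
      ext x
      by_cases hx : x ∈ tsupport b₂
      · rw [hker f x (hdisj' x hx), hφx]
        have : ∀ z, P (z, x) = b₂ x * (b₁ z * rieszKernel (x - z)) := by
          intro z; simp only [hP]; rw [hrk z x]; ring
        simp only [this, integral_const_mul]
        push_cast
        rw [← integral_complex_ofReal]
        push_cast
        simp only [hfx]
        ring
      · have hz := image_eq_zero_of_notMem_tsupport hx
        simp [hφx, hP, hz]
    rw [e1, e2] at hzero
    have hzero' := Complex.ofReal_injective hzero
    -- By the kernel formula the commutator pairing is `-κ` times this integral. Its integrand is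
    -- continuous, nonnegative and positive at `(x₀, y₀)`, a contradiction.
    have hd : ∫ p, (h p.1 - h p.2) * P p ∂(volume.prod volume) = 0 := by
      simp_rw [sub_mul]
      rw [integral_sub hint1 hint2, sub_eq_zero]
      exact mul_left_cancel₀ (neg_ne_zero.2 hκ.ne') hzero'
    have hP0 : ∀ p, 0 ≤ P p := fun p =>
      mul_nonneg b₁.nonneg (mul_nonneg b₂.nonneg (rieszKernel_nonneg _))
    have hnn : ∀ p, 0 ≤ (h p.1 - h p.2) * P p := by
      intro p
      by_cases hx : p.1 ∈ tsupport b₁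
      · by_cases hy : p.2 ∈ tsupport b₂
        · exact mul_nonneg (by linarith [hs₁ _ hx, hs₂ _ hy]) (hP0 p)
        · simp [hP, image_eq_zero_of_notMem_tsupport hy]
      · simp [hP, image_eq_zero_of_notMem_tsupport hx]
    have hpos : 0 < ∫ p, (h p.1 - h p.2) * P p ∂(volume.prod volume) := by
      have hc : Continuous fun p : Space n × Space n => (h p.1 - h p.2) * P p := by fun_prop
      refine hc.integral_pos_of_hasCompactSupport_nonneg_nonzero hPs.mul_left hnn (x := (x₀, y₀)) ?_
      have hx : x₀ ∈ tsupport b₁ := by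
        rw [b₁.tsupport_eq]; exact Metric.mem_closedBall_self b₁.rOut_pos.le
      have hne' : x₀ - y₀ ≠ 0 := sub_ne_zero.2 (by rintro rfl; exact lt_irrefl _ hxy)
      refine mul_ne_zero (sub_ne_zero.2 hxy.ne') (mul_ne_zero ?_ (mul_ne_zero ?_ ?_))
      · rw [b₁.one_of_mem_closedBall (Metric.mem_closedBall_self b₁.rIn_pos.le)]; exact one_ne_zero
      · rw [b₂.one_of_mem_closedBall (Metric.mem_closedBall_self b₂.rIn_pos.le)]; exact one_ne_zero
      · unfold rieszKernel
        have := norm_ne_zero_iff.2 hne'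
        positivity
    exact hpos.ne' hd
  have hc : (fun x => (h x)⁻¹) = fun _ : Space n => (h 0)⁻¹ := by
    ext x; rw [le_antisymm (hconst x 0) (hconst 0 x)]
  rw [hc, memLp_const_iff (by norm_num) (by norm_num)] at htwo
  rcases htwo with h1 | h1
  · exact inv_ne_zero (hne 0) h1
  · exact h1.ne (measure_univ_of_isAddLeftInvariant volume)

/-! ### Mollification -/

/-- The mollifier attached to a bump function. -/
def mker (ρ : ContDiffBump (0 : Space n)) (x : Space n) : ℝ := ρ.normed volume x

lemma mker_nonneg (ρ : ContDiffBump (0 : Space n)) (x : Space n) : 0 ≤ mker ρ x :=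
  ρ.nonneg_normed x

lemma mker_sub_comm (ρ : ContDiffBump (0 : Space n)) (x y : Space n) :
    mker ρ (x - y) = mker ρ (y - x) := by
  rw [← neg_sub]; exact ρ.normed_neg _

lemma contDiff_mker (ρ : ContDiffBump (0 : Space n)) : ContDiff ℝ ∞ (mker ρ) :=
  ρ.contDiff_normed

@[fun_prop] lemma continuous_mker (ρ : ContDiffBump (0 : Space n)) : Continuous (mker ρ) :=
  ρ.continuous_normed

lemma hasCompactSupport_mker (ρ : ContDiffBump (0 : Space n)) : HasCompactSupport (mker ρ) :=
  ρ.hasCompactSupport_normed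

lemma integrable_mker (ρ : ContDiffBump (0 : Space n)) : Integrable (mker ρ) :=
  ρ.integrable_normed

lemma integral_mker (ρ : ContDiffBump (0 : Space n)) : ∫ x, mker ρ x = 1 :=
  ρ.integral_normed

lemma mker_eq_zero {ρ : ContDiffBump (0 : Space n)} {x : Space n} (hx : ρ.rOut ≤ ‖x‖) :
    mker ρ x = 0 := by
  by_contra hne
  have : x ∈ Function.support (ρ.normed volume) := hne
  rw [ρ.support_normed_eq, mem_ball_zero_iff] at this
  exact absurd this (not_lt.2 hx)

/-- The mollification of `w`. -/
def moll (ρ : ContDiffBump (0 : Space n)) (w : Space n → ℂ) (x : Space n) : ℂ :=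
  ∫ y, (mker ρ (x - y) : ℂ) * w y

open Convolution in
lemma moll_eq_convolution (ρ : ContDiffBump (0 : Space n)) (w : Space n → ℂ) :
    moll ρ w = ρ.normed volume ⋆[ContinuousLinearMap.lsmul ℝ ℝ, volume] w := by
  ext x
  rw [convolution_eq_swap]
  simp [moll, mker]

lemma contDiff_moll (ρ : ContDiffBump (0 : Space n)) {w : Space n → ℂ}
    (hw : LocallyIntegrable w volume) : ContDiff ℝ ∞ (moll ρ w) := by
  rw [moll_eq_convolution]
  exact ρ.hasCompactSupport_normed.contDiff_convolution_left _ ρ.contDiff_normed hw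

lemma moll_eq_zero {ρ : ContDiffBump (0 : Space n)} {w : Space n → ℂ} {R : ℝ}
    (hw : ∀ x, R < ‖x‖ → w x = 0) {x : Space n} (hx : R + ρ.rOut < ‖x‖) : moll ρ w x = 0 := by
  unfold moll
  rw [← integral_zero (Space n) ℂ (μ := volume)]
  congr 1
  ext y
  rcases lt_or_ge R ‖y‖ with hy | hy
  · rw [hw y hy, mul_zero]
  · rw [mker_eq_zero]; · simp
    have := norm_sub_norm_le x y
    linarith

lemma hasCompactSupport_of_zero {E : Type*} [Zero E] {w : Space n → E} {R : ℝ} (hw : ∀ x, R < ‖x‖ → w x = 0) :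
    HasCompactSupport w :=
  HasCompactSupport.intro (isCompact_closedBall (0 : Space n) R) fun x hx => hw x (by simpa using hx)

lemma exists_zero_of_hasCompactSupport {E : Type*} [Zero E] {w : Space n → E} (hw : HasCompactSupport w) :
    ∃ R : ℝ, 0 ≤ R ∧ ∀ x, R < ‖x‖ → w x = 0 := by
  obtain ⟨R, hR⟩ := hw.isBounded.subset_closedBall (0 : Space n)
  refine ⟨max R 0, le_max_right _ _, fun x hx => ?_⟩
  by_contra hne
  have := hR (subset_tsupport _ hne)
  rw [mem_closedBall_zero_iff] at this
  exact absurd hx (not_lt.2 (this.trans (le_max_left _ _)))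

lemma integrable_mker_mul (ρ : ContDiffBump (0 : Space n)) {w : Space n → ℂ}
    (hw : LocallyIntegrable w volume) (x : Space n) :
    Integrable fun y => (mker ρ (x - y) : ℂ) * w y := by
  have hc : Continuous fun y => mker ρ (x - y) := by fun_prop
  have hs : HasCompactSupport fun y => mker ρ (x - y) :=
    (hasCompactSupport_mker ρ).comp_homeomorph (Homeomorph.subLeft x)
  simpa using hw.integrable_smul_left_of_hasCompactSupport hc hs

lemma moll_add (ρ : ContDiffBump (0 : Space n)) {v w : Space n → ℂ}
    (hv : LocallyIntegrable v volume) (hw : LocallyIntegrable w volume) (x : Space n) :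
    moll ρ (fun y => v y + w y) x = moll ρ v x + moll ρ w x := by
  unfold moll
  rw [← integral_add (integrable_mker_mul ρ hv x) (integrable_mker_mul ρ hw x)]
  simp_rw [mul_add]

lemma moll_sub (ρ : ContDiffBump (0 : Space n)) {v w : Space n → ℂ}
    (hv : LocallyIntegrable v volume) (hw : LocallyIntegrable w volume) (x : Space n) :
    moll ρ (fun y => v y - w y) x = moll ρ v x - moll ρ w x := by
  unfold moll
  rw [← integral_sub (integrable_mker_mul ρ hv x) (integrable_mker_mul ρ hw x)]
  simp_rw [mul_sub]

lemma moll_conj (ρ : ContDiffBump (0 : Space n)) (w : Space n → ℂ) (x : Space n) :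
    moll ρ (fun y => (starRingEnd ℂ) (w y)) x = (starRingEnd ℂ) (moll ρ w x) := by
  unfold moll
  rw [← integral_conj]
  simp

lemma lintegral_ofReal_mker (ρ : ContDiffBump (0 : Space n)) :
    ∫⁻ y, ENNReal.ofReal (mker ρ y) = 1 := by
  rw [← ofReal_integral_eq_lintegral_ofReal (integrable_mker ρ) (ae_of_all _ (mker_nonneg ρ)),
    integral_mker, ENNReal.ofReal_one]

/-- Jensen's inequality for the probability measure with density `mker ρ (x - ·)`, in the form of
monotonicity of `L^r` norms in `r`. -/
lemma enorm_moll_rpow_le (ρ : ContDiffBump (0 : Space n)) {w : Space n → ℂ}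
    (hw : AEStronglyMeasurable w volume) {r : ℝ} (hr : 1 ≤ r) (x : Space n) :
    ‖moll ρ w x‖ₑ ^ r ≤ ∫⁻ y, ENNReal.ofReal (mker ρ (x - y)) * ‖w y‖ₑ ^ r := by
  set d : Space n → ℝ≥0∞ := fun y => ENNReal.ofReal (mker ρ (x - y)) with hd
  have hdm : Measurable d := by
    have : Continuous fun y => mker ρ (x - y) := by fun_prop
    exact this.measurable.ennreal_ofReal
  have hprob : IsProbabilityMeasure (volume.withDensity d) := by
    constructor
    rw [withDensity_apply _ MeasurableSet.univ, setLIntegral_univ, hd,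
      lintegral_sub_left_eq_self (fun y => ENNReal.ofReal (mker ρ y)), lintegral_ofReal_mker]
  have hwd : AEStronglyMeasurable w (volume.withDensity d) :=
    hw.mono_ac (withDensity_absolutelyContinuous _ _)
  have h1 : ‖moll ρ w x‖ₑ ≤ ∫⁻ y, ‖w y‖ₑ ∂(volume.withDensity d) := by
    refine (enorm_integral_le_lintegral_enorm _).trans_eq ?_
    rw [lintegral_withDensity_eq_lintegral_mul₀ hdm.aemeasurable hw.enorm]
    refine lintegral_congr fun y => ?_
    simp only [Pi.mul_apply, hd, enorm_mul]
    congr 1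
    rw [← ofReal_norm, Complex.norm_real, Real.norm_of_nonneg (mker_nonneg _ _)]
  have h2 := eLpNorm'_le_eLpNorm'_of_exponent_le (μ := volume.withDensity d) one_pos hr hwd
  simp only [eLpNorm', ENNReal.rpow_one, div_one] at h2
  have h3 := ENNReal.rpow_le_rpow (h1.trans h2) (zero_le_one.trans hr)
  rw [← ENNReal.rpow_mul, one_div, inv_mul_cancel₀ (by positivity), ENNReal.rpow_one] at h3
  refine h3.trans_eq ?_
  rw [lintegral_withDensity_eq_lintegral_mul₀ hdm.aemeasurable (hw.enorm.pow_const r)]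
  rfl

lemma lintegral_enorm_moll_rpow_le (ρ : ContDiffBump (0 : Space n)) {w : Space n → ℂ}
    (hw : AEStronglyMeasurable w volume) {r : ℝ} (hr : 1 ≤ r) :
    ∫⁻ x, ‖moll ρ w x‖ₑ ^ r ≤ ∫⁻ y, ‖w y‖ₑ ^ r := by
  refine (lintegral_mono fun x => enorm_moll_rpow_le ρ hw hr x).trans_eq ?_
  have hc : Continuous fun p : Space n × Space n => mker ρ (p.1 - p.2) := by fun_prop
  rw [lintegral_lintegral_swap]
  · refine lintegral_congr fun y => ?_
    rw [lintegral_mul_const]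
    · rw [lintegral_sub_right_eq_self (fun z => ENNReal.ofReal (mker ρ z)),
        lintegral_ofReal_mker, one_mul]
    · have : Continuous fun x => mker ρ (x - y) := by fun_prop
      exact this.measurable.ennreal_ofReal
  · refine AEMeasurable.mul hc.measurable.ennreal_ofReal.aemeasurable ?_
    exact (hw.enorm.pow_const r).comp_quasiMeasurePreserving Measure.quasiMeasurePreserving_snd

lemma eLpNorm_moll_le (ρ : ContDiffBump (0 : Space n)) {w : Space n → ℂ}
    (hw : AEStronglyMeasurable w volume) {r : ℝ≥0∞} (hr : 1 ≤ r) (hr' : r ≠ ⊤) :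
    eLpNorm (moll ρ w) r volume ≤ eLpNorm w r volume := by
  have h0 : r ≠ 0 := (zero_lt_one.trans_le hr).ne'
  have h1 : 1 ≤ r.toReal := by
    rw [← ENNReal.toReal_one]; exact ENNReal.toReal_mono hr' hr
  rw [eLpNorm_eq_lintegral_rpow_enorm_toReal h0 hr', eLpNorm_eq_lintegral_rpow_enorm_toReal h0 hr']
  exact ENNReal.rpow_le_rpow (lintegral_enorm_moll_rpow_le ρ hw h1) (by positivity)

lemma memLp_moll (ρ : ContDiffBump (0 : Space n)) {w : Space n → ℂ} {r : ℝ≥0∞}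
    (hw : MemLp w r volume) (hr : 1 ≤ r) (hr' : r ≠ ⊤) : MemLp (moll ρ w) r volume :=
  ⟨(contDiff_moll ρ (hw.locallyIntegrable hr)).continuous.aestronglyMeasurable,
    (eLpNorm_moll_le ρ hw.1 hr hr').trans_lt hw.2⟩

/-- By contractivity in `L^r` it suffices to treat continuous functions of compact support, where
uniform continuity gives uniform convergence inside a fixed ball. -/
lemma tendsto_eLpNorm_moll_sub {ρ : ℕ → ContDiffBump (0 : Space n)}
    (hρ : Tendsto (fun m => (ρ m).rOut) atTop (𝓝 0)) {w : Space n → ℂ} {r : ℝ≥0∞}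
    (hw : MemLp w r volume) (hr : 1 ≤ r) (hr' : r ≠ ⊤) :
    Tendsto (fun m => eLpNorm (fun x => moll (ρ m) w x - w x) r volume) atTop (𝓝 0) := by
  rw [ENNReal.tendsto_nhds_zero]
  intro ε hε
  obtain ⟨g, hgs, hge, hgc, hgm⟩ := hw.exists_hasCompactSupport_eLpNorm_sub_le hr'
    (ε := ε / 3) (by simpa using hε.ne')
  obtain ⟨R, hR0, hR⟩ := exists_zero_of_hasCompactSupport hgs
  have huc : UniformContinuous g := hgs.uniformContinuous_of_continuous hgc
  set s : Set (Space n) := Metric.closedBall 0 (R + 1) with hs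
  have hsm : volume s ≠ ⊤ := (isCompact_closedBall _ _).measure_lt_top.ne
  obtain ⟨c, hc0, hc⟩ : ∃ c : ℝ, 0 < c ∧ ENNReal.ofReal c * volume s ^ (1 / r.toReal) ≤ ε / 3 := by
    have hV : volume s ^ (1 / r.toReal) ≠ ⊤ := by
      refine ENNReal.rpow_ne_top_of_nonneg (by positivity) hsm
    have h3 : ε / 3 ≠ 0 := by simpa using hε.ne'
    obtain ⟨c, hc0, hc⟩ := ENNReal.exists_nnreal_pos_mul_lt hV h3
    exact ⟨c, hc0, by rw [ENNReal.ofReal_coe_nnreal]; exact hc.le⟩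
  obtain ⟨δ, hδ, hδc⟩ := Metric.uniformContinuous_iff.1 huc c hc0
  filter_upwards [hρ.eventually (gt_mem_nhds hδ), hρ.eventually (gt_mem_nhds one_pos)] with m h1 h2
  have hwl := hw.locallyIntegrable hr
  have hgl := hgm.locallyIntegrable hr
  have e : (fun x => moll (ρ m) w x - w x) = fun x =>
      (moll (ρ m) (fun y => w y - g y) x + (moll (ρ m) g x - g x)) - (w x - g x) := by
    ext x; rw [moll_sub _ hwl hgl]; ring
  rw [e]
  have hA : AEStronglyMeasurable (moll (ρ m) (fun y => w y - g y)) volume :=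
    (contDiff_moll _ (hwl.sub hgl)).continuous.aestronglyMeasurable
  have hB : AEStronglyMeasurable (fun x => moll (ρ m) g x - g x) volume :=
    ((contDiff_moll _ hgl).continuous.sub hgc).aestronglyMeasurable
  have hC : AEStronglyMeasurable (fun x => w x - g x) volume := hw.1.sub hgm.1
  have hB' : eLpNorm (fun x => moll (ρ m) g x - g x) r volume ≤ ε / 3 := by
    refine le_trans (eLpNorm_sub_le_of_dist_bdd volume hr' Metric.isClosed_closedBall.measurableSet
      hc0.le (fun x => ?_) ?_ ?_) hc
    · rw [moll_eq_convolution]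
      refine ContDiffBump.dist_normed_convolution_le hgc.aestronglyMeasurable fun y hy => ?_
      exact (hδc (lt_trans hy h1)).le
    · intro x hx
      by_contra hxs
      rw [mem_closedBall_zero_iff, not_le] at hxs
      exact hx (moll_eq_zero hR (by linarith))
    · intro x hx
      by_contra hxs
      rw [mem_closedBall_zero_iff, not_le] at hxs
      exact hx (hR x (by linarith))
  refine (eLpNorm_sub_le (hA.add hB) hC hr).trans ?_
  refine (add_le_add (eLpNorm_add_le hA hB hr) le_rfl).trans ?_
  have hA' := (eLpNorm_moll_le (ρ m) hC hr hr').trans hge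
  calc _ ≤ ε / 3 + ε / 3 + ε / 3 := add_le_add (add_le_add hA' hB') hge
    _ = ε := ENNReal.add_thirds ε

/-- Fubini with an even kernel. Integrability of the double integrand comes from bounding the
product `|a||b|` by the sum of the squares. -/
lemma integral_mul_moll (ρ : ContDiffBump (0 : Space n)) {a b : Space n → ℂ}
    (ha : MemLp a 2 volume) (hb : MemLp b 2 volume) :
    ∫ x, a x * moll ρ b x = ∫ x, moll ρ a x * b x := by
  set F : Space n → Space n → ℂ := fun x y => a x * ((mker ρ (x - y) : ℂ) * b y) with hF
  have hFi : Integrable (Function.uncurry F) (volume.prod volume) := by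
    have ha2 : Integrable fun x => ‖a x‖ ^ 2 := ha.norm.integrable_sq
    have hb2 : Integrable fun x => ‖b x‖ ^ 2 := hb.norm.integrable_sq
    have i1 : Integrable (fun p : Space n × Space n => ‖b p.2‖ ^ 2 * mker ρ (p.1 - p.2))
      (volume.prod volume) :=
      hb2.convolution_integrand (ContinuousLinearMap.mul ℝ ℝ) (integrable_mker ρ)
    have i2 : Integrable (fun p : Space n × Space n => ‖a p.2‖ ^ 2 * mker ρ (p.1 - p.2))
      (volume.prod volume) :=
      ha2.convolution_integrand (ContinuousLinearMap.mul ℝ ℝ) (integrable_mker ρ)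
    refine (i1.add i2.swap).mono' ?_ (ae_of_all _ fun p => ?_)
    · refine (ha.1.comp_quasiMeasurePreserving Measure.quasiMeasurePreserving_fst).mul
        (AEStronglyMeasurable.mul ?_
          (hb.1.comp_quasiMeasurePreserving Measure.quasiMeasurePreserving_snd))
      exact (by fun_prop : Continuous fun p : Space n × Space n =>
        (mker ρ (p.1 - p.2) : ℂ)).aestronglyMeasurable
    · simp only [Function.uncurry, hF, norm_mul, Complex.norm_real, Pi.add_apply, Function.comp,
        Prod.fst_swap, Prod.snd_swap]
      rw [Real.norm_of_nonneg (mker_nonneg _ _), mker_sub_comm ρ p.2 p.1]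
      have := mker_nonneg ρ (p.1 - p.2)
      nlinarith [mul_nonneg this (sq_nonneg (‖a p.1‖ - ‖b p.2‖)),
        mul_nonneg this (sq_nonneg (‖a p.1‖)), mul_nonneg this (sq_nonneg (‖b p.2‖))]
  have h := integral_integral_swap hFi
  have e1 : ∀ x, ∫ y, F x y = a x * moll ρ b x := fun x => by
    simp only [hF, integral_const_mul]; rfl
  have e2 : ∀ y, ∫ x, F x y = moll ρ a y * b y := fun y => by
    unfold moll
    rw [← integral_mul_const]
    congr 1
    ext x
    simp only [hF]
    rw [mker_sub_comm]
    ring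
  simp_rw [e1, e2] at h
  exact h

lemma nrm_moll_le (ρ : ContDiffBump (0 : Space n)) {w : Space n → ℂ} (hw : MemLp w 2 volume) :
    nrm (moll ρ w) ≤ nrm w :=
  ENNReal.toReal_mono hw.eLpNorm_ne_top (eLpNorm_moll_le ρ hw.1 (by norm_num) (by norm_num))

lemma memLp_mker (ρ : ContDiffBump (0 : Space n)) : MemLp (fun x => (mker ρ x : ℂ)) 2 volume :=
  Continuous.memLp_of_hasCompactSupport (by fun_prop)
    ((hasCompactSupport_mker ρ).comp_left (g := ((↑) : ℝ → ℂ)) Complex.ofReal_zero)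

lemma norm_moll_le (ρ : ContDiffBump (0 : Space n)) {w : Space n → ℂ} (hw : MemLp w 2 volume)
    (x : Space n) : ‖moll ρ w x‖ ≤ nrm (fun y => (mker ρ y : ℂ)) * nrm w := by
  have hmp := Measure.measurePreserving_sub_left (volume : Measure (Space n)) x
  have hk := memLp_mker ρ
  set k : Space n → ℂ := fun y => (mker ρ y : ℂ) with hkd
  have e : (fun y => (mker ρ (x - y) : ℂ)) = k ∘ (fun y => x - y) := rfl
  have h1 : MemLp (fun y => (mker ρ (x - y) : ℂ)) 2 volume := by
    rw [e]; exact hk.comp_measurePreserving hmp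
  have h2 : nrm (fun y => (mker ρ (x - y) : ℂ)) = nrm k := by
    rw [e]
    unfold nrm
    rw [eLpNorm_comp_measurePreserving hk.1 hmp]
  rw [← h2]
  exact norm_integral_mul_le h1 hw

lemma exists_lipschitz_mker (ρ : ContDiffBump (0 : Space n)) : ∃ K : ℝ≥0, LipschitzWith K (mker ρ) :=
  ContDiff.lipschitzWith_of_hasCompactSupport (hasCompactSupport_mker ρ) (contDiff_mker ρ) (by simp)

lemma norm_moll_sub_le (ρ : ContDiffBump (0 : Space n)) {K : ℝ≥0} (hK : LipschitzWith K (mker ρ))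
    {w : Space n → ℂ} (hw : Integrable w) (x x' : Space n) :
    ‖moll ρ w x - moll ρ w x'‖ ≤ K * (∫ y, ‖w y‖) * ‖x - x'‖ := by
  unfold moll
  rw [← integral_sub (integrable_mker_mul ρ hw.locallyIntegrable x)
    (integrable_mker_mul ρ hw.locallyIntegrable x')]
  refine (norm_integral_le_of_norm_le (hw.norm.const_mul (K * ‖x - x'‖))
    (ae_of_all _ fun y => ?_)).trans_eq ?_
  · rw [← sub_mul, norm_mul]
    gcongr
    rw [← Complex.ofReal_sub, Complex.norm_real]
    have := hK.dist_le_mul (x - y) (x' - y)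
    rwa [dist_eq_norm, dist_eq_norm, sub_sub_sub_cancel_right] at this
  · rw [integral_const_mul]; ring

/-- A mollification is an average of translates, and averaging does not increase the Lipschitz
constant. -/
lemma lipschitzWith_moll (ρ : ContDiffBump (0 : Space n)) {K : ℝ≥0} {w : Space n → ℂ}
    (hw : LipschitzWith K w) : LipschitzWith K (moll ρ w) := by
  have hl : LocallyIntegrable w volume := hw.continuous.locallyIntegrable
  have hsub : ∀ x, moll ρ w x = ∫ z, (mker ρ z : ℂ) * w (x - z) := by
    intro x
    unfold moll
    rw [← integral_sub_left_eq_self _ volume x]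
    simp
  have hi : ∀ x, Integrable fun z => (mker ρ z : ℂ) * w (x - z) := by
    intro x
    have := (integrable_mker_mul ρ hl x).comp_sub_left x
    simpa using this
  refine LipschitzWith.of_dist_le_mul fun x x' => ?_
  rw [dist_eq_norm, hsub, hsub, ← integral_sub (hi x) (hi x')]
  refine (norm_integral_le_of_norm_le ((integrable_mker ρ).mul_const (K * dist x x'))
    (ae_of_all _ fun z => ?_)).trans_eq ?_
  · rw [← mul_sub, norm_mul, Complex.norm_real, Real.norm_of_nonneg (mker_nonneg _ _)]
    gcongr
    · exact mker_nonneg _ _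
    have := hw.dist_le_mul (x - z) (x' - z)
    rwa [dist_eq_norm, dist_sub_right] at this
  · rw [integral_mul_const, integral_mker, one_mul]

/-! ### Test functions and density -/

/-- Smooth functions with compact support. -/
structure IsTest (φ : Space n → ℂ) : Prop where
  contDiff : ContDiff ℝ ∞ φ
  hasCompactSupport : HasCompactSupport φ

/-- A test function as a Schwartz function. -/
def IsTest.toSchwartz {φ : Space n → ℂ} (hφ : IsTest φ) : 𝓢(Space n, ℂ) :=
  hφ.hasCompactSupport.toSchwartzMap hφ.contDiff

@[simp] lemma IsTest.coe_toSchwartz {φ : Space n → ℂ} (hφ : IsTest φ) : ⇑hφ.toSchwartz = φ := rfl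

lemma IsTest.memLp {φ : Space n → ℂ} (hφ : IsTest φ) (p : ℝ≥0∞) : MemLp φ p volume :=
  hφ.contDiff.continuous.memLp_of_hasCompactSupport hφ.hasCompactSupport

lemma IsTest.integrable {φ : Space n → ℂ} (hφ : IsTest φ) : Integrable φ :=
  hφ.contDiff.continuous.integrable_of_hasCompactSupport hφ.hasCompactSupport

lemma IsTest.conj {φ : Space n → ℂ} (hφ : IsTest φ) : IsTest fun x => (starRingEnd ℂ) (φ x) :=
  ⟨Complex.conjCLE.contDiff.comp hφ.contDiff,
    hφ.hasCompactSupport.comp_left (g := (starRingEnd ℂ)) (map_zero _)⟩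

lemma IsTest.memLp_weight_mul_absD {φ : Space n → ℂ} (hφ : IsTest φ) (hn : 1 ≤ n) {h : Space n → ℝ}
    {K : ℝ≥0} (hLip : LipschitzWith K h) : MemLp (fun x => (h x : ℂ) * absD φ x) 2 volume :=
  FracGL.memLp_weight_mul_absD hn hLip hφ.toSchwartz hφ.hasCompactSupport

lemma IsTest.memLp_absD {φ : Space n → ℂ} (hφ : IsTest φ) (hn : 1 ≤ n) :
    MemLp (absD φ) 2 volume := by
  have := hφ.memLp_weight_mul_absD hn (LipschitzWith.const (1 : ℝ))
  simpa using this

lemma IsTest.moll {φ : Space n → ℂ} (hφ : IsTest φ) (ρ : ContDiffBump (0 : Space n)) :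
    IsTest (moll ρ φ) := by
  obtain ⟨R, -, hR⟩ := exists_zero_of_hasCompactSupport hφ.hasCompactSupport
  exact ⟨contDiff_moll ρ hφ.integrable.locallyIntegrable,
    hasCompactSupport_of_zero fun x hx => moll_eq_zero hR hx⟩

lemma exists_seq_isTest {v : Space n → ℂ} (hv : MemLp v 2 volume) :
    ∃ f : ℕ → Space n → ℂ, (∀ k, IsTest (f k)) ∧
      Tendsto (fun k => nrm (fun x => f k x - v x)) atTop (𝓝 0) := by
  have h : ∀ k : ℕ, ∃ g, HasCompactSupport g ∧ ContDiff ℝ ∞ g ∧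
      eLpNorm (v - g) 2 volume ≤ ENNReal.ofReal (1 / ((k : ℝ) + 1)) := fun k =>
    hv.exist_eLpNorm_sub_le (by norm_num) (by norm_num) (by positivity)
  choose g hg1 hg2 hg3 using h
  refine ⟨g, fun k => ⟨hg2 k, hg1 k⟩, ?_⟩
  refine squeeze_zero (fun k => nrm_nonneg _) (fun k => ?_) tendsto_one_div_add_atTop_nhds_zero_nat
  unfold nrm
  refine ENNReal.toReal_le_of_le_ofReal (by positivity) ?_
  have := hg3 k
  rw [eLpNorm_sub_comm] at this
  exact this

lemma abs_nrm_sub_le {f g : Space n → ℂ} (hf : MemLp f 2 volume) (hg : MemLp g 2 volume) :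
    |nrm f - nrm g| ≤ nrm (fun x => f x - g x) := by
  have hfg : MemLp (fun x => f x - g x) 2 volume := hf.sub hg
  have h1 := nrm_add_le hfg hg
  have h2 := nrm_sub_le hf hfg
  simp only [sub_add_cancel, sub_sub_cancel] at h1 h2
  rw [abs_le]; constructor <;> linarith

lemma tendsto_nrm {v : Space n → ℂ} {f : ℕ → Space n → ℂ} (hv : MemLp v 2 volume)
    (hf : ∀ k, MemLp (f k) 2 volume)
    (h : Tendsto (fun k => nrm (fun x => f k x - v x)) atTop (𝓝 0)) :
    Tendsto (fun k => nrm (f k)) atTop (𝓝 (nrm v)) := by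
  rw [tendsto_iff_norm_sub_tendsto_zero]
  exact squeeze_zero (fun k => norm_nonneg _) (fun k => abs_nrm_sub_le (hf k) hv) h

lemma tendsto_integral_mul {v G : Space n → ℂ} {f : ℕ → Space n → ℂ} (hv : MemLp v 2 volume)
    (hf : ∀ k, MemLp (f k) 2 volume) (hG : MemLp G 2 volume)
    (h : Tendsto (fun k => nrm (fun x => f k x - v x)) atTop (𝓝 0)) :
    Tendsto (fun k => ∫ x, f k x * G x) atTop (𝓝 (∫ x, v x * G x)) := by
  rw [tendsto_iff_norm_sub_tendsto_zero]
  have h' := h.mul_const (nrm G)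
  rw [zero_mul] at h'
  refine squeeze_zero (fun k => norm_nonneg _) (fun k => ?_) h'
  have i1 : Integrable fun x => f k x * G x := (hf k).integrable_mul hG
  have i2 : Integrable fun x => v x * G x := hv.integrable_mul hG
  rw [← integral_sub i1 i2]
  simp_rw [← sub_mul]
  exact norm_integral_mul_le ((hf k).sub hv) hG

/-- Both sides are continuous in `L²`, where test functions are dense. Here `C` may be much smaller
than the norm of `G` obtained from its pointwise decay; the point is to retain that sharper
constant. -/
lemma norm_integral_mul_le_of_dense {G : Space n → ℂ} (hG : MemLp G 2 volume) {C : ℝ}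
    (h : ∀ f : Space n → ℂ, IsTest f → ‖∫ x, f x * G x‖ ≤ C * nrm f) {v : Space n → ℂ}
    (hv : MemLp v 2 volume) : ‖∫ x, v x * G x‖ ≤ C * nrm v := by
  obtain ⟨f, hf, hlim⟩ := exists_seq_isTest hv
  exact le_of_tendsto_of_tendsto
    (tendsto_integral_mul hv (fun k => (hf k).memLp 2) hG hlim).norm
    ((tendsto_nrm hv (fun k => (hf k).memLp 2) hlim).const_mul C)
    (Eventually.of_forall fun k => h (f k) (hf k))

/-- The constant in the bound of the form `∫ |D| f g` by the `L²` norm of `f`, for a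
`K`-Lipschitz function `g` with support in the ball of radius `R`. -/
def energyConst (n : ℕ) (K R : ℝ) : ℝ :=
  √(n * (K ^ 2 * volume.real (Metric.closedBall (0 : Space n) R)))

lemma norm_integral_mul_absD_le (hn : 1 ≤ n) {v g : Space n → ℂ} (hv : MemLp v 2 volume)
    (hg : IsTest g) {K : ℝ≥0} {R : ℝ} (hK : LipschitzWith K g) (hR : ∀ x, R < ‖x‖ → g x = 0) :
    ‖∫ x, v x * absD g x‖ ≤ energyConst n K R * nrm v := by
  refine norm_integral_mul_le_of_dense (hg.memLp_absD hn) (fun f hf => ?_) hv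
  have h1 := integral_absD_mul_comm hf.toSchwartz hg.toSchwartz
  simp only [IsTest.coe_toSchwartz] at h1
  rw [← h1]
  refine norm_integral_absD_mul_le_of_lipschitz hf.toSchwartz hg.toSchwartz hK ?_
  refine closure_minimal (fun x hx => ?_) Metric.isClosed_closedBall
  by_contra hxs
  rw [mem_closedBall_zero_iff, not_le] at hxs
  exact hx (hR x hxs)

lemma absD_sub {φ ψ : Space n → ℂ} (hφ : IsTest φ) (hψ : IsTest ψ) (x : Space n) :
    absD (fun y => φ y - ψ y) x = absD φ x - absD ψ x := by
  have h1 := absD_add hφ.toSchwartz ((-1 : ℂ) • hψ.toSchwartz) x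
  have h2 := absD_const_mul (-1) hψ.toSchwartz x
  have e : (fun y => φ y - ψ y) = fun y => hφ.toSchwartz y + ((-1 : ℂ) • hψ.toSchwartz) y := by
    ext y; simp [sub_eq_add_neg]
  have e2 : (⇑((-1 : ℂ) • hψ.toSchwartz) : Space n → ℂ) = fun y => (-1) * hψ.toSchwartz y := by
    ext y; simp
  rw [e, h1, e2, h2]
  simp [sub_eq_add_neg]

/-! ### Moving a mollification through `|D|` -/

open Convolution in
lemma fourier_moll (ρ : ContDiffBump (0 : Space n)) {f : Space n → ℂ} (hf : Integrable f)
    (ξ : Space n) : 𝓕 (moll ρ f) ξ = 𝓕 (fun x => (mker ρ x : ℂ)) ξ * 𝓕 f ξ := by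
  have hi : Integrable fun x => (mker ρ x : ℂ) := (integrable_mker ρ).ofReal
  have e : moll ρ f = (fun x => (mker ρ x : ℂ)) ⋆[ContinuousLinearMap.mul ℂ ℂ, volume] f := by
    ext x
    rw [convolution_eq_swap]
    rfl
  rw [← Real.fourier_mul_convolution_eq hi hf, e]

lemma fourier_mker_neg (ρ : ContDiffBump (0 : Space n)) (ξ : Space n) :
    𝓕 (fun x => (mker ρ x : ℂ)) (-ξ) = 𝓕 (fun x => (mker ρ x : ℂ)) ξ := by
  rw [Real.fourier_eq', Real.fourier_eq', ← integral_neg_eq_self]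
  congr 1
  ext x
  have : mker ρ (-x) = mker ρ x := ρ.normed_neg x
  simp [this]

/-- Mollification and `|D|` are both Fourier multipliers with even symbols, so a mollification may
be moved to the other factor across `|D|`. -/
lemma integral_mul_absD_moll {f g : Space n → ℂ} (hf : IsTest f) (hg : IsTest g)
    (ρ : ContDiffBump (0 : Space n)) :
    ∫ x, f x * absD (moll ρ g) x = ∫ x, moll ρ f x * absD g x := by
  have h1 := integral_absD_mul_comm hf.toSchwartz (hg.moll ρ).toSchwartz
  have h2 := integral_absD_mul_comm (hf.moll ρ).toSchwartz hg.toSchwartz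
  have h3 := integral_absD_mul_eq hf.toSchwartz (hg.moll ρ).integrable
  have h4 := integral_absD_mul_eq (hf.moll ρ).toSchwartz hg.integrable
  simp only [IsTest.coe_toSchwartz] at h1 h2 h3 h4
  rw [← h1, ← h2, h3, h4]
  congr 1
  ext ξ
  rw [fourier_moll ρ hf.integrable, Real.fourierInv_eq_fourier_neg, Real.fourierInv_eq_fourier_neg,
    fourier_moll ρ hg.integrable, fourier_mker_neg]
  ring

/-! ### The smoothing operator -/

lemma cutoff_eq_zero {R : ℝ} (hR : 0 < R) {x : Space n} (hx : 2 * R < ‖x‖) : cutoff R x = 0 := by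
  refine unitBump.zero_of_le_dist ?_
  change (2 : ℝ) ≤ _
  rw [dist_zero_right, norm_smul, norm_inv, Real.norm_of_nonneg hR.le, le_inv_mul_iff₀ hR]
  linarith

@[fun_prop] lemma continuous_cutoff (R : ℝ) : Continuous (cutoff (n := n) R) :=
  (contDiff_cutoff R).continuous

lemma norm_cutoff_mul_le (R : ℝ) (w : Space n → ℂ) (x : Space n) :
    ‖(cutoff R x : ℂ) * w x‖ ≤ ‖w x‖ := by
  rw [norm_mul, Complex.norm_real, Real.norm_of_nonneg (cutoff_nonneg R x)]
  exact mul_le_of_le_one_left (norm_nonneg _) (cutoff_le_one R x)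

lemma memLp_cutoff_mul (R : ℝ) {w : Space n → ℂ} {r : ℝ≥0∞} (hw : MemLp w r volume) :
    MemLp (fun x => (cutoff R x : ℂ) * w x) r volume := by
  refine hw.mono ?_ (ae_of_all _ fun x => norm_cutoff_mul_le R w x)
  exact (by fun_prop : Continuous fun x : Space n => (cutoff R x : ℂ)).aestronglyMeasurable.mul hw.1

lemma nrm_cutoff_mul_le (R : ℝ) {w : Space n → ℂ} (hw : MemLp w 2 volume) :
    nrm (fun x => (cutoff R x : ℂ) * w x) ≤ nrm w :=
  nrm_mono hw (ae_of_all _ fun x => norm_cutoff_mul_le R w x)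

/-- The smoothing operator: mollify, cut off at scale `R`, and mollify again. -/
def smoother (ρ : ContDiffBump (0 : Space n)) (R : ℝ) (w : Space n → ℂ) : Space n → ℂ :=
  moll ρ fun x => (cutoff R x : ℂ) * moll ρ w x

lemma memLp_cutoff_moll (ρ : ContDiffBump (0 : Space n)) (R : ℝ) {w : Space n → ℂ} {r : ℝ≥0∞}
    (hw : MemLp w r volume) (hr : 1 ≤ r) (hr' : r ≠ ⊤) :
    MemLp (fun x => (cutoff R x : ℂ) * moll ρ w x) r volume :=
  memLp_cutoff_mul R (memLp_moll ρ hw hr hr')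

lemma smoother_eq_zero {ρ : ContDiffBump (0 : Space n)} {R : ℝ} (hR : 0 < R) (hρ : ρ.rOut ≤ 1)
    (w : Space n → ℂ) {x : Space n} (hx : 2 * R + 1 < ‖x‖) : smoother ρ R w x = 0 :=
  moll_eq_zero (R := 2 * R) (fun y hy => by rw [cutoff_eq_zero hR hy]; simp) (by linarith)

lemma isTest_cutoff_moll (ρ : ContDiffBump (0 : Space n)) {R : ℝ} (hR : 0 < R) {w : Space n → ℂ}
    (hw : LocallyIntegrable w volume) : IsTest fun x => (cutoff R x : ℂ) * moll ρ w x := by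
  constructor
  · exact (Complex.ofRealCLM.contDiff.comp (contDiff_cutoff R)).mul (contDiff_moll ρ hw)
  · exact hasCompactSupport_of_zero (R := 2 * R) fun y hy => by rw [cutoff_eq_zero hR hy]; simp

lemma isTest_smoother (ρ : ContDiffBump (0 : Space n)) {R : ℝ} (hR : 0 < R) {w : Space n → ℂ}
    (hw : LocallyIntegrable w volume) : IsTest (smoother ρ R w) :=
  (isTest_cutoff_moll ρ hR hw).moll ρ

lemma smoother_add (ρ : ContDiffBump (0 : Space n)) {R : ℝ} (hR : 0 < R) {v w : Space n → ℂ}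
    (hv : LocallyIntegrable v volume) (hw : LocallyIntegrable w volume) (x : Space n) :
    smoother ρ R (fun y => v y + w y) x = smoother ρ R v x + smoother ρ R w x := by
  unfold smoother
  rw [← moll_add ρ (isTest_cutoff_moll ρ hR hv).integrable.locallyIntegrable
    (isTest_cutoff_moll ρ hR hw).integrable.locallyIntegrable]
  simp_rw [moll_add ρ hv hw, mul_add]

lemma smoother_sub (ρ : ContDiffBump (0 : Space n)) {R : ℝ} (hR : 0 < R) {v w : Space n → ℂ}
    (hv : LocallyIntegrable v volume) (hw : LocallyIntegrable w volume) (x : Space n) :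
    smoother ρ R (fun y => v y - w y) x = smoother ρ R v x - smoother ρ R w x := by
  unfold smoother
  rw [← moll_sub ρ (isTest_cutoff_moll ρ hR hv).integrable.locallyIntegrable
    (isTest_cutoff_moll ρ hR hw).integrable.locallyIntegrable]
  simp_rw [moll_sub ρ hv hw, mul_sub]

lemma smoother_conj (ρ : ContDiffBump (0 : Space n)) (R : ℝ) (w : Space n → ℂ) (x : Space n) :
    smoother ρ R (fun y => (starRingEnd ℂ) (w y)) x = (starRingEnd ℂ) (smoother ρ R w x) := by
  unfold smoother
  rw [← moll_conj]
  congr 1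
  ext y
  rw [moll_conj, map_mul, Complex.conj_ofReal]

lemma integral_mul_smoother (ρ : ContDiffBump (0 : Space n)) (R : ℝ) {a b : Space n → ℂ}
    (ha : MemLp a 2 volume) (hb : MemLp b 2 volume) :
    ∫ x, a x * smoother ρ R b x = ∫ x, (cutoff R x : ℂ) * (moll ρ a x * moll ρ b x) := by
  unfold smoother
  rw [integral_mul_moll ρ ha (memLp_cutoff_moll ρ R hb (by norm_num) (by norm_num))]
  congr 1; ext x; ring

/-- Mollifying on both sides of the cutoff makes the smoothing operator symmetric, which is what the
polarization of the energy requires. -/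
lemma integral_mul_smoother_comm (ρ : ContDiffBump (0 : Space n)) (R : ℝ) {a b : Space n → ℂ}
    (ha : MemLp a 2 volume) (hb : MemLp b 2 volume) :
    ∫ x, a x * smoother ρ R b x = ∫ x, b x * smoother ρ R a x := by
  rw [integral_mul_smoother ρ R ha hb, integral_mul_smoother ρ R hb ha]
  simp_rw [mul_comm (moll ρ a _)]

lemma nrm_smoother_le (ρ : ContDiffBump (0 : Space n)) (R : ℝ) {w : Space n → ℂ}
    (hw : MemLp w 2 volume) : nrm (smoother ρ R w) ≤ nrm w :=
  (nrm_moll_le ρ (memLp_cutoff_moll ρ R hw (by norm_num) (by norm_num))).trans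
    ((nrm_cutoff_mul_le R (memLp_moll ρ hw (by norm_num) (by norm_num))).trans (nrm_moll_le ρ hw))

lemma exists_norm_smoother_le (ρ : ContDiffBump (0 : Space n)) (R : ℝ) :
    ∃ C : ℝ, 0 ≤ C ∧ ∀ w : Space n → ℂ, MemLp w 2 volume → ∀ x, ‖smoother ρ R w x‖ ≤ C * nrm w := by
  refine ⟨nrm fun y => (mker ρ y : ℂ), nrm_nonneg _, fun w hw x => ?_⟩
  refine (norm_moll_le ρ (memLp_cutoff_moll ρ R hw (by norm_num) (by norm_num)) x).trans ?_
  gcongr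
  · exact nrm_nonneg _
  exact (nrm_cutoff_mul_le R (memLp_moll ρ hw (by norm_num) (by norm_num))).trans (nrm_moll_le ρ hw)

/-- For fixed `ρ` and `R`, smoothing turns an `L²` function into a Lipschitz function supported in a
fixed ball, with Lipschitz constant proportional to the `L²` norm. The constant degenerates with
`ρ`, so the bound serves only for continuity arguments. -/
lemma exists_norm_integral_mul_absD_smoother_le (hn : 1 ≤ n) {ρ : ContDiffBump (0 : Space n)} {R : ℝ}
    (hR : 0 < R) (hρ : ρ.rOut ≤ 1) :
    ∃ C : ℝ, 0 ≤ C ∧ ∀ v w : Space n → ℂ, MemLp v 2 volume → MemLp w 2 volume →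
      ‖∫ x, v x * absD (smoother ρ R w) x‖ ≤ C * nrm v * nrm w := by
  obtain ⟨K, hK⟩ := exists_lipschitz_mker ρ
  set χ : Space n → ℂ := fun x => (cutoff R x : ℂ) with hχ
  have hχL : MemLp χ 2 volume := (cutoffSchwartz (n := n) hR).memLp 2 volume
  refine ⟨energyConst n (K * nrm χ) (2 * R + 1), Real.sqrt_nonneg _, fun v w hv hw => ?_⟩
  have hm := memLp_moll ρ hw (by norm_num) (by norm_num)
  have hint : Integrable fun x => (cutoff R x : ℂ) * moll ρ w x := hχL.integrable_mul hm
  -- Cauchy–Schwarz applied to the moduli, to have the absolute value inside the integral.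
  have hl1 : ∫ x, ‖(cutoff R x : ℂ) * moll ρ w x‖ ≤ nrm χ * nrm w := by
    have h1 := norm_integral_mul_le (f := fun x => (‖χ x‖ : ℂ)) (g := fun x => (‖moll ρ w x‖ : ℂ))
      hχL.norm.ofReal hm.norm.ofReal
    have e : ∀ f : Space n → ℂ, nrm (fun x => (‖f x‖ : ℂ)) = nrm f := by
      intro f
      unfold nrm
      congr 1
      exact eLpNorm_congr_norm_ae (ae_of_all _ fun x => by simp)
    rw [e, e] at h1
    have e2 : ∫ x, (‖χ x‖ : ℂ) * (‖moll ρ w x‖ : ℂ) =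
        ((∫ x, ‖(cutoff R x : ℂ) * moll ρ w x‖ : ℝ) : ℂ) := by
      rw [← integral_complex_ofReal]
      simp [hχ]
    rw [e2, Complex.norm_real, Real.norm_of_nonneg (integral_nonneg fun _ => norm_nonneg _)] at h1
    exact h1.trans (mul_le_mul_of_nonneg_left (nrm_moll_le ρ hw) (nrm_nonneg _))
  obtain ⟨N, hN⟩ : ∃ N : ℝ≥0, (N : ℝ) = K * nrm χ * nrm w :=
    ⟨K * (nrm χ).toNNReal * (nrm w).toNNReal, by simp [nrm_nonneg]⟩
  have hLip : LipschitzWith N (smoother ρ R w) := by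
    refine LipschitzWith.of_dist_le_mul fun x x' => ?_
    rw [dist_eq_norm, dist_eq_norm]
    refine (norm_moll_sub_le ρ hK hint x x').trans ?_
    have := mul_le_mul_of_nonneg_right (mul_le_mul_of_nonneg_left hl1 K.coe_nonneg)
      (norm_nonneg (x - x'))
    rw [hN]
    linarith
  refine (norm_integral_mul_absD_le hn hv (isTest_smoother ρ hR (hw.locallyIntegrable (by norm_num)))
    hLip fun x hx => smoother_eq_zero hR hρ w hx).trans_eq ?_
  unfold energyConst
  have : (n : ℝ) * ((N : ℝ) ^ 2 *
      volume.real (Metric.closedBall (0 : Space n) (2 * R + 1))) =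
      n * ((K * nrm χ) ^ 2 * volume.real (Metric.closedBall (0 : Space n) (2 * R + 1))) *
        nrm w ^ 2 := by
    rw [hN]
    ring
  rw [this, Real.sqrt_mul' _ (sq_nonneg _), Real.sqrt_sq (nrm_nonneg w)]
  ring

/-- The outer mollification is moved onto `w`. What remains is the pairing of `moll ρ w` with `|D|`
of the cut-off conjugate of the same function, so the cutoff estimate applies with a constant
independent of `ρ`. -/
lemma abs_im_integral_mul_absD_smoother_le_of_isTest (ρ : ContDiffBump (0 : Space n)) {R : ℝ}
    (hR : 0 < R) {w : Space n → ℂ} (hw : IsTest w) :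
    |(∫ x, w x * absD (smoother ρ R fun y => (starRingEnd ℂ) (w y)) x).im| ≤
      Real.pi * cutoffConst (cutoffSchwartz (n := n) hR) * nrm w ^ 2 := by
  have hl : LocallyIntegrable (fun y => (starRingEnd ℂ) (w y)) volume :=
    hw.conj.integrable.locallyIntegrable
  unfold smoother
  rw [integral_mul_absD_moll hw (isTest_cutoff_moll ρ hR hl)]
  have h1 := abs_im_integral_mul_absD_le (cutoffSchwartz hR) (hw.moll ρ).toSchwartz
    (fun x => Complex.conj_ofReal _)
  simp only [IsTest.coe_toSchwartz, cutoffSchwartz_apply] at h1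
  simp_rw [moll_conj]
  refine h1.trans ?_
  have h0 : 0 ≤ cutoffConst (cutoffSchwartz (n := n) hR) :=
    integral_nonneg fun _ => mul_nonneg (norm_nonneg _) (norm_nonneg _)
  have h2 := nrm_moll_le ρ (hw.memLp 2)
  have h3 := nrm_nonneg (moll ρ w)
  have := Real.pi_pos
  gcongr

/-- The quadratic form is continuous on `L²` for fixed `ρ` and `R`, so the bound passes from test
functions to the limit; only the constant uniform in `ρ` survives. -/
lemma abs_im_integral_mul_absD_smoother_le (hn : 1 ≤ n) {ρ : ContDiffBump (0 : Space n)} {R : ℝ}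
    (hR : 0 < R) (hρ : ρ.rOut ≤ 1) {w : Space n → ℂ} (hw : MemLp w 2 volume) :
    |(∫ x, w x * absD (smoother ρ R fun y => (starRingEnd ℂ) (w y)) x).im| ≤
      Real.pi * cutoffConst (cutoffSchwartz (n := n) hR) * nrm w ^ 2 := by
  obtain ⟨C, hC0, hC⟩ := exists_norm_integral_mul_absD_smoother_le hn hR hρ
  obtain ⟨f, hf, hlim⟩ := exists_seq_isTest hw
  have hnf := tendsto_nrm hw (fun k => (hf k).memLp 2) hlim
  have hwc := memLp_conj hw
  have hwl : LocallyIntegrable (fun y => (starRingEnd ℂ) (w y)) volume :=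
    hwc.locallyIntegrable (by norm_num)
  have hconv : Tendsto (fun k => ∫ x, f k x * absD (smoother ρ R fun y => (starRingEnd ℂ) (f k y)) x)
      atTop (𝓝 (∫ x, w x * absD (smoother ρ R fun y => (starRingEnd ℂ) (w y)) x)) := by
    rw [tendsto_iff_norm_sub_tendsto_zero]
    have hb : Tendsto (fun k => C * nrm (fun x => f k x - w x) * nrm (f k) +
        C * nrm w * nrm (fun x => f k x - w x)) atTop (𝓝 0) := by
      have := ((hlim.const_mul C).mul hnf).add (hlim.const_mul (C * nrm w))
      simpa using this
    refine squeeze_zero (fun k => norm_nonneg _) (fun k => ?_) hb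
    have hfk := (hf k).memLp 2
    have hfc := (hf k).conj
    have hfl : LocallyIntegrable (fun y => (starRingEnd ℂ) (f k y)) volume :=
      hfc.integrable.locallyIntegrable
    have t1 := isTest_smoother ρ hR hfl
    have t2 := isTest_smoother ρ hR hwl
    have hsub : MemLp (fun x => f k x - w x) 2 volume := hfk.sub hw
    have hsubc : MemLp (fun x => (starRingEnd ℂ) (f k x) - (starRingEnd ℂ) (w x)) 2 volume :=
      (hfc.memLp 2).sub hwc
    have b1 := hC _ _ hsub (hfc.memLp 2)
    have b2 := hC _ _ hw hsubc
    rw [nrm_conj] at b1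
    have e1 : nrm (fun x => (starRingEnd ℂ) (f k x) - (starRingEnd ℂ) (w x)) =
        nrm (fun x => f k x - w x) := by
      rw [← nrm_conj (fun x => f k x - w x)]
      simp_rw [map_sub]
    rw [e1] at b2
    have e2 : ∀ x, absD (smoother ρ R fun y => (starRingEnd ℂ) (f k y) - (starRingEnd ℂ) (w y)) x =
        absD (smoother ρ R fun y => (starRingEnd ℂ) (f k y)) x -
          absD (smoother ρ R fun y => (starRingEnd ℂ) (w y)) x := by
      intro x
      rw [← absD_sub t1 t2]
      congr 1
      ext y
      exact smoother_sub ρ hR hfl hwl y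
    simp_rw [e2] at b2
    refine le_trans (le_of_eq ?_) ((norm_add_le _ _).trans (add_le_add b1 b2))
    rw [← integral_add, ← integral_sub]
    · congr 2
      ext x
      ring
    · exact hfk.integrable_mul (t1.memLp_absD hn)
    · exact hw.integrable_mul (t2.memLp_absD hn)
    · exact hsub.integrable_mul (t1.memLp_absD hn)
    · exact hw.integrable_mul ((t1.memLp_absD hn).sub (t2.memLp_absD hn))
  refine le_of_tendsto_of_tendsto ((Complex.continuous_im.tendsto _).comp hconv).abs
    ((hnf.pow 2).const_mul _) (Eventually.of_forall fun k => ?_)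
  exact abs_im_integral_mul_absD_smoother_le_of_isTest ρ hR (hf k)

/-! ### Convergence of the smoothing operator -/

/-- The cutoff lives in the ball of radius `2R` and the inner mollification reaches at most distance
`1` further. This locality allows purely local `L^(p+1)` information to be used. -/
lemma smoother_eq_smoother_indicator {ρ : ContDiffBump (0 : Space n)} {R : ℝ} (hR : 0 < R)
    (hρ : ρ.rOut ≤ 1) (w : Space n → ℂ) :
    smoother ρ R w =
      smoother ρ R ((Metric.closedBall (0 : Space n) (2 * R + 1)).indicator w) := by
  unfold smoother
  congr 1
  ext x
  rcases lt_or_ge (2 * R) ‖x‖ with hx | hx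
  · rw [cutoff_eq_zero hR hx]; simp
  · congr 1
    unfold moll
    congr 1
    ext y
    by_cases hy : y ∈ Metric.closedBall (0 : Space n) (2 * R + 1)
    · rw [Set.indicator_of_mem hy]
    · rw [Set.indicator_of_notMem hy, mker_eq_zero]
      · simp
      · rw [mem_closedBall_zero_iff, not_le] at hy
        have := norm_sub_norm_le y x
        rw [norm_sub_rev] at this
        linarith

lemma eLpNorm_smoother_le (ρ : ContDiffBump (0 : Space n)) (R : ℝ) {w : Space n → ℂ} {r : ℝ≥0∞}
    (hw : MemLp w r volume) (hr : 1 ≤ r) (hr' : r ≠ ⊤) :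
    eLpNorm (smoother ρ R w) r volume ≤ eLpNorm w r volume := by
  have h1 := memLp_cutoff_moll ρ R hw hr hr'
  refine (eLpNorm_moll_le ρ h1.1 hr hr').trans ?_
  refine (eLpNorm_mono fun x => norm_cutoff_mul_le R (moll ρ w) x).trans ?_
  exact eLpNorm_moll_le ρ hw.1 hr hr'

/-- With `J` the mollification and `χ` the cutoff, `JχJw - χw = J(χ(Jw - w)) + (J(χw) - χw)`. Both
terms are controlled by convergence of `J` and its contractivity. -/
lemma tendsto_eLpNorm_smoother_sub {ρ : ℕ → ContDiffBump (0 : Space n)}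
    (hρ : Tendsto (fun m => (ρ m).rOut) atTop (𝓝 0)) (R : ℝ) {w : Space n → ℂ} {r : ℝ≥0∞}
    (hw : MemLp w r volume) (hr : 1 ≤ r) (hr' : r ≠ ⊤) :
    Tendsto (fun m => eLpNorm (fun x => smoother (ρ m) R w x - (cutoff R x : ℂ) * w x) r volume)
      atTop (𝓝 0) := by
  have hχw := memLp_cutoff_mul R hw
  have h1 := tendsto_eLpNorm_moll_sub hρ hw hr hr'
  have h2 := tendsto_eLpNorm_moll_sub hρ hχw hr hr'
  have h3 := h1.add h2
  rw [add_zero] at h3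
  refine tendsto_of_tendsto_of_tendsto_of_le_of_le tendsto_const_nhds h3 (fun _ => bot_le)
    fun m => ?_
  have hm := memLp_cutoff_moll (ρ m) R hw hr hr'
  have e : (fun x => smoother (ρ m) R w x - (cutoff R x : ℂ) * w x) = fun x =>
      moll (ρ m) (fun y => (cutoff R y : ℂ) * moll (ρ m) w y - (cutoff R y : ℂ) * w y) x +
        (moll (ρ m) (fun y => (cutoff R y : ℂ) * w y) x - (cutoff R x : ℂ) * w x) := by
    ext x
    rw [moll_sub _ (hm.locallyIntegrable hr) (hχw.locallyIntegrable hr)]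
    unfold smoother
    ring
  rw [e]
  have hsub : MemLp (fun y => (cutoff R y : ℂ) * moll (ρ m) w y - (cutoff R y : ℂ) * w y) r volume :=
    hm.sub hχw
  refine (eLpNorm_add_le (memLp_moll _ hsub hr hr').1 ((memLp_moll _ hχw hr hr').sub hχw).1 hr).trans ?_
  refine add_le_add ((eLpNorm_moll_le _ hsub.1 hr hr').trans ?_) le_rfl
  refine eLpNorm_mono fun x => ?_
  rw [← mul_sub]
  exact norm_cutoff_mul_le R (fun x => moll (ρ m) w x - w x) x

/-! ### Jointly measurable representatives of curves in `L²` -/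

/-- Uniform continuity of a curve of square integrable functions. -/
def UniformCurve (w : ℝ → Space n → ℂ) : Prop :=
  ∀ ε > 0, ∃ δ > 0, ∀ s t : ℝ, |s - t| < δ → nrm (fun x => w s x - w t x) < ε

lemma eLpNorm_eq_ofReal_nrm {f : Space n → ℂ} (hf : MemLp f 2 volume) :
    eLpNorm f 2 volume = ENNReal.ofReal (nrm f) := (ENNReal.ofReal_toReal hf.eLpNorm_ne_top).symm

/-- A geometric rate in `L²` gives convergence almost everywhere of the whole sequence. The limit is
identified along a subsequence converging almost everywhere to `w`. -/
lemma ae_tendsto_limUnder_of_eLpNorm_lt {v : ℕ → Space n → ℂ} {w : Space n → ℂ}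
    (hvma : ∀ m, AEStronglyMeasurable (v m) volume) (hw : AEStronglyMeasurable w volume)
    (hwd : ∀ m, eLpNorm (v m - w) 2 volume < ENNReal.ofReal ((1 / 2) ^ m)) :
    (fun x => limUnder atTop fun m => v m x) =ᵐ[volume] w := by
  have hae := Lp.ae_tendsto_of_cauchy_eLpNorm (μ := (volume : Measure (Space n))) (p := 2)
    (f := v) hvma (by norm_num)
    (B := fun m => ENNReal.ofReal (2 * (1 / 2) ^ m)) ?_ ?_
  · have h2 : Tendsto (fun m => eLpNorm (v m - w) 2 volume) atTop (𝓝 0) := by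
      have h3 : Tendsto (fun m : ℕ => ENNReal.ofReal ((1 / 2 : ℝ) ^ m)) atTop (𝓝 0) := by
        have := ENNReal.tendsto_ofReal (tendsto_pow_atTop_nhds_zero_of_lt_one
          (by norm_num : (0 : ℝ) ≤ 1 / 2) (by norm_num))
        simpa using this
      exact tendsto_of_tendsto_of_tendsto_of_le_of_le tendsto_const_nhds h3 (fun _ => bot_le)
        fun m => (hwd m).le
    obtain ⟨ns, hns, hlim⟩ := (tendstoInMeasure_of_tendsto_eLpNorm (by norm_num) hvma hw
      h2).exists_seq_tendsto_ae
    filter_upwards [hae, hlim] with x ⟨l, hl⟩ hx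
    rw [hl.limUnder_eq]
    exact tendsto_nhds_unique (hl.comp hns.tendsto_atTop) hx
  · have hs : Summable fun m : ℕ => (2 * (1 / 2) ^ m : ℝ) := summable_geometric_two.mul_left 2
    rw [← ENNReal.ofReal_tsum_of_nonneg (fun m => by positivity) hs]
    exact ENNReal.ofReal_ne_top
  · intro N i j hi hj
    have e : v i - v j =
(v i - w) - (v j - w) := by
      abel
    rw [e]
    refine (eLpNorm_sub_le ((hvma i).sub hw) ((hvma j).sub hw) (by norm_num)).trans_lt ?_
    have h1 : ∀ i, N ≤ i → ENNReal.ofReal ((1 / 2 : ℝ) ^ i) ≤ ENNReal.ofReal ((1 / 2) ^ N) :=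
      fun i hi => ENNReal.ofReal_le_ofReal (pow_le_pow_of_le_one (by norm_num) (by norm_num) hi)
    rw [two_mul, ENNReal.ofReal_add (by positivity) (by positivity)]
    exact ENNReal.add_lt_add ((hwd i).trans_le (h1 i hi)) ((hwd j).trans_le (h1 j hj))

/-- Functions piecewise constant in time, made from measurable representatives of the slices at grid
points, are jointly measurable. With grids fine enough to give errors below `2^(-m)` they converge
almost everywhere in `x` for every `t`. -/
lemma exists_measurable_curve {w : ℝ → Space n → ℂ} (hw : ∀ t, MemLp (w t) 2 volume)
    (hc : UniformCurve w) :
    ∃ v : ℝ → Space n → ℂ, StronglyMeasurable (Function.uncurry v) ∧ ∀ t, v t =ᵐ[volume] w t := by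
  have hk : ∀ m : ℕ, ∃ k : ℕ, 0 < k ∧ ∀ s t : ℝ, |s - t| ≤ 1 / (k : ℝ) →
      nrm (fun x => w s x - w t x) < (1 / 2) ^ m := by
    intro m
    obtain ⟨δ, hδ, hd⟩ := hc ((1 / 2) ^ m) (by positivity)
    obtain ⟨k, hk⟩ := exists_nat_one_div_lt hδ
    refine ⟨k + 1, Nat.succ_pos _, fun s t hst => hd s t (hst.trans_lt ?_)⟩
    push_cast
    exact hk
  choose k hk0 hk using hk
  have hmk : ∀ t, ∃ g : Space n → ℂ, StronglyMeasurable g ∧ g =ᵐ[volume] w t := fun t =>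
    ⟨_, (hw t).1.stronglyMeasurable_mk, (hw t).1.ae_eq_mk.symm⟩
  choose g hgm hga using hmk
  obtain ⟨d, hd⟩ : ∃ d : ℕ → ℝ → ℝ, ∀ m t, d m t = (⌊t * k m⌋ : ℝ) / k m := ⟨_, fun _ _ => rfl⟩
  have hdist : ∀ m t, |t - d m t| ≤ 1 / (k m : ℝ) := by
    intro m t
    have hkp : (0 : ℝ) < k m := by exact_mod_cast hk0 m
    have h1 := Int.floor_le (t * k m)
    have h2 := Int.lt_floor_add_one (t * k m)
    have e : t - d m t = (t * k m - ⌊t * k m⌋) / k m := by rw [hd]; field_simp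
    rw [e, abs_of_nonneg (div_nonneg (by linarith) hkp.le)]
    gcongr
    linarith
  set v : ℕ → ℝ × Space n → ℂ := fun m q => g (d m q.1) q.2 with hv
  have hvm : ∀ m, StronglyMeasurable (v m) := by
    intro m
    -- The approximation factors through the integer index of the grid point, so joint measurability
    -- reduces to countably many slices.
    have h1 : Measurable fun q : ℤ × Space n => g ((q.1 : ℝ) / k m) q.2 :=
      measurable_from_prod_countable_right fun z => (hgm ((z : ℝ) / k m)).measurable
    have h2 : Measurable fun q : ℝ × Space n => (⌊q.1 * k m⌋, q.2) := by fun_prop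
    have h3 : v m = (fun q : ℤ × Space n => g ((q.1 : ℝ) / k m) q.2) ∘
        fun q : ℝ × Space n => (⌊q.1 * k m⌋, q.2) := by
      funext q
      simp only [hv, hd, Function.comp]
    rw [h3]
    exact (h1.comp h2).stronglyMeasurable
  have hlm : StronglyMeasurable fun q : ℝ × Space n => limUnder atTop fun m => v m q :=
    StronglyMeasurable.limUnder hvm
  refine ⟨fun t x => limUnder atTop fun m => v m (t, x), hlm, fun t => ?_⟩
  have hwd : ∀ m, eLpNorm ((fun x => v m (t, x)) - w t) 2 volume < ENNReal.ofReal ((1 / 2) ^ m) := by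
    intro m
    have e : eLpNorm ((fun x => v m (t, x)) - w t) 2 volume =
        eLpNorm (fun x => w (d m t) x - w t x) 2 volume := by
      refine eLpNorm_congr_ae ?_
      filter_upwards [hga (d m t)] with x hx
      simp only [hv, hx, Pi.sub_apply]
    have hs : MemLp (fun x => w (d m t) x - w t x) 2 volume := (hw _).sub (hw _)
    rw [e, eLpNorm_eq_ofReal_nrm hs, ENNReal.ofReal_lt_ofReal_iff (by positivity)]
    refine hk m _ _ ?_
    rw [abs_sub_comm]
    exact hdist m t
  have hvma : ∀ m, AEStronglyMeasurable (fun x => v m (t, x)) volume :=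
    fun m => (hgm (d m t)).aestronglyMeasurable
  exact ae_tendsto_limUnder_of_eLpNorm_lt hvma (hw t).1 hwd

/-! ### Local solutions -/

/-- A solution on `[0, b]`, written as `u = h w` with `w` a uniformly continuous, jointly measurable
curve in `L²`. -/
structure LocalSolution (p : ℝ) (h : Space n → ℝ) (b : ℝ) (w : ℝ → Space n → ℂ) : Prop where
  meas : StronglyMeasurable (Function.uncurry w)
  memLp : ∀ t, MemLp (w t) 2 volume
  cont : UniformCurve w
  integ : ∀ R : ℝ, ∫⁻ t in Set.Icc 0 b, ∫⁻ x in Metric.closedBall 0 R, ‖(h x : ℂ) * w t x‖ₑ ^ (p + 1) < ⊤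
  eqn : ∀ φ : Space n → ℂ, IsTest φ → ∀ t ∈ Set.Icc 0 b,
    ∫ x, (h x : ℂ) * w t x * φ x = (∫ x, (h x : ℂ) * w 0 x * φ x) +
      ∫ s in (0 : ℝ)..t, (-Complex.I * (∫ x, (h x : ℂ) * w s x * absD φ x) +
        ∫ x, nonlin p ((h x : ℂ) * w s x) * φ x)

lemma dist_toLp {f g : Space n → ℂ} (hf : MemLp f 2 volume) (hg : MemLp g 2 volume) :
    dist (hf.toLp f) (hg.toLp g) = nrm (fun x => f x - g x) := by
  rw [dist_edist, Lp.edist_toLp_toLp]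
  rfl

/-- The notion of solution assumes no joint measurability of `u`, and its continuity is only
pointwise in time. Passing to a compact time interval and a good representative supplies both joint
measurability and uniform continuity. -/
lemma IsSolution.exists_localSolution {p : ℝ} {h : Space n → ℝ} {T : EReal} {u₀ : Space n → ℂ}
    {u : ℝ → Space n → ℂ} (hu : IsSolution p h T u₀ u) (hne : ∀ x, h x ≠ 0) {b : ℝ} (hb0 : 0 ≤ b)
    (hbT : (b : EReal) < T) :
    ∃ w : ℝ → Space n → ℂ, LocalSolution p h b w ∧
      ∀ t ∈ Set.Icc 0 b, nrm (w t) = (wnorm h (u t)).toReal := by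
  have hlt : ∀ t ∈ Set.Icc 0 b, (t : EReal) < T := fun t ht =>
    lt_of_le_of_lt (EReal.coe_le_coe_iff.2 ht.2) hbT
  -- Freezing time outside `[0, b]` extends the curve to all of `ℝ`. The projection is 1-Lipschitz,
  -- so uniform continuity on the compact interval is inherited.
  set q : ℝ → ℝ := fun t => Set.projIcc 0 b hb0 t with hq
  have hqm : ∀ t, q t ∈ Set.Icc 0 b := fun t => (Set.projIcc 0 b hb0 t).2
  have hqe : ∀ t ∈ Set.Icc 0 b, q t = t := fun t ht => by simp only [hq, Set.projIcc_of_mem hb0 ht]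
  set w₀ : ℝ → Space n → ℂ := fun t x => u (q t) x / h x with hw₀
  have hmem : ∀ t, MemLp (w₀ t) 2 volume := fun t =>
    hu.memWeighted (q t) (hqm t).1 (hlt _ (hqm t))
  have hcurve : UniformCurve w₀ := by
    have hm' : ∀ t : Set.Icc 0 b, MemLp (fun x => u t x / (h x : ℂ)) 2 volume := fun t =>
      hu.memWeighted t t.2.1 (hlt _ t.2)
    set W : Set.Icc 0 b → Lp ℂ 2 (volume : Measure (Space n)) := fun t => (hm' t).toLp _ with hW
    have hWc : Continuous W := by
      rw [continuous_iff_continuousAt]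
      intro t
      rw [ContinuousAt, tendsto_iff_dist_tendsto_zero]
      have h1 := hu.continuous t t.2.1 (hlt _ t.2)
      have h2 : Tendsto (fun s : Set.Icc 0 b => (s : ℝ)) (𝓝 t)
          (𝓝[{s : ℝ | 0 ≤ s ∧ (s : EReal) < T}] (t : ℝ)) :=
        tendsto_nhdsWithin_iff.2 ⟨continuous_subtype_val.tendsto t,
          Eventually.of_forall fun s => ⟨s.2.1, hlt _ s.2⟩⟩
      have h3 := (ENNReal.tendsto_toReal ENNReal.zero_ne_top).comp (h1.comp h2)
      rw [ENNReal.toReal_zero] at h3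
      refine h3.congr fun s => ?_
      simp only [hW, Function.comp, wnorm]
      rw [dist_toLp]
      unfold nrm
      simp_rw [sub_div]
    have huc := CompactSpace.uniformContinuous_of_continuous hWc
    intro ε hε
    obtain ⟨δ, hδ, hd⟩ := Metric.uniformContinuous_iff.1 huc ε hε
    refine ⟨δ, hδ, fun s t hst => ?_⟩
    have h1 : dist (Set.projIcc 0 b hb0 s) (Set.projIcc 0 b hb0 t) < δ := by
      refine lt_of_le_of_lt ?_ hst
      rw [Subtype.dist_eq, Real.dist_eq]
      exact Set.abs_projIcc_sub_projIcc hb0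
    have h2 := hd h1
    simp only [hW] at h2
    rw [dist_toLp] at h2
    exact h2
  obtain ⟨w, hwm, hwae⟩ := exists_measurable_curve hmem hcurve
  have hae : ∀ t ∈ Set.Icc 0 b, ∀ᵐ x, (h x : ℂ) * w t x = u t x := by
    intro t ht
    filter_upwards [hwae t] with x hx
    have : (h x : ℂ) ≠ 0 := by exact_mod_cast hne x
    rw [hx]
    simp only [hw₀, hqe t ht]
    field_simp
  refine ⟨w, ⟨hwm, fun t => (memLp_congr_ae (hwae t)).2 (hmem t), ?_, ?_, ?_⟩, fun t ht => ?_⟩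
  · intro ε hε
    obtain ⟨δ, hδ, hd⟩ := hcurve ε hε
    refine ⟨δ, hδ, fun s t hst => ?_⟩
    convert hd s t hst using 1
    unfold nrm
    congr 1
    refine eLpNorm_congr_ae ?_
    filter_upwards [hwae s, hwae t] with x h1 h2
    rw [h1, h2]
  · intro R
    refine lt_of_eq_of_lt ?_ (hu.integrable b hb0 hbT _ (isCompact_closedBall 0 R))
    refine setLIntegral_congr_fun measurableSet_Icc fun t ht => ?_
    refine setLIntegral_congr_fun_ae Metric.isClosed_closedBall.measurableSet ?_
    filter_upwards [hae t ht] with x hx _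
    rw [hx]
  · intro φ hφ t ht
    have h0 : (0 : ℝ) ∈ Set.Icc 0 b := ⟨le_rfl, hb0⟩
    have h1 := hu.equation φ hφ.contDiff hφ.hasCompactSupport t ht.1 (hlt t ht)
    have e1 : ∫ x, (h x : ℂ) * w t x * φ x = ∫ x, u t x * φ x :=
      integral_congr_ae (by filter_upwards [hae t ht] with x hx; rw [hx])
    have e2 : ∫ x, (h x : ℂ) * w 0 x * φ x = ∫ x, u₀ x * φ x :=
      integral_congr_ae (by filter_upwards [hae 0 h0, hu.initial] with x hx hx'; rw [hx, hx'])
    rw [e1, e2, h1]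
    congr 1
    refine intervalIntegral.integral_congr fun s hs => ?_
    rw [Set.uIcc_of_le ht.1] at hs
    have hs' : s ∈ Set.Icc 0 b := ⟨hs.1, hs.2.trans ht.2⟩
    have e3 : ∫ x, (h x : ℂ) * w s x * absD φ x = ∫ x, u s x * absD φ x :=
      integral_congr_ae (by filter_upwards [hae s hs'] with x hx; rw [hx])
    have e4 : ∫ x, nonlin p ((h x : ℂ) * w s x) * φ x = ∫ x, nonlin p (u s x) * φ x :=
      integral_congr_ae (by filter_upwards [hae s hs'] with x hx; rw [hx])
    simp only [e3, e4]
  · unfold nrm wnorm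
    congr 1
    refine eLpNorm_congr_ae ?_
    filter_upwards [hwae t] with x hx
    rw [hx]
    simp only [hw₀, hqe t ht]

/-! ### Division of test functions by the weight -/

lemma exists_bump_seq : ∃ ρ : ℕ → ContDiffBump (0 : Space n), (∀ m, (ρ m).rOut ≤ 1) ∧
    Tendsto (fun m => (ρ m).rOut) atTop (𝓝 0) := by
  refine ⟨fun m => ⟨1 / ((m : ℝ) + 1) / 2, 1 / ((m : ℝ) + 1), by positivity,
    half_lt_self (by positivity)⟩, fun m => ?_, tendsto_one_div_add_atTop_nhds_zero_nat⟩
  rw [div_le_one (by positivity)]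
  have : (0 : ℝ) ≤ m := m.cast_nonneg
  linarith

lemma norm_moll_sub_self_le (ρ : ContDiffBump (0 : Space n)) {K : ℝ≥0} {w : Space n → ℂ}
    (hw : LipschitzWith K w) (x : Space n) : ‖moll ρ w x - w x‖ ≤ K * ρ.rOut := by
  rw [moll_eq_convolution, ← dist_eq_norm]
  refine ρ.dist_normed_convolution_le hw.continuous.aestronglyMeasurable fun y hy => ?_
  refine (hw.dist_le_mul y x).trans ?_
  gcongr
  exact (Metric.mem_ball.1 hy).le

lemma nrm_le_of_zero {f : Space n → ℂ} {c R : ℝ} (hc : 0 ≤ c) (hf : ∀ x, ‖f x‖ ≤ c)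
    (hR : ∀ x, R < ‖x‖ → f x = 0) :
    nrm f ≤ c * nrm ((Metric.closedBall (0 : Space n) R).indicator fun _ => (1 : ℂ)) := by
  have hm : MemLp ((Metric.closedBall (0 : Space n) R).indicator fun _ => (1 : ℂ)) 2 volume :=
    memLp_indicator_const 2 Metric.isClosed_closedBall.measurableSet 1
      (Or.inr measure_closedBall_lt_top.ne)
  have h1 := nrm_const_mul (c : ℂ) ((Metric.closedBall (0 : Space n) R).indicator fun _ => (1 : ℂ))
  rw [Complex.norm_real, Real.norm_of_nonneg hc] at h1
  rw [← h1]
  refine nrm_mono (hm.const_mul (c : ℂ)) (ae_of_all _ fun x => ?_)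
  by_cases hx : R < ‖x‖
  · rw [hR x hx, norm_zero]; exact norm_nonneg _
  · have : x ∈ Metric.closedBall (0 : Space n) R := by simpa using hx
    rw [Set.indicator_of_mem this, mul_one, Complex.norm_real, Real.norm_of_nonneg hc]
    exact hf x

/-- The product rule, with `h` evaluated only at a point of the ball where it is bounded. If just
one of the two points lies in the ball, that one plays this role; if neither does, both values are
zero. -/
lemma lipschitzWith_weight_mul {h : Space n → ℝ} {g : Space n → ℂ} {K L : ℝ≥0} {S R : ℝ}
    (hK : LipschitzWith K h) (hL : LipschitzWith L g) (hS : ∀ x, ‖g x‖ ≤ S)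
    (hR0 : 0 ≤ R) (hR : ∀ x, R < ‖x‖ → g x = 0) :
    LipschitzWith (((|h 0| + K) * (1 + R)) * L + K * S).toNNReal (fun x => (h x : ℂ) * g x) := by
  have hS0 : 0 ≤ S := (norm_nonneg _).trans (hS 0)
  refine LipschitzWith.of_dist_le' fun x y => ?_
  have key : ∀ x y : Space n, ‖x‖ ≤ R → ‖(h x : ℂ) * g x - h y * g y‖ ≤
      ((|h 0| + K) * (1 + R) * L + K * S) * dist x y := by
    intro x y hx
    have e : (h x : ℂ) * g x - h y * g y = h x * (g x - g y) + (h x - h y : ℝ) * g y := by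
      push_cast; ring
    have h1 := hL.dist_le_mul x y
    have h2 := hK.dist_le_mul x y
    have h3 : |h x| ≤ (|h 0| + K) * (1 + R) := (norm_le_of_lipschitz hK x).trans (by gcongr)
    rw [dist_eq_norm] at h1
    rw [Real.dist_eq] at h2
    rw [e]
    refine (norm_add_le _ _).trans ?_
    rw [norm_mul, norm_mul, Complex.norm_real, Complex.norm_real, Real.norm_eq_abs, Real.norm_eq_abs,
      add_mul]
    refine add_le_add ?_ ?_
    · calc |h x| * ‖g x - g y‖ ≤ ((|h 0| + K) * (1 + R)) * (L * dist x y) := by gcongr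
        _ = _ := by ring
    · calc |h x - h y| * ‖g y‖ ≤ (K * dist x y) * S := by gcongr; exact hS y
        _ = _ := by ring
  rw [dist_eq_norm]
  by_cases hx : ‖x‖ ≤ R
  · exact key x y hx
  by_cases hy : ‖y‖ ≤ R
  · rw [← norm_neg, neg_sub, dist_comm]
    exact key y x hy
  rw [hR x (not_le.1 hx), hR y (not_le.1 hy)]
  simp only [mul_zero, sub_zero, norm_zero]
  positivity

lemma IsTest.exists_lipschitzWith {φ : Space n → ℂ} (hφ : IsTest φ) :
    ∃ K : ℝ≥0, LipschitzWith K φ :=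
  ContDiff.lipschitzWith_of_hasCompactSupport hφ.hasCompactSupport hφ.contDiff (by simp)

lemma exists_norm_le_of_zero {g : Space n → ℂ} {R : ℝ} (hg : Continuous g)
    (hR : ∀ x, R < ‖x‖ → g x = 0) : ∃ S : ℝ, ∀ x, ‖g x‖ ≤ S :=
  (hasCompactSupport_of_zero hR).exists_bound_of_continuous hg

lemma lipschitzWith_inv {h : Space n → ℝ} {K : ℝ≥0} (hK : LipschitzWith K h) (hne : ∀ x, h x ≠ 0)
    {m : ℝ} (hm : ∀ x, |(h x)⁻¹| ≤ m) :
    LipschitzWith (m ^ 2 * K).toNNReal (fun x => (h x)⁻¹) := by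
  have hm0 : 0 ≤ m := (abs_nonneg _).trans (hm 0)
  refine LipschitzWith.of_dist_le' fun x y => ?_
  have h2 := hK.dist_le_mul y x
  rw [Real.dist_eq] at h2 ⊢
  rw [inv_sub_inv (hne x) (hne y), div_eq_mul_inv, mul_inv, abs_mul, abs_mul, dist_comm]
  calc |h y - h x| * (|(h x)⁻¹| * |(h y)⁻¹|) ≤ (K * dist y x) * (m * m) := by
        gcongr
        exacts [hm x, hm y]
    _ = _ := by ring

/-- The quotient of a test function by the weight, as a limit of test functions `φ k`, with a
uniform Lipschitz bound for `h φ k`. -/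
lemma exists_seq_isTest_div {h : Space n → ℝ} {K : ℝ≥0} (hK : LipschitzWith K h)
    (hne : ∀ x, h x ≠ 0) {m : ℝ} (hm : ∀ x, |(h x)⁻¹| ≤ m) {ψ : Space n → ℂ} (hψ : IsTest ψ) :
    ∃ (φ : ℕ → Space n → ℂ) (L : ℝ≥0) (R : ℝ), (∀ k, IsTest (φ k)) ∧
      (∀ k, LipschitzWith L fun x => (h x : ℂ) * φ k x) ∧ (∀ k x, R < ‖x‖ → φ k x = 0) ∧
      (∀ x, R < ‖x‖ → ψ x = 0) ∧
      Tendsto (fun k => nrm fun x => h x * φ k x - ψ x) atTop (𝓝 0) ∧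
      ∃ e : ℕ → ℝ, Tendsto e atTop (𝓝 0) ∧ ∀ k x, ‖φ k x - ψ x / h x‖ ≤ e k := by
  obtain ⟨R, hR0, hR⟩ := exists_zero_of_hasCompactSupport hψ.hasCompactSupport
  obtain ⟨L, hL⟩ := hψ.exists_lipschitzWith
  obtain ⟨S, hS⟩ := exists_norm_le_of_zero hψ.contDiff.continuous hR
  obtain ⟨ρ, hρ1, hρ⟩ := exists_bump_seq (n := n)
  have hφL := lipschitzWith_weight_mul (lipschitzWith_inv hK hne hm) hL hS hR0 hR
  set φ : Space n → ℂ := fun x => (((h x)⁻¹ : ℝ) : ℂ) * ψ x with hφ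
  generalize ((|(h 0)⁻¹| + (m ^ 2 * K).toNNReal) * (1 + R) * L + (m ^ 2 * K).toNNReal * S).toNNReal =
    M at hφL
  have hφR : ∀ x, R < ‖x‖ → φ x = 0 := fun x hx => by simp only [hφ, hR x hx, mul_zero]
  obtain ⟨S', hS'⟩ := exists_norm_le_of_zero hφL.continuous hφR
  have hloc : LocallyIntegrable φ volume := hφL.continuous.locallyIntegrable
  have hzero : ∀ k x, R + 1 < ‖x‖ → moll (ρ k) φ x = 0 := fun k x hx =>
    moll_eq_zero hφR (by have := hρ1 k; linarith)
  have hdist : ∀ k x, ‖moll (ρ k) φ x - φ x‖ ≤ M * (ρ k).rOut := fun k x =>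
    norm_moll_sub_self_le (ρ k) hφL x
  have hbd : ∀ k x, ‖moll (ρ k) φ x‖ ≤ M + S' := by
    intro k x
    have h1 : ‖moll (ρ k) φ x‖ ≤ ‖moll (ρ k) φ x - φ x‖ + ‖φ x‖ := by
      simpa using norm_add_le (moll (ρ k) φ x - φ x) (φ x)
    have h2 : (M : ℝ) * (ρ k).rOut ≤ M := mul_le_of_le_one_right M.2 (hρ1 k)
    linarith [hdist k x, hS' x]
  have he : Tendsto (fun k => (M : ℝ) * (ρ k).rOut) atTop (𝓝 0) := by
    simpa using hρ.const_mul (M : ℝ)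
  -- The quotient `φ = ψ / h` is Lipschitz with compact support. Its mollifications share its
  -- Lipschitz constant and vanish outside radius `R + 1`, since the bumps have radius at most `1`.
  refine ⟨fun k => moll (ρ k) φ, _, R + 1, fun k => ⟨contDiff_moll _ hloc,
    hasCompactSupport_of_zero (hzero k)⟩, fun k => lipschitzWith_weight_mul hK
      (lipschitzWith_moll (ρ k) hφL) (hbd k) (by linarith) (hzero k), hzero,
      fun x hx => hR x (by linarith), ?_, fun k => M * (ρ k).rOut, he, fun k x => ?_⟩
  · set H : ℝ := (|h 0| + K) * (1 + (R + 1)) with hH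
    have hH0 : 0 ≤ H := by positivity
    have hlim := (he.const_mul H).mul_const
      (nrm ((Metric.closedBall (0 : Space n) (R + 1)).indicator fun _ => (1 : ℂ)))
    rw [mul_zero, zero_mul] at hlim
    refine squeeze_zero (fun k => nrm_nonneg _) (fun k => nrm_le_of_zero ?_ (fun x => ?_)
      fun x hx => ?_) hlim
    · exact mul_nonneg hH0 (mul_nonneg M.2 (ρ k).rOut_pos.le)
    · beta_reduce
      by_cases hx : R + 1 < ‖x‖
      · rw [hzero k x hx, hR x (by linarith), mul_zero, sub_zero, norm_zero]
        exact mul_nonneg hH0 (mul_nonneg M.2 (ρ k).rOut_pos.le)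
      · have hhx : (h x : ℂ) ≠ 0 := by exact_mod_cast hne x
        have e : (h x : ℂ) * moll (ρ k) φ x - ψ x = h x * (moll (ρ k) φ x - φ x) := by
          simp only [hφ]; push_cast; field_simp
        rw [e, norm_mul, Complex.norm_real, Real.norm_eq_abs]
        have h3 : |h x| ≤ H := (norm_le_of_lipschitz hK x).trans (by rw [hH]; gcongr; linarith)
        exact mul_le_mul h3 (hdist k x) (norm_nonneg _) hH0
    · beta_reduce
      rw [hzero k x hx, hR x (by linarith), mul_zero, sub_zero]
  · have e : ψ x / h x = φ x := by simp only [hφ]; push_cast; rw [div_eq_inv_mul]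
    rw [e]
    exact hdist k x

/-- The function `g` is now merely Lipschitz, as is the case for `h φ`. Mollifying it keeps the
Lipschitz constant and enlarges the support by at most `1`, whence the radius `R + 1`. -/
lemma norm_integral_absD_mul_le_of_lipschitzWith (hn : 1 ≤ n) {f g : Space n → ℂ} (hf : IsTest f)
    {K : ℝ≥0} {R : ℝ} (hK : LipschitzWith K g) (hR : ∀ x, R < ‖x‖ → g x = 0) :
    ‖∫ x, absD f x * g x‖ ≤ energyConst n K (R + 1) * nrm f := by
  obtain ⟨ρ, hρ1, hρ⟩ := exists_bump_seq (n := n)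
  have hg2 : MemLp g 2 volume :=
    hK.continuous.memLp_of_hasCompactSupport (hasCompactSupport_of_zero hR)
  have hz : ∀ k x, R + 1 < ‖x‖ → moll (ρ k) g x = 0 := fun k x hx =>
    moll_eq_zero hR (by have := hρ1 k; linarith)
  have ht : ∀ k, IsTest (moll (ρ k) g) := fun k =>
    ⟨contDiff_moll _ hK.continuous.locallyIntegrable, hasCompactSupport_of_zero (hz k)⟩
  have hlim : Tendsto (fun k => nrm (fun x => moll (ρ k) g x - g x)) atTop (𝓝 0) := by
    have := (ENNReal.tendsto_toReal ENNReal.zero_ne_top).comp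
      (tendsto_eLpNorm_moll_sub hρ hg2 (by norm_num) (by norm_num))
    rw [ENNReal.toReal_zero] at this
    exact this
  have h2 := tendsto_integral_mul hg2 (fun k => (ht k).memLp 2) (hf.memLp_absD hn) hlim
  simp_rw [mul_comm (absD f _)]
  refine le_of_tendsto h2.norm (Eventually.of_forall fun k => ?_)
  have h3 := norm_integral_mul_absD_le hn (hf.memLp 2) (ht k) (lipschitzWith_moll (ρ k) hK) (hz k)
  have h4 := integral_absD_mul_comm hf.toSchwartz (ht k).toSchwartz
  simp only [IsTest.coe_toSchwartz] at h4
  rw [← h4] at h3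
  simp_rw [mul_comm (moll (ρ k) g _)]
  exact h3

/-! ### Summation over partitions -/

/-- An increment bound with an error that is small on short intervals holds without the error. -/
lemma integral_le_sub_of_partition {F k g : ℝ → ℝ} {a b : ℝ} (hab : a ≤ b)
    (hk : IntegrableOn k (Set.Icc a b)) (hg : IntegrableOn g (Set.Icc a b))
    (h : ∀ ε > 0, ∃ δ > 0, ∀ s t, a ≤ s → s ≤ t → t ≤ b → t - s < δ →
      (∫ τ in s..t, k τ) - ε * (∫ τ in s..t, g τ) ≤ F t - F s) :
    ∫ τ in a..b, k τ ≤ F b - F a := by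
  have hki : ∀ s t, a ≤ s → s ≤ t → t ≤ b → IntervalIntegrable k volume s t := fun s t h1 h2 h3 =>
    (intervalIntegrable_iff_integrableOn_Icc_of_le h2).2 (hk.mono_set (Set.Icc_subset_Icc h1 h3))
  have hgi : ∀ s t, a ≤ s → s ≤ t → t ≤ b → IntervalIntegrable g volume s t := fun s t h1 h2 h3 =>
    (intervalIntegrable_iff_integrableOn_Icc_of_le h2).2 (hg.mono_set (Set.Icc_subset_Icc h1 h3))
  -- On an equal partition into `N + 1` pieces shorter than `δ` the increments of `F` telescope, and
  -- the errors add up to `ε ∫ g`, independently of the number of pieces.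
  have key : ∀ ε > 0, (∫ τ in a..b, k τ) - ε * (∫ τ in a..b, g τ) ≤ F b - F a := by
    intro ε hε
    obtain ⟨δ, hδ, hd⟩ := h ε hε
    obtain ⟨N, hN⟩ := exists_nat_gt ((b - a) / δ)
    have hN1 : (0 : ℝ) < N + 1 := by positivity
    set x : ℕ → ℝ := fun i => a + i * ((b - a) / (N + 1)) with hx
    have hstep : 0 ≤ (b - a) / ((N : ℝ) + 1) := div_nonneg (by linarith) hN1.le
    have hx0 : x 0 = a := by simp [hx]
    have hxN : x (N + 1) = b := by simp only [hx]; push_cast; field_simp; ring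
    have hxa : ∀ i, a ≤ x i := fun i => by simp only [hx]; nlinarith [(i.cast_nonneg : (0 : ℝ) ≤ i)]
    have hxs : ∀ i, x i ≤ x (i + 1) := fun i => by simp only [hx]; push_cast; nlinarith
    have hxb : ∀ i < N + 1, x (i + 1) ≤ b := by
      intro i hi
      rw [← hxN]
      simp only [hx]
      have : ((i + 1 : ℕ) : ℝ) ≤ ((N + 1 : ℕ) : ℝ) := by exact_mod_cast hi
      nlinarith
    have hlt : ∀ i, x (i + 1) - x i < δ := by
      intro i
      have e : x (i + 1) - x i = (b - a) / (N + 1) := by simp only [hx]; push_cast; ring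
      rw [e, div_lt_iff₀ hN1]
      rw [div_lt_iff₀ hδ] at hN
      nlinarith
    have h1 := intervalIntegral.sum_integral_adjacent_intervals (f := k) (a := x) (μ := volume)
      (n := N + 1) fun i hi => hki _ _ (hxa i) (hxs i) (hxb i hi)
    have h2 := intervalIntegral.sum_integral_adjacent_intervals (f := g) (a := x) (μ := volume)
      (n := N + 1) fun i hi => hgi _ _ (hxa i) (hxs i) (hxb i hi)
    have h3 := Finset.sum_range_sub (fun i => F (x i)) (N + 1)
    rw [hx0, hxN] at h1 h2 h3
    rw [← h1, ← h2, ← h3, Finset.mul_sum, ← Finset.sum_sub_distrib]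
    exact Finset.sum_le_sum fun i hi => hd _ _ (hxa i) (hxs i) (hxb i (Finset.mem_range.1 hi)) (hlt i)
  have hlim : Tendsto (fun ε : ℝ => (∫ τ in a..b, k τ) - ε * (∫ τ in a..b, g τ)) (𝓝[>] 0)
      (𝓝 (∫ τ in a..b, k τ)) := by
    have : Tendsto (fun ε : ℝ => (∫ τ in a..b, k τ) - ε * (∫ τ in a..b, g τ)) (𝓝 0)
        (𝓝 ((∫ τ in a..b, k τ) - 0 * (∫ τ in a..b, g τ))) := by
      apply Continuous.tendsto; fun_prop
    rw [zero_mul, sub_zero] at this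
    exact this.mono_left nhdsWithin_le_nhds
  exact le_of_tendsto hlim (eventually_mem_nhdsWithin.mono key)

/-! ### The nonlinearity along a local solution -/

lemma norm_nonlin {p : ℝ} (hp : 1 < p) (z : ℂ) : ‖nonlin p z‖ = ‖z‖ ^ p := by
  unfold nonlin
  rw [norm_mul, Complex.norm_real, Real.norm_of_nonneg (by positivity)]
  rcases eq_or_ne ‖z‖ 0 with h0 | h0
  · rw [h0, mul_zero, Real.zero_rpow (by linarith)]
  · rw [← Real.rpow_add_one h0, sub_add_cancel]

lemma measurable_nonlin (p : ℝ) : Measurable (nonlin p) := by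
  unfold nonlin
  fun_prop

/-- The modulus is `|z|^p`, at most `1` for `|z| ≤ 1` and at most `|z|^(p+1)` otherwise. Hence the
local `L^(p+1)` hypothesis makes the nonlinearity locally integrable. -/
lemma enorm_nonlin_le {p : ℝ} (hp : 1 < p) (z : ℂ) : ‖nonlin p z‖ₑ ≤ 1 + ‖z‖ₑ ^ (p + 1) := by
  have e1 : ‖nonlin p z‖ₑ = ENNReal.ofReal (‖z‖ ^ p) := by
    rw [← norm_nonlin hp, ofReal_norm]
  have e2 : ‖z‖ₑ ^ (p + 1) = ENNReal.ofReal (‖z‖ ^ (p + 1)) := by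
    rw [← ofReal_norm, ENNReal.ofReal_rpow_of_nonneg (norm_nonneg _) (by linarith)]
  rw [e1, e2, ← ENNReal.ofReal_one, ← ENNReal.ofReal_add zero_le_one (by positivity)]
  refine ENNReal.ofReal_le_ofReal ?_
  rcases le_total ‖z‖ 1 with h | h
  · have := Real.rpow_le_one (norm_nonneg z) h (by linarith : 0 ≤ p)
    have : 0 ≤ ‖z‖ ^ (p + 1) := by positivity
    linarith
  · have := Real.rpow_le_rpow_of_exponent_le h (by linarith : p ≤ p + 1)
    linarith

namespace LocalSolution

variable {p : ℝ} {h : Space n → ℝ} {b : ℝ} {w : ℝ → Space n → ℂ}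

lemma measurable_nonlin_comp (lw : LocalSolution p h b w) (hh : Continuous h) :
    StronglyMeasurable fun q : ℝ × Space n => nonlin p ((h q.2 : ℂ) * w q.1 q.2) := by
  have h1 : Measurable fun q : ℝ × Space n => w q.1 q.2 := lw.meas.measurable
  exact ((measurable_nonlin p).comp (by fun_prop)).stronglyMeasurable

lemma integrable_prod (lw : LocalSolution p h b w) (hp : 1 < p) (hh : Continuous h) (R : ℝ) :
    Integrable (fun q : ℝ × Space n => nonlin p ((h q.2 : ℂ) * w q.1 q.2))
      ((volume.restrict (Set.Icc 0 b)).prod (volume.restrict (Metric.closedBall 0 R))) := by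
  refine ⟨(lw.measurable_nonlin_comp hh).aestronglyMeasurable, ?_⟩
  have hm : Measurable fun q : ℝ × Space n => w q.1 q.2 := lw.meas.measurable
  have hm2 : Measurable fun q : ℝ × Space n => ‖(h q.2 : ℂ) * w q.1 q.2‖ₑ ^ (p + 1) := by fun_prop
  unfold HasFiniteIntegral
  refine (lintegral_mono fun q => enorm_nonlin_le hp _).trans_lt ?_
  rw [lintegral_add_left measurable_const, lintegral_const, lintegral_prod _ hm2.aemeasurable]
  refine ENNReal.add_lt_top.2 ⟨?_, lw.integ R⟩
  rw [one_mul, ← Set.univ_prod_univ, Measure.prod_prod, Measure.restrict_apply_univ,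
    Measure.restrict_apply_univ]
  exact ENNReal.mul_lt_top measure_Icc_lt_top measure_closedBall_lt_top

/-- The `L¹` norm of the nonlinearity on a ball. -/
def nonlinMass (p : ℝ) (h : Space n → ℝ) (w : ℝ → Space n → ℂ) (R τ : ℝ) : ℝ :=
  ∫ x in Metric.closedBall 0 R, ‖nonlin p ((h x : ℂ) * w τ x)‖

lemma nonlinMass_nonneg (R τ : ℝ) : 0 ≤ nonlinMass p h w R τ :=
  integral_nonneg fun _ => norm_nonneg _

lemma integrableOn_nonlinMass (lw : LocalSolution p h b w) (hp : 1 < p) (hh : Continuous h) (R : ℝ) :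
    IntegrableOn (nonlinMass p h w R) (Set.Icc 0 b) :=
  (lw.integrable_prod hp hh R).integral_norm_prod_left

lemma ae_integrableOn_nonlin (lw : LocalSolution p h b w) (hp : 1 < p) (hh : Continuous h) (R : ℝ) :
    ∀ᵐ τ ∂(volume.restrict (Set.Icc 0 b)),
      IntegrableOn (fun x => nonlin p ((h x : ℂ) * w τ x)) (Metric.closedBall 0 R) :=
  (lw.integrable_prod hp hh R).prod_right_ae

lemma integral_nonlin_mul_eq {ψ : Space n → ℂ} {R τ : ℝ} (hR : ∀ x, R < ‖x‖ → ψ x = 0) :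
    ∫ x, nonlin p ((h x : ℂ) * w τ x) * ψ x =
      ∫ x in Metric.closedBall 0 R, nonlin p ((h x : ℂ) * w τ x) * ψ x := by
  refine (setIntegral_eq_integral_of_forall_compl_eq_zero fun x hx => ?_).symm
  rw [hR x (by simpa using hx), mul_zero]

lemma integrableOn_integral_nonlin_mul (lw : LocalSolution p h b w) (hp : 1 < p)
    (hh : Continuous h) {R c : ℝ} {ψ : ℝ → Space n → ℂ}
    (hψ : StronglyMeasurable (Function.uncurry ψ)) (hc : ∀ τ x, ‖ψ τ x‖ ≤ c)
    (hR : ∀ τ x, R < ‖x‖ → ψ τ x = 0) :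
    IntegrableOn (fun τ => ∫ x, nonlin p ((h x : ℂ) * w τ x) * ψ τ x) (Set.Icc 0 b) := by
  simp_rw [fun τ => integral_nonlin_mul_eq (p := p) (h := h) (w := w) (τ := τ) (hR τ)]
  exact ((lw.integrable_prod hp hh R).mul_bdd (g := Function.uncurry ψ) (c := c)
    hψ.aestronglyMeasurable (ae_of_all _ fun q => hc q.1 q.2)).integral_prod_left

lemma integrable_nonlin_mul {R c τ : ℝ}
    (hτ : IntegrableOn (fun x => nonlin p ((h x : ℂ) * w τ x)) (Metric.closedBall 0 R))
    {ψ : Space n → ℂ} (hψ : AEStronglyMeasurable ψ volume) (hc : ∀ x, ‖ψ x‖ ≤ c)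
    (hR : ∀ x, R < ‖x‖ → ψ x = 0) : Integrable fun x => nonlin p ((h x : ℂ) * w τ x) * ψ x := by
  have h1 : IntegrableOn (fun x => nonlin p ((h x : ℂ) * w τ x) * ψ x) (Metric.closedBall 0 R) :=
    Integrable.mul_bdd (c := c) hτ hψ.restrict (ae_of_all _ hc)
  refine (integrableOn_iff_integrable_of_support_subset fun x hx => ?_).1 h1
  by_contra hx'
  exact hx (by simp only [hR x (by simpa using hx'), mul_zero])

lemma norm_integral_nonlin_mul_le {R c τ : ℝ}
    (hτ : IntegrableOn (fun x => nonlin p ((h x : ℂ) * w τ x)) (Metric.closedBall 0 R))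
    {ψ : Space n → ℂ} (hc : ∀ x, ‖ψ x‖ ≤ c) (hR : ∀ x, R < ‖x‖ → ψ x = 0) :
    ‖∫ x, nonlin p ((h x : ℂ) * w τ x) * ψ x‖ ≤ c * nonlinMass p h w R τ := by
  rw [integral_nonlin_mul_eq hR, nonlinMass, ← integral_const_mul]
  refine norm_integral_le_of_norm_le (hτ.norm.const_mul c) (ae_of_all _ fun x => ?_)
  rw [norm_mul, mul_comm]
  exact mul_le_mul_of_nonneg_right (hc x) (norm_nonneg _)

lemma continuous_nrm (lw : LocalSolution p h b w) : Continuous fun τ => nrm (w τ) := by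
  refine Metric.continuous_iff.2 fun t ε hε => ?_
  obtain ⟨δ, hδ, hd⟩ := lw.cont ε hε
  exact ⟨δ, hδ, fun s hs => (abs_nrm_sub_le (lw.memLp s) (lw.memLp t)).trans_lt (hd s t hs)⟩

lemma continuous_integral_mul (lw : LocalSolution p h b w) {G : Space n → ℂ} (hG : MemLp G 2 volume) :
    Continuous fun τ => ∫ x, w τ x * G x := by
  refine Metric.continuous_iff.2 fun t ε hε => ?_
  have hG0 : 0 ≤ nrm G := nrm_nonneg G
  obtain ⟨δ, hδ, hd⟩ := lw.cont (ε / (nrm G + 1)) (by positivity)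
  refine ⟨δ, hδ, fun s hs => ?_⟩
  have hst : MemLp (fun x => w s x - w t x) 2 volume := (lw.memLp s).sub (lw.memLp t)
  have i1 : Integrable fun x => w s x * G x := (lw.memLp s).integrable_mul hG
  have i2 : Integrable fun x => w t x * G x := (lw.memLp t).integrable_mul hG
  have e : (∫ x, w s x * G x) - ∫ x, w t x * G x = ∫ x, (w s x - w t x) * G x := by
    rw [← integral_sub i1 i2]; simp_rw [sub_mul]
  rw [dist_eq_norm, e]
  refine (norm_integral_mul_le hst hG).trans_lt ?_
  have h1 := hd s t hs
  rw [lt_div_iff₀ (by positivity)] at h1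
  nlinarith [nrm_nonneg fun x => w s x - w t x]

/-- Since `Re(-iz) = Im z`, the real part of the equation involves the imaginary part of the `|D|`
pairing. -/
lemma integral_re_sub_eq (lw : LocalSolution p h b w) (hn : 1 ≤ n) (hp : 1 < p) {K : ℝ≥0}
    (hK : LipschitzWith K h) {φ : Space n → ℂ} (hφ : IsTest φ) {s t : ℝ} (hs : 0 ≤ s) (hst : s ≤ t)
    (ht : t ≤ b) :
    (∫ x, w t x * ((h x : ℂ) * φ x)).re - (∫ x, w s x * ((h x : ℂ) * φ x)).re =
      ∫ τ in s..t, ((∫ x, w τ x * ((h x : ℂ) * absD φ x)).im +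
        (∫ x, nonlin p ((h x : ℂ) * w τ x) * φ x).re) := by
  obtain ⟨R, -, hR⟩ := exists_zero_of_hasCompactSupport hφ.hasCompactSupport
  obtain ⟨c, hc⟩ := exists_norm_le_of_zero hφ.contDiff.continuous hR
  have hX := lw.continuous_integral_mul (hφ.memLp_weight_mul_absD hn hK)
  have hN : IntegrableOn (fun τ => ∫ x, nonlin p ((h x : ℂ) * w τ x) * φ x) (Set.Icc 0 b) := by
    refine lw.integrableOn_integral_nonlin_mul hp hK.continuous (ψ := fun _ => φ) ?_ (fun _ => hc)
      fun _ => hR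
    exact (hφ.contDiff.continuous.comp continuous_snd).stronglyMeasurable
  set f : ℝ → ℂ := fun τ => -Complex.I * (∫ x, w τ x * ((h x : ℂ) * absD φ x)) +
    ∫ x, nonlin p ((h x : ℂ) * w τ x) * φ x with hf
  have hfi : ∀ s t, 0 ≤ s → s ≤ t → t ≤ b → IntervalIntegrable f volume s t := by
    intro s t hs hst ht
    refine (Continuous.intervalIntegrable (by fun_prop) _ _).add
      ((intervalIntegrable_iff_integrableOn_Icc_of_le hst).2
        (hN.mono_set (Set.Icc_subset_Icc hs ht)))
  have hE : ∀ t ∈ Set.Icc 0 b, ∫ x, w t x * ((h x : ℂ) * φ x) =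
      (∫ x, w 0 x * ((h x : ℂ) * φ x)) + ∫ τ in (0 : ℝ)..t, f τ := by
    intro t ht
    have h1 := lw.eqn φ hφ t ht
    have e1 : ∀ v g : Space n → ℂ, ∀ x, (h x : ℂ) * v x * g x = v x * ((h x : ℂ) * g x) :=
      fun v g x => by ring
    simp_rw [e1] at h1
    exact h1
  have h1 := hE t ⟨hs.trans hst, ht⟩
  have h2 := hE s ⟨hs, hst.trans ht⟩
  have h3 := intervalIntegral.integral_interval_sub_left (hfi 0 t le_rfl (hs.trans hst) ht)
    (hfi 0 s le_rfl hs (hst.trans ht))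
  have h4 : (∫ τ in s..t, f τ).re = ∫ τ in s..t, (f τ).re :=
    (Complex.reCLM.intervalIntegral_comp_comm (hfi s t hs hst ht)).symm
  rw [h1, h2, ← Complex.sub_re, add_sub_add_left_eq_sub, h3, h4]
  congr 1
  ext τ
  simp [hf]

end LocalSolution

/-! ### The weak differential inequality -/

/-- Lower bound for the pairing with `h |D| φ` when `h φ` is close to `ψ`. -/
lemma im_integral_mul_absD_sub_le (hn : 1 ≤ n) {h : Space n → ℝ} {K : ℝ≥0} (hK : LipschitzWith K h)
    (hA : commNorm h ≠ ⊤) {f φ ψ v : Space n → ℂ} (hf : IsTest f) (hφ : IsTest φ) (hψ : IsTest ψ)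
    (hv : MemLp v 2 volume) {L : ℝ≥0} {R C θ : ℝ} (hL : LipschitzWith L fun x => (h x : ℂ) * φ x)
    (hR : ∀ x, R < ‖x‖ → φ x = 0)
    (hC : energyConst n L (R + 1) + (commNorm h).toReal * nrm (fun x => (h x : ℂ) * φ x) ≤ C)
    (hθ : nrm (fun x => v x - f x) ≤ θ) :
    (∫ x, v x * absD ψ x).im - (commNorm h).toReal * nrm v * nrm ψ -
        θ * (C + nrm (absD ψ) + (commNorm h).toReal * nrm ψ) -
        (nrm (absD f) + (commNorm h).toReal * nrm f) * nrm (fun x => (h x : ℂ) * φ x - ψ x) ≤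
      (∫ x, v x * ((h x : ℂ) * absD φ x)).im := by
  set A := (commNorm h).toReal with hAd
  have hA0 : 0 ≤ A := ENNReal.toReal_nonneg
  have hhφ : MemLp (fun x => (h x : ℂ) * φ x) 2 volume :=
    hL.continuous.memLp_of_hasCompactSupport
      (hasCompactSupport_of_zero (R := R) fun x hx => by rw [hR x hx, mul_zero])
  have hG := hφ.memLp_weight_mul_absD hn hK
  have hvf : MemLp (fun x => v x - f x) 2 volume := hv.sub (hf.memLp 2)
  have hcomm : ∀ f, IsTest f → ‖(∫ x, f x * ((h x : ℂ) * absD φ x)) -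
      ∫ x, absD f x * ((h x : ℂ) * φ x)‖ ≤ A * nrm f * nrm (fun x => (h x : ℂ) * φ x) := by
    intro f hf
    have h1 := norm_commutator_le hA hf.toSchwartz hφ.toSchwartz hhφ
    simp only [IsTest.coe_toSchwartz] at h1
    have e1 : ∀ x, (h x : ℂ) * f x * absD φ x = f x * ((h x : ℂ) * absD φ x) := fun x => by ring
    have e2 : ∀ x, (h x : ℂ) * absD f x * φ x = absD f x * ((h x : ℂ) * φ x) := fun x => by ring
    simp_rw [e1, e2] at h1
    exact h1
  -- On test functions, commuting `h` past `|D|` costs the commutator norm, and the remaining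
  -- pairing is bounded through the Lipschitz constant of `h φ`. Density gives a bound on `L²` that
  -- does not see higher derivatives of `φ`.
  have hX : ‖∫ x, (v x - f x) * ((h x : ℂ) * absD φ x)‖ ≤ C * nrm (fun x => v x - f x) := by
    refine norm_integral_mul_le_of_dense hG (fun f hf => ?_) hvf
    have h1 := hcomm f hf
    have h2 := norm_integral_absD_mul_le_of_lipschitzWith hn hf hL (R := R)
      fun x hx => by rw [hR x hx, mul_zero]
    have h3 := norm_add_le ((∫ x, f x * ((h x : ℂ) * absD φ x)) -
      ∫ x, absD f x * ((h x : ℂ) * φ x)) (∫ x, absD f x * ((h x : ℂ) * φ x))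
    rw [sub_add_cancel] at h3
    have h4 := mul_le_mul_of_nonneg_right hC (nrm_nonneg f)
    nlinarith
  have e1 : ∫ x, (v x - f x) * ((h x : ℂ) * absD φ x) =
      (∫ x, v x * ((h x : ℂ) * absD φ x)) - ∫ x, f x * ((h x : ℂ) * absD φ x) := by
    have i1 : Integrable fun x => v x * ((h x : ℂ) * absD φ x) := hv.integrable_mul hG
    have i2 : Integrable fun x => f x * ((h x : ℂ) * absD φ x) := (hf.memLp 2).integrable_mul hG
    rw [← integral_sub i1 i2]; simp_rw [sub_mul]
  have hfD := hf.memLp_absD hn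
  have hψD := hψ.memLp_absD hn
  have e2 : ∫ x, absD f x * ((h x : ℂ) * φ x - ψ x) =
      (∫ x, absD f x * ((h x : ℂ) * φ x)) - ∫ x, absD f x * ψ x := by
    have i1 : Integrable fun x => absD f x * ((h x : ℂ) * φ x) := hfD.integrable_mul hhφ
    have i2 : Integrable fun x => absD f x * ψ x := hfD.integrable_mul (hψ.memLp 2)
    rw [← integral_sub i1 i2]; simp_rw [mul_sub]
  have e3 : ∫ x, (v x - f x) * absD ψ x = (∫ x, v x * absD ψ x) - ∫ x, f x * absD ψ x := by
    have i1 : Integrable fun x => v x * absD ψ x := hv.integrable_mul hψD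
    have i2 : Integrable fun x => f x * absD ψ x := (hf.memLp 2).integrable_mul hψD
    rw [← integral_sub i1 i2]; simp_rw [sub_mul]
  have e4 : ∫ x, absD f x * ψ x = ∫ x, f x * absD ψ x := by
    have := integral_absD_mul_comm hf.toSchwartz hψ.toSchwartz
    simpa only [IsTest.coe_toSchwartz] using this
  have hsub : MemLp (fun x => (h x : ℂ) * φ x - ψ x) 2 volume := hhφ.sub (hψ.memLp 2)
  have b1 := (Complex.abs_im_le_norm _).trans hX
  have b2 := (Complex.abs_im_le_norm _).trans (hcomm f hf)
  have b3 := (Complex.abs_im_le_norm _).trans (norm_integral_mul_le hfD hsub)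
  have b4 := (Complex.abs_im_le_norm _).trans (norm_integral_mul_le hvf hψD)
  rw [e1, Complex.sub_im] at b1
  rw [Complex.sub_im] at b2
  rw [e2, Complex.sub_im, e4] at b3
  rw [e3, Complex.sub_im] at b4
  have c1 := (abs_le.1 b1).1
  have c2 := (abs_le.1 b2).1
  have c3 := (abs_le.1 b3).1
  have c4 := (abs_le.1 b4).2
  have n1 := (abs_le.1 (abs_nrm_sub_le (hf.memLp 2) hv)).2
  have n1' : nrm (fun x => f x - v x) = nrm (fun x => v x - f x) := by
    rw [← nrm_neg]; simp
  rw [n1'] at n1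
  have n2 := (abs_le.1 (abs_nrm_sub_le hhφ (hψ.memLp 2))).2
  have hC0 : 0 ≤ C := (add_nonneg (Real.sqrt_nonneg _) (mul_nonneg hA0 (nrm_nonneg _))).trans hC
  have f0 := nrm_nonneg f
  have p0 := nrm_nonneg ψ
  have m1 := mul_le_mul_of_nonneg_left hθ hC0
  have m2 := mul_le_mul_of_nonneg_right hθ (nrm_nonneg (absD ψ))
  have m3 : A * nrm f * nrm (fun x => (h x : ℂ) * φ x) ≤
      A * nrm f * (nrm ψ + nrm (fun x => (h x : ℂ) * φ x - ψ x)) := by gcongr; linarith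
  have m4 : A * nrm f * nrm ψ ≤ A * (nrm v + θ) * nrm ψ := by gcongr; linarith
  nlinarith

namespace LocalSolution

variable {p : ℝ} {h : Space n → ℝ} {b : ℝ} {w : ℝ → Space n → ℂ}

lemma norm_div_le {m c : ℝ} (hm : ∀ x, |(h x)⁻¹| ≤ m) {ψ : Space n → ℂ} (hc : ∀ x, ‖ψ x‖ ≤ c)
    (x : Space n) : ‖ψ x / h x‖ ≤ c * m := by
  rw [div_eq_mul_inv, norm_mul, ← Complex.ofReal_inv, Complex.norm_real, Real.norm_eq_abs]
  exact mul_le_mul (hc x) (hm x) (abs_nonneg _) ((norm_nonneg _).trans (hc x))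

/-- The integrand of the weak differential inequality tested with `ψ`. -/
def weakRate (p : ℝ) (h : Space n → ℝ) (w : ℝ → Space n → ℂ) (ψ : Space n → ℂ) (τ : ℝ) : ℝ :=
  (∫ x, w τ x * absD ψ x).im - (commNorm h).toReal * nrm (w τ) * nrm ψ +
    (∫ x, nonlin p ((h x : ℂ) * w τ x) * (ψ x / h x)).re

lemma integrableOn_weakRate (lw : LocalSolution p h b w) (hn : 1 ≤ n) (hp : 1 < p)
    (hh : Continuous h) (hne : ∀ x, h x ≠ 0) {m : ℝ} (hm : ∀ x, |(h x)⁻¹| ≤ m)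
    {ψ : Space n → ℂ} (hψ : IsTest ψ) : IntegrableOn (weakRate p h w ψ) (Set.Icc 0 b) := by
  obtain ⟨R, -, hR⟩ := exists_zero_of_hasCompactSupport hψ.hasCompactSupport
  obtain ⟨c, hc⟩ := exists_norm_le_of_zero hψ.contDiff.continuous hR
  have hcd : Continuous fun x => ψ x / (h x : ℂ) :=
    hψ.contDiff.continuous.div (by fun_prop) fun x => by exact_mod_cast hne x
  have hN : IntegrableOn (fun τ => ∫ x, nonlin p ((h x : ℂ) * w τ x) * (ψ x / h x))
      (Set.Icc 0 b) := by
    refine lw.integrableOn_integral_nonlin_mul hp hh (ψ := fun _ x => ψ x / h x) ?_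
      (fun _ => norm_div_le hm hc) (R := R) fun _ x hx => by rw [hR x hx, zero_div]
    exact (hcd.comp continuous_snd).stronglyMeasurable
  have h1 := lw.continuous_integral_mul (hψ.memLp_absD hn)
  have h2 := lw.continuous_nrm
  refine IntegrableOn.add (ContinuousOn.integrableOn_Icc (Continuous.continuousOn ?_)) ?_
  · fun_prop
  · exact hN.re

/-- The weak differential inequality on a short interval, with an error term. -/
lemma exists_integral_weakRate_sub_le (lw : LocalSolution p h b w) (hn : 1 ≤ n) (hp : 1 < p)
    {K : ℝ≥0} (hK : LipschitzWith K h) (hA : commNorm h ≠ ⊤) (hne : ∀ x, h x ≠ 0) {m : ℝ}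
    (hm : ∀ x, |(h x)⁻¹| ≤ m) {ψ : Space n → ℂ} (hψ : IsTest ψ) :
    ∃ C : ℝ, 0 ≤ C ∧ ∀ η > 0, ∀ s t, 0 ≤ s → s ≤ t → t ≤ b →
      (∀ τ ∈ Set.Icc s t, nrm (fun x => w τ x - w s x) ≤ η) →
      (∫ τ in s..t, weakRate p h w ψ τ) - η * (C * (t - s)) ≤
        (∫ x, w t x * ψ x).re - (∫ x, w s x * ψ x).re := by
  obtain ⟨φ, L, R, hφ, hL, hR, hψR, hlim, e, he, hφe⟩ := exists_seq_isTest_div hK hne hm hψ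
  set A := (commNorm h).toReal with hAd
  have hA0 : 0 ≤ A := ENNReal.toReal_nonneg
  set C₁ := energyConst n L (R + 1) + A * (nrm ψ + 1) with hC₁
  have hp0 := nrm_nonneg ψ
  have hC₁0 : 0 ≤ C₁ := add_nonneg (Real.sqrt_nonneg _) (by positivity)
  refine ⟨2 * (C₁ + nrm (absD ψ) + A * nrm ψ), ?_, fun η hη s t hs hst ht hτ => ?_⟩
  · have := nrm_nonneg (absD ψ); positivity
  -- A single test function within `η` of `w s` is within `2η` of `w τ` throughout the interval. It
  -- is fixed before `k → ∞`: the norm of `|D| f` may be huge, but it is multiplied by `δ k`, which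
  -- tends to zero.
  obtain ⟨fseq, hfs, hfl⟩ := exists_seq_isTest (lw.memLp s)
  obtain ⟨j, hj⟩ := (hfl.eventually (gt_mem_nhds hη)).exists
  have hf := hfs j
  set f := fseq j with hfd
  have hhφ : ∀ k, MemLp (fun x => (h x : ℂ) * φ k x) 2 volume := fun k =>
    (hL k).continuous.memLp_of_hasCompactSupport
      (hasCompactSupport_of_zero (R := R) fun x hx => by rw [hR k x hx, mul_zero])
  set δ : ℕ → ℝ := fun k => nrm (fun x => (h x : ℂ) * φ k x - ψ x) with hδ
  set D := nrm (absD f) + A * nrm f with hD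
  have hclose : ∀ τ ∈ Set.Icc s t, nrm (fun x => w τ x - f x) ≤ 2 * η := by
    intro τ hτ'
    have h1 : MemLp (fun x => w τ x - w s x) 2 volume := (lw.memLp τ).sub (lw.memLp s)
    have h2 : MemLp (fun x => f x - w s x) 2 volume := (hf.memLp 2).sub (lw.memLp s)
    have h3 := nrm_sub_le h1 h2
    simp only [sub_sub_sub_cancel_right] at h3
    linarith [hτ τ hτ']
  have hevent : ∀ᶠ k in atTop, (∫ τ in s..t, weakRate p h w ψ τ) -
      η * (2 * (C₁ + nrm (absD ψ) + A * nrm ψ) * (t - s)) - D * δ k * (t - s) -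
        e k * (∫ τ in s..t, nonlinMass p h w R τ) ≤
      (∫ x, w t x * ((h x : ℂ) * φ k x)).re - (∫ x, w s x * ((h x : ℂ) * φ k x)).re := by
    -- Requiring `δ k < 1` bounds the norm of `h φ k` by `nrm ψ + 1`, which makes `C₁` independent
    -- of `k` and of `η`.
    filter_upwards [hlim.eventually (gt_mem_nhds one_pos)] with k hk
    rw [lw.integral_re_sub_eq hn hp hK (hφ k) hs hst ht]
    have hsub : Set.Icc s t ⊆ Set.Icc 0 b := Set.Icc_subset_Icc hs ht
    have hi1 : IntervalIntegrable (weakRate p h w ψ) volume s t :=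
      (intervalIntegrable_iff_integrableOn_Icc_of_le hst).2
        ((lw.integrableOn_weakRate hn hp hK.continuous hne hm hψ).mono_set hsub)
    have hi2 : IntervalIntegrable (nonlinMass p h w R) volume s t :=
      (intervalIntegrable_iff_integrableOn_Icc_of_le hst).2
        ((lw.integrableOn_nonlinMass hp hK.continuous R).mono_set hsub)
    have hi3 : IntervalIntegrable (fun τ => (∫ x, w τ x * ((h x : ℂ) * absD (φ k) x)).im +
        (∫ x, nonlin p ((h x : ℂ) * w τ x) * φ k x).re) volume s t := by
      obtain ⟨c, hc⟩ := exists_norm_le_of_zero (hφ k).contDiff.continuous (hR k)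
      have hN : IntegrableOn (fun τ => ∫ x, nonlin p ((h x : ℂ) * w τ x) * φ k x)
          (Set.Icc 0 b) := by
        refine lw.integrableOn_integral_nonlin_mul hp hK.continuous (ψ := fun _ => φ k) ?_
          (fun _ => hc) fun _ => hR k
        exact ((hφ k).contDiff.continuous.comp continuous_snd).stronglyMeasurable
      have hX := lw.continuous_integral_mul ((hφ k).memLp_weight_mul_absD hn hK)
      refine (Continuous.intervalIntegrable (by fun_prop) _ _).add ?_
      exact (intervalIntegrable_iff_integrableOn_Icc_of_le hst).2 (hN.mono_set hsub).re
    have hi4 : IntervalIntegrable (fun _ : ℝ => η * (2 * (C₁ + nrm (absD ψ) + A * nrm ψ)) + D * δ k)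
      volume s t := intervalIntegrable_const
    have hconst : ∫ τ in s..t, (weakRate p h w ψ τ -
          (η * (2 * (C₁ + nrm (absD ψ) + A * nrm ψ)) + D * δ k) - e k * nonlinMass p h w R τ) =
        (∫ τ in s..t, weakRate p h w ψ τ) -
          η * (2 * (C₁ + nrm (absD ψ) + A * nrm ψ) * (t - s)) - D * δ k * (t - s) -
          e k * (∫ τ in s..t, nonlinMass p h w R τ) := by
      rw [intervalIntegral.integral_sub (hi1.sub hi4) (hi2.const_mul _),
        intervalIntegral.integral_sub hi1 hi4, intervalIntegral.integral_const_mul,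
        intervalIntegral.integral_const, smul_eq_mul]
      ring
    rw [← hconst]
    refine intervalIntegral.integral_mono_ae_restrict hst ((hi1.sub hi4).sub (hi2.const_mul _)) hi3 ?_
    have hae := ae_restrict_of_ae_restrict_of_subset hsub
      (lw.ae_integrableOn_nonlin hp hK.continuous R)
    filter_upwards [hae, ae_restrict_mem measurableSet_Icc] with τ hτi hτm
    have hCk : energyConst n L (R + 1) + A * nrm (fun x => (h x : ℂ) * φ k x) ≤ C₁ := by
      have h1 := (abs_le.1 (abs_nrm_sub_le (hhφ k) (hψ.memLp 2))).2
      rw [hC₁]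
      gcongr
      linarith
    have h1 := im_integral_mul_absD_sub_le hn hK hA hf (hφ k) hψ (lw.memLp τ) (hL k) (hR k) hCk
      (hclose τ hτm)
    have hcd : Continuous fun x => ψ x / (h x : ℂ) :=
      hψ.contDiff.continuous.div (by have := hK.continuous; fun_prop)
        fun x => by exact_mod_cast hne x
    obtain ⟨c, hc⟩ := exists_norm_le_of_zero hψ.contDiff.continuous hψR
    obtain ⟨c', hc'⟩ := exists_norm_le_of_zero (hφ k).contDiff.continuous (hR k)
    have j1 := integrable_nonlin_mul hτi (hφ k).contDiff.continuous.aestronglyMeasurable hc' (hR k)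
    have j2 := integrable_nonlin_mul hτi hcd.aestronglyMeasurable (norm_div_le hm hc)
      fun x hx => by rw [hψR x hx, zero_div]
    have h2 := norm_integral_nonlin_mul_le hτi (hφe k)
      fun x hx => by rw [hψR x hx, zero_div, hR k x hx, sub_zero]
    have e1 : ∫ x, nonlin p ((h x : ℂ) * w τ x) * (φ k x - ψ x / h x) =
        (∫ x, nonlin p ((h x : ℂ) * w τ x) * φ k x) -
          ∫ x, nonlin p ((h x : ℂ) * w τ x) * (ψ x / h x) := by
      rw [← integral_sub j1 j2]; simp_rw [mul_sub]
    have h3 := (Complex.abs_re_le_norm _).trans h2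
    rw [e1, Complex.sub_re] at h3
    have h4 := (abs_le.1 h3).1
    simp only [weakRate]
    simp only [hδ, hD]
    linarith
  have hl : ∀ τ, Tendsto (fun k => (∫ x, w τ x * ((h x : ℂ) * φ k x)).re) atTop
      (𝓝 (∫ x, w τ x * ψ x).re) := by
    intro τ
    have h1 := tendsto_integral_mul (hψ.memLp 2) hhφ (lw.memLp τ) hlim
    simp_rw [mul_comm _ (w τ _)] at h1
    exact (Complex.continuous_re.tendsto _).comp h1
  have hl2 : Tendsto (fun k => (∫ τ in s..t, weakRate p h w ψ τ) -
      η * (2 * (C₁ + nrm (absD ψ) + A * nrm ψ) * (t - s)) - D * δ k * (t - s) -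
        e k * (∫ τ in s..t, nonlinMass p h w R τ)) atTop
      (𝓝 ((∫ τ in s..t, weakRate p h w ψ τ) -
      η * (2 * (C₁ + nrm (absD ψ) + A * nrm ψ) * (t - s)) - D * 0 * (t - s) -
        0 * (∫ τ in s..t, nonlinMass p h w R τ))) :=
    (tendsto_const_nhds.sub ((hlim.const_mul D).mul_const _)).sub (he.mul_const _)
  have := le_of_tendsto_of_tendsto hl2 ((hl t).sub (hl s)) hevent
  simpa using this

/-- The weak differential inequality. -/
lemma integral_weakRate_le (lw : LocalSolution p h b w) (hn : 1 ≤ n) (hp : 1 < p)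
    {K : ℝ≥0} (hK : LipschitzWith K h) (hA : commNorm h ≠ ⊤) (hne : ∀ x, h x ≠ 0) {m : ℝ}
    (hm : ∀ x, |(h x)⁻¹| ≤ m) {ψ : Space n → ℂ} (hψ : IsTest ψ) {s t : ℝ} (hs : 0 ≤ s)
    (hst : s ≤ t) (ht : t ≤ b) :
    ∫ τ in s..t, weakRate p h w ψ τ ≤ (∫ x, w t x * ψ x).re - (∫ x, w s x * ψ x).re := by
  obtain ⟨C, hC0, hC⟩ := lw.exists_integral_weakRate_sub_le hn hp hK hA hne hm hψ
  -- The error `η C (t - s)` is `η` times the integral of a constant, and uniform continuity of the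
  -- curve makes `η` arbitrarily small on short intervals.
  refine integral_le_sub_of_partition (F := fun τ => (∫ x, w τ x * ψ x).re) (g := fun _ => C) hst
    ((lw.integrableOn_weakRate hn hp hK.continuous hne hm hψ).mono_set (Set.Icc_subset_Icc hs ht))
    (by simp) fun ε hε => ?_
  obtain ⟨δ, hδ, hd⟩ := lw.cont ε hε
  refine ⟨δ, hδ, fun s' t' h1 h2 h3 h4 => ?_⟩
  have := hC ε hε s' t' (hs.trans h1) h2 (h3.trans ht) fun τ hτ => (hd τ s' ?_).le
  · simpa [mul_comm] using this
  · rw [abs_of_nonneg (by linarith [hτ.1])]; linarith [hτ.2]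

end LocalSolution

/-! ### The regularized energy -/

/-- The regularization of the complex conjugate. -/
def conjSmoother (ρ : ContDiffBump (0 : Space n)) (R : ℝ) (v : Space n → ℂ) : Space n → ℂ :=
  smoother ρ R fun y => (starRingEnd ℂ) (v y)

lemma isTest_conjSmoother (ρ : ContDiffBump (0 : Space n)) {R : ℝ} (hR : 0 < R) {v : Space n → ℂ}
    (hv : MemLp v 2 volume) : IsTest (conjSmoother ρ R v) :=
  isTest_smoother ρ hR ((memLp_conj hv).locallyIntegrable (by norm_num))

lemma conjSmoother_add (ρ : ContDiffBump (0 : Space n)) {R : ℝ} (hR : 0 < R) {v w : Space n → ℂ}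
    (hv : MemLp v 2 volume) (hw : MemLp w 2 volume) (x : Space n) :
    conjSmoother ρ R (fun y => v y + w y) x = conjSmoother ρ R v x + conjSmoother ρ R w x := by
  unfold conjSmoother
  simp_rw [map_add]
  exact smoother_add ρ hR ((memLp_conj hv).locallyIntegrable (by norm_num))
    ((memLp_conj hw).locallyIntegrable (by norm_num)) x

/-- The smoothing operator is symmetric and commutes with conjugation, so the associated
sesquilinear form is Hermitian. -/
lemma re_integral_mul_conjSmoother_comm (ρ : ContDiffBump (0 : Space n)) (R : ℝ) {v w : Space n → ℂ}
    (hv : MemLp v 2 volume) (hw : MemLp w 2 volume) :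
    (∫ x, v x * conjSmoother ρ R w x).re = (∫ x, w x * conjSmoother ρ R v x).re := by
  unfold conjSmoother
  rw [integral_mul_smoother_comm ρ R hv (memLp_conj hw)]
  have e : ∀ x, (starRingEnd ℂ) (w x) * smoother ρ R v x =
      (starRingEnd ℂ) (w x * smoother ρ R (fun y => (starRingEnd ℂ) (v y)) x) := by
    intro x
    rw [smoother_conj, map_mul, Complex.conj_conj]
  simp_rw [e]
  rw [integral_conj, Complex.conj_re]

/-- The regularized energy. -/
def regEnergy (ρ : ContDiffBump (0 : Space n)) (R : ℝ) (v : Space n → ℂ) : ℝ :=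
  (∫ x, v x * conjSmoother ρ R v x).re

/-- Polarization: a Hermitian quadratic form `Q` satisfies `Q(v) - Q(w) = Re⟨v - w, S(v + w)⟩`. The
increment between two times is thus the increment of a pairing with one fixed test function, to
which the weak inequality applies. -/
lemma regEnergy_sub (ρ : ContDiffBump (0 : Space n)) {R : ℝ} (hR : 0 < R) {v w : Space n → ℂ}
    (hv : MemLp v 2 volume) (hw : MemLp w 2 volume) :
    regEnergy ρ R v - regEnergy ρ R w =
      (∫ x, v x * conjSmoother ρ R (fun y => v y + w y) x).re -
        (∫ x, w x * conjSmoother ρ R (fun y => v y + w y) x).re := by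
  have h1 := re_integral_mul_conjSmoother_comm ρ R hv hw
  have hvS := (isTest_conjSmoother ρ hR hv).memLp 2
  have hwS := (isTest_conjSmoother ρ hR hw).memLp 2
  have e : ∀ u : Space n → ℂ, MemLp u 2 volume →
      ∫ x, u x * conjSmoother ρ R (fun y => v y + w y) x =
        (∫ x, u x * conjSmoother ρ R v x) + ∫ x, u x * conjSmoother ρ R w x := by
    intro u hu
    have i1 : Integrable fun x => u x * conjSmoother ρ R v x := hu.integrable_mul hvS
    have i2 : Integrable fun x => u x * conjSmoother ρ R w x := hu.integrable_mul hwS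
    rw [← integral_add i1 i2]
    simp_rw [conjSmoother_add ρ hR hv hw, mul_add]
  rw [e v hv, e w hw, Complex.add_re, Complex.add_re, regEnergy, regEnergy]
  linarith

lemma stronglyMeasurable_moll (ρ : ContDiffBump (0 : Space n)) {w : ℝ → Space n → ℂ}
    (hw : StronglyMeasurable (Function.uncurry w)) :
    StronglyMeasurable fun q : ℝ × Space n => moll ρ (w q.1) q.2 := by
  unfold moll
  have hm : Measurable fun q : (ℝ × Space n) × Space n => w q.1.1 q.2 :=
    hw.measurable.comp (by fun_prop : Measurable fun q : (ℝ × Space n) × Space n => (q.1.1, q.2))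
  have hk : Measurable fun q : (ℝ × Space n) × Space n => (mker ρ (q.1.2 - q.2) : ℂ) :=
    (by fun_prop : Continuous fun q : (ℝ × Space n) × Space n => (mker ρ (q.1.2 - q.2) : ℂ)).measurable
  exact (hk.mul hm).stronglyMeasurable.integral_prod_right

lemma stronglyMeasurable_conjSmoother (ρ : ContDiffBump (0 : Space n)) (R : ℝ)
    {w : ℝ → Space n → ℂ} (hw : StronglyMeasurable (Function.uncurry w)) :
    StronglyMeasurable fun q : ℝ × Space n => conjSmoother ρ R (w q.1) q.2 := by
  unfold conjSmoother smoother
  have h1 : StronglyMeasurable (Function.uncurry fun t x => (starRingEnd ℂ) (w t x)) :=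
    (Complex.continuous_conj.measurable.comp hw.measurable).stronglyMeasurable
  have h2 := stronglyMeasurable_moll ρ h1
  have h3 : Measurable fun q : ℝ × Space n => (cutoff R q.2 : ℂ) :=
    (by fun_prop : Continuous fun q : ℝ × Space n => (cutoff R q.2 : ℂ)).measurable
  exact stronglyMeasurable_moll ρ (w := fun t x => (cutoff R x : ℂ) *
    moll ρ (fun y => (starRingEnd ℂ) (w t y)) x) (h3.mul h2.measurable).stronglyMeasurable

namespace LocalSolution

variable {p : ℝ} {h : Space n → ℝ} {b : ℝ} {w : ℝ → Space n → ℂ}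

/-- The contribution of the nonlinearity to the growth of the regularized energy. -/
def nonlinRate (p : ℝ) (h : Space n → ℝ) (w : ℝ → Space n → ℂ) (ρ : ContDiffBump (0 : Space n))
    (R τ : ℝ) : ℝ :=
  (∫ x, nonlin p ((h x : ℂ) * w τ x) * (conjSmoother ρ R (w τ) x / h x)).re

lemma exists_nrm_le (lw : LocalSolution p h b w) : ∃ M : ℝ, 0 ≤ M ∧ ∀ τ ∈ Set.Icc 0 b, nrm (w τ) ≤ M := by
  obtain ⟨M, hM⟩ := isCompact_Icc.exists_bound_of_continuousOn
    (lw.continuous_nrm.continuousOn (s := Set.Icc 0 b))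
  exact ⟨max M 0, le_max_right _ _, fun τ hτ =>
    (le_abs_self _).trans ((hM τ hτ).trans (le_max_left _ _))⟩

lemma integrableOn_nonlinRate (lw : LocalSolution p h b w) (hp : 1 < p) (hh : Continuous h)
    {m : ℝ} (hm : ∀ x, |(h x)⁻¹| ≤ m) {ρ : ContDiffBump (0 : Space n)} {R : ℝ} (hR : 0 < R)
    (hρ : ρ.rOut ≤ 1) : IntegrableOn (nonlinRate p h w ρ R) (Set.Icc 0 b) := by
  obtain ⟨C, hC0, hC⟩ := exists_norm_smoother_le ρ R
  obtain ⟨M, hM0, hM⟩ := lw.exists_nrm_le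
  -- The indicator in time makes the sup bound `C * M * m` hold for every `τ`; the norms of `w τ`
  -- have been bounded only on `[0, b]`.
  set ψ : ℝ → Space n → ℂ := fun τ x =>
    (Set.Icc 0 b).indicator (fun τ => conjSmoother ρ R (w τ) x / h x) τ with hψ
  have hψm : StronglyMeasurable (Function.uncurry ψ) := by
    have h1 : Measurable fun q : ℝ × Space n => conjSmoother ρ R (w q.1) q.2 / h q.2 :=
      (stronglyMeasurable_conjSmoother ρ R lw.meas).measurable.div (by fun_prop)
    have h2 : MeasurableSet ((Set.Icc 0 b) ×ˢ (Set.univ : Set (Space n))) :=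
      measurableSet_Icc.prod MeasurableSet.univ
    have e : Function.uncurry ψ = ((Set.Icc 0 b) ×ˢ (Set.univ : Set (Space n))).indicator
        fun q : ℝ × Space n => conjSmoother ρ R (w q.1) q.2 / h q.2 := by
      ext ⟨τ, x⟩
      by_cases hτ : τ ∈ Set.Icc 0 b
      · rw [Set.indicator_of_mem (by exact ⟨hτ, trivial⟩)]
        simp only [Function.uncurry, hψ, Set.indicator_of_mem hτ]
      · rw [Set.indicator_of_notMem (by exact fun h => hτ h.1)]
        simp only [Function.uncurry, hψ, Set.indicator_of_notMem hτ]
    rw [e]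
    exact (h1.indicator h2).stronglyMeasurable
  have hm0 : 0 ≤ m := (abs_nonneg _).trans (hm 0)
  have h1 := lw.integrableOn_integral_nonlin_mul hp hh (ψ := ψ) (R := 2 * R + 1) (c := C * M * m) hψm
    ?_ ?_
  · refine (h1.congr_fun (fun τ hτ => ?_) measurableSet_Icc).re
    simp only [hψ, Set.indicator_of_mem hτ]
  · intro τ x
    by_cases hτ : τ ∈ Set.Icc 0 b
    · simp only [hψ, Set.indicator_of_mem hτ]
      refine norm_div_le hm (fun x => (hC _ (memLp_conj (lw.memLp τ)) x).trans ?_) x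
      rw [nrm_conj]
      exact mul_le_mul_of_nonneg_left (hM τ hτ) hC0
    · simp only [hψ, Set.indicator_of_notMem hτ, norm_zero]
      positivity
  · intro τ x hx
    by_cases hτ : τ ∈ Set.Icc 0 b
    · simp only [hψ, Set.indicator_of_mem hτ]
      rw [conjSmoother, smoother_eq_zero hR hρ _ hx, zero_div]
    · simp only [hψ, Set.indicator_of_notMem hτ]

/-- The growth rate of the regularized energy. -/
def regRate (p : ℝ) (h : Space n → ℝ) (w : ℝ → Space n → ℂ) (ρ : ContDiffBump (0 : Space n))
    {R : ℝ} (hR : 0 < R) (τ : ℝ) : ℝ :=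
  -(2 * (Real.pi * cutoffConst (cutoffSchwartz (n := n) hR)) + 2 * (commNorm h).toReal) *
    nrm (w τ) ^ 2 + 2 * nonlinRate p h w ρ R τ

lemma integrableOn_regRate (lw : LocalSolution p h b w) (hp : 1 < p) (hh : Continuous h)
    {m : ℝ} (hm : ∀ x, |(h x)⁻¹| ≤ m) {ρ : ContDiffBump (0 : Space n)} {R : ℝ} (hR : 0 < R)
    (hρ : ρ.rOut ≤ 1) : IntegrableOn (regRate p h w ρ hR) (Set.Icc 0 b) := by
  have h2 := lw.continuous_nrm
  refine IntegrableOn.add (ContinuousOn.integrableOn_Icc (Continuous.continuousOn ?_))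
    ((lw.integrableOn_nonlinRate hp hh hm hR hρ).const_mul 2)
  fun_prop

/-- Write `w t + w s = 2 w τ + d` with `‖d‖ ≤ 2η`. The part from `2 w τ` yields the growth rate of
the regularized energy, with the cutoff estimate for its `|D|` term; the part from `d` is absorbed
by the boundedness of the forms at fixed `ρ` and `R`. -/
lemma exists_regRate_le_weakRate (lw : LocalSolution p h b w) (hn : 1 ≤ n)
    (hh : Continuous h) (hne : ∀ x, h x ≠ 0) {m : ℝ} (hm : ∀ x, |(h x)⁻¹| ≤ m)
    {ρ : ContDiffBump (0 : Space n)} {R : ℝ} (hR : 0 < R) (hρ : ρ.rOut ≤ 1) :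
    ∃ C : ℝ, 0 ≤ C ∧ ∀ s t τ η : ℝ, nrm (fun x => w t x - w τ x) ≤ η →
      nrm (fun x => w s x - w τ x) ≤ η →
      IntegrableOn (fun x => nonlin p ((h x : ℂ) * w τ x)) (Metric.closedBall 0 (2 * R + 1)) →
      regRate p h w ρ hR τ - η * (C * (nrm (w τ) + nonlinMass p h w (2 * R + 1) τ)) ≤
        weakRate p h w (conjSmoother ρ R fun x => w t x + w s x) τ := by
  obtain ⟨C, hC0, hC⟩ := exists_norm_integral_mul_absD_smoother_le hn hR hρ
  obtain ⟨C', hC'0, hC'⟩ := exists_norm_smoother_le ρ R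
  set A := (commNorm h).toReal with hAd
  have hA0 : 0 ≤ A := ENNReal.toReal_nonneg
  have hm0 : 0 ≤ m := (abs_nonneg _).trans (hm 0)
  refine ⟨2 * C + 2 * A + 2 * C' * m, by positivity, fun s t τ η ht hs hτ => ?_⟩
  have hwτ := lw.memLp τ
  have hd1 : MemLp (fun x => w t x - w τ x) 2 volume := (lw.memLp t).sub hwτ
  have hd2 : MemLp (fun x => w s x - w τ x) 2 volume := (lw.memLp s).sub hwτ
  set d : Space n → ℂ := fun x => (w t x - w τ x) + (w s x - w τ x) with hd
  have hdL : MemLp d 2 volume := hd1.add hd2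
  have hdn : nrm d ≤ 2 * η := (nrm_add_le hd1 hd2).trans (by linarith)
  have h2L : MemLp (fun x => w τ x + w τ x) 2 volume := hwτ.add hwτ
  have hsL : MemLp (fun x => w t x + w s x) 2 volume := (lw.memLp t).add (lw.memLp s)
  set ψ := conjSmoother ρ R fun x => w t x + w s x with hψ
  set S := conjSmoother ρ R (w τ) with hS
  have hψT : IsTest ψ := isTest_conjSmoother ρ hR hsL
  have hST : IsTest S := isTest_conjSmoother ρ hR hwτ
  have hdT : IsTest (conjSmoother ρ R d) := isTest_conjSmoother ρ hR hdL
  have hψe : ∀ x, ψ x = conjSmoother ρ R d x + (S x + S x) := by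
    intro x
    rw [hS, ← conjSmoother_add ρ hR hwτ hwτ, ← conjSmoother_add ρ hR hdL h2L, hψ]
    congr 1
    ext y
    simp only [hd]; ring
  have hST2 : IsTest fun x => S x + S x := ⟨hST.contDiff.add hST.contDiff,
    hST.hasCompactSupport.add hST.hasCompactSupport⟩
  have hDe : ∀ x, absD ψ x = absD (conjSmoother ρ R d) x + 2 * absD S x := by
    intro x
    have h1 := absD_add hdT.toSchwartz hST2.toSchwartz x
    have h2 := absD_add hST.toSchwartz hST.toSchwartz x
    simp only [IsTest.coe_toSchwartz] at h1 h2
    have e : ψ = fun y => conjSmoother ρ R d y + (S y + S y) := funext hψe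
    rw [e, h1, h2]; ring
  have a1 : ∫ x, w τ x * absD ψ x =
      (∫ x, w τ x * absD (conjSmoother ρ R d) x) + 2 * ∫ x, w τ x * absD S x := by
    have i1 : Integrable fun x => w τ x * absD (conjSmoother ρ R d) x :=
      hwτ.integrable_mul (hdT.memLp_absD hn)
    have i2 : Integrable fun x => w τ x * absD S x := hwτ.integrable_mul (hST.memLp_absD hn)
    rw [← integral_const_mul, ← integral_add i1 (i2.const_mul 2)]
    congr 1; ext x; rw [hDe]; ring
  have a2 := (Complex.abs_im_le_norm _).trans (hC (w τ) _ hwτ (memLp_conj hdL))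
  rw [nrm_conj] at a2
  have a3 := abs_im_integral_mul_absD_smoother_le hn hR hρ hwτ
  have hzero : ∀ v : Space n → ℂ, ∀ x, 2 * R + 1 < ‖x‖ → conjSmoother ρ R v x / (h x : ℂ) = 0 :=
    fun v x hx => by rw [conjSmoother, smoother_eq_zero hR hρ _ hx, zero_div]
  have hcd : ∀ v : Space n → ℂ, MemLp v 2 volume →
      Continuous fun x => conjSmoother ρ R v x / (h x : ℂ) := fun v hv =>
    (isTest_conjSmoother ρ hR hv).contDiff.continuous.div (by fun_prop)
      fun x => by exact_mod_cast hne x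
  have hbd : ∀ v : Space n → ℂ, MemLp v 2 volume →
      ∀ x, ‖conjSmoother ρ R v x / (h x : ℂ)‖ ≤ C' * nrm v * m := fun v hv =>
    norm_div_le hm fun x => by have := hC' _ (memLp_conj hv) x; rwa [nrm_conj] at this
  have a4 : ∫ x, nonlin p ((h x : ℂ) * w τ x) * (ψ x / h x) =
      (∫ x, nonlin p ((h x : ℂ) * w τ x) * (conjSmoother ρ R d x / h x)) +
        2 * ∫ x, nonlin p ((h x : ℂ) * w τ x) * (S x / h x) := by
    have i1 := integrable_nonlin_mul hτ (hcd d hdL).aestronglyMeasurable (hbd d hdL) (hzero d)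
    have i2 := integrable_nonlin_mul hτ (hcd _ hwτ).aestronglyMeasurable (hbd _ hwτ) (hzero _)
    rw [← integral_const_mul, ← integral_add i1 (i2.const_mul 2)]
    congr 1; ext x; rw [hψe]; ring
  have a5 := (Complex.abs_re_le_norm _).trans (norm_integral_nonlin_mul_le hτ (hbd d hdL) (hzero d))
  have a6 : nrm ψ ≤ nrm d + 2 * nrm (w τ) := by
    have h1 : nrm ψ ≤ nrm fun x => (starRingEnd ℂ) (w t x + w s x) := nrm_smoother_le ρ R (memLp_conj hsL)
    rw [nrm_conj] at h1
    have h2 := nrm_add_le hdL h2L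
    have h3 := nrm_add_le hwτ hwτ
    have e : (fun x => d x + (w τ x + w τ x)) = fun x => w t x + w s x := by
      ext x; simp only [hd]; ring
    rw [e] at h2
    linarith
  have w0 := nrm_nonneg (w τ)
  have θ0 := nonlinMass_nonneg (p := p) (h := h) (w := w) (2 * R + 1) τ
  have η0 : 0 ≤ η := (nrm_nonneg _).trans ht
  have b1 := (abs_le.1 a2).1
  have b2 := (abs_le.1 a3).1
  have b3 := (abs_le.1 a5).1
  have c1 : C * nrm (w τ) * nrm d ≤ C * nrm (w τ) * (2 * η) := by gcongr
  have c2 : C' * nrm d * m * nonlinMass p h w (2 * R + 1) τ ≤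
    C' * (2 * η) * m * nonlinMass p h w (2 * R + 1) τ := by gcongr
  have c3 : A * nrm (w τ) * nrm ψ ≤ A * nrm (w τ) * (2 * η + 2 * nrm (w τ)) := by
    gcongr; linarith
  have c4 : 0 ≤ η * ((2 * C' * m) * nrm (w τ)) := by positivity
  have c5 : 0 ≤ η * ((2 * C + 2 * A) * nonlinMass p h w (2 * R + 1) τ) := by positivity
  simp only [weakRate, regRate, nonlinRate]
  rw [a1, a4]
  simp only [Complex.add_im, Complex.add_re, Complex.mul_im, Complex.mul_re, Complex.re_ofNat,
    Complex.im_ofNat, zero_mul, add_zero, sub_zero]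
  change _ ≤ (∫ x, w τ x * absD S x).im at b2
  change _ ≤ (∫ x, w τ x * absD (conjSmoother ρ R d) x).im at b1
  nlinarith

/-- Growth of the regularized energy. -/
lemma integral_regRate_le (lw : LocalSolution p h b w) (hn : 1 ≤ n) (hp : 1 < p)
    {K : ℝ≥0} (hK : LipschitzWith K h) (hA : commNorm h ≠ ⊤) (hne : ∀ x, h x ≠ 0) {m : ℝ}
    (hm : ∀ x, |(h x)⁻¹| ≤ m) {ρ : ContDiffBump (0 : Space n)} {R : ℝ} (hR : 0 < R)
    (hρ : ρ.rOut ≤ 1) {s t : ℝ} (hs : 0 ≤ s) (hst : s ≤ t) (ht : t ≤ b) :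
    ∫ τ in s..t, regRate p h w ρ hR τ ≤ regEnergy ρ R (w t) - regEnergy ρ R (w s) := by
  obtain ⟨C, hC0, hC⟩ := lw.exists_regRate_le_weakRate hn hK.continuous hne hm hR hρ
  have hg : IntegrableOn (fun τ => C * (nrm (w τ) + nonlinMass p h w (2 * R + 1) τ)) (Set.Icc 0 b) :=
    ((lw.continuous_nrm.continuousOn.integrableOn_Icc).add
      (lw.integrableOn_nonlinMass hp hK.continuous _)).const_mul C
  have hk := lw.integrableOn_regRate hp hK.continuous hm hR hρ
  -- A second summation over partitions: the test function is updated on each piece. The error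
  -- density is not constant this time, since it contains the local mass of the nonlinearity, which
  -- is only integrable in time.
  refine integral_le_sub_of_partition (F := fun τ => regEnergy ρ R (w τ)) hst
    (hk.mono_set (Set.Icc_subset_Icc hs ht)) (hg.mono_set (Set.Icc_subset_Icc hs ht)) fun ε hε => ?_
  obtain ⟨δ, hδ, hd⟩ := lw.cont ε hε
  refine ⟨δ, hδ, fun s' t' h1 h2 h3 h4 => ?_⟩
  have hsub : Set.Icc s' t' ⊆ Set.Icc 0 b := Set.Icc_subset_Icc (hs.trans h1) (h3.trans ht)
  have hψ := isTest_conjSmoother ρ hR ((lw.memLp t').add (lw.memLp s'))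
  rw [regEnergy_sub ρ hR (lw.memLp t') (lw.memLp s')]
  refine le_trans ?_ (lw.integral_weakRate_le hn hp hK hA hne hm hψ (hs.trans h1) h2 (h3.trans ht))
  have hii : ∀ {f : ℝ → ℝ}, IntegrableOn f (Set.Icc 0 b) → IntervalIntegrable f volume s' t' :=
    fun hf => (intervalIntegrable_iff_integrableOn_Icc_of_le h2).2 (hf.mono_set hsub)
  rw [← intervalIntegral.integral_const_mul,
    ← intervalIntegral.integral_sub (hii hk) ((hii hg).const_mul ε)]
  refine intervalIntegral.integral_mono_ae_restrict h2 ((hii hk).sub ((hii hg).const_mul ε))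
    (hii (lw.integrableOn_weakRate hn hp hK.continuous hne hm hψ)) ?_
  filter_upwards [ae_restrict_of_ae_restrict_of_subset hsub
    (lw.ae_integrableOn_nonlin hp hK.continuous (2 * R + 1)), ae_restrict_mem measurableSet_Icc]
    with τ hτi hτm
  refine hC s' t' τ ε (hd _ _ ?_).le (hd _ _ ?_).le hτi
  · rw [abs_of_nonneg (by linarith [hτm.2])]; linarith [hτm.1]
  · rw [abs_of_nonpos (by linarith [hτm.1])]; linarith [hτm.2]

end LocalSolution

/-! ### Removal of the mollification -/

/-- Hölder's inequality for a geometric mean. -/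
lemma integral_rpow_mul_rpow_le {X Y : Space n → ℝ} (hX : Integrable X) (hY : Integrable Y)
    (hX0 : ∀ x, 0 ≤ X x) (hY0 : ∀ x, 0 ≤ Y x) {a : ℝ} (ha : 0 < a) (ha1 : a < 1) :
    ∫ x, X x ^ a * Y x ^ (1 - a) ≤ (∫ x, X x) ^ a * (∫ x, Y x) ^ (1 - a) := by
  have hL : ∀ {Z : Space n → ℝ} {c : ℝ}, Integrable Z → (∀ x, 0 ≤ Z x) → 0 < c →
      MemLp (fun x => Z x ^ c) (ENNReal.ofReal c⁻¹) volume := by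
    intro Z c hZ hZ0 hc
    have hm : AEStronglyMeasurable (fun x => Z x ^ c) volume :=
      (hZ.1.aemeasurable.pow_const c).aestronglyMeasurable
    rw [← integrable_norm_rpow_iff hm (by simpa using hc) ENNReal.ofReal_ne_top,
      ENNReal.toReal_ofReal (inv_nonneg.2 hc.le)]
    refine hZ.congr (ae_of_all _ fun x => ?_)
    simp only
    rw [Real.norm_of_nonneg (by have := hZ0 x; positivity), Real.rpow_rpow_inv (hZ0 x) hc.ne']
  have hpq : (a⁻¹).HolderConjugate (1 - a)⁻¹ :=
    Real.holderConjugate_iff.2 ⟨one_lt_inv_iff₀.2 ⟨ha, ha1⟩, by simp⟩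
  have h1 := integral_mul_le_Lp_mul_Lq_of_nonneg (μ := (volume : Measure (Space n))) hpq
    (ae_of_all _ fun x => Real.rpow_nonneg (hX0 x) a)
    (ae_of_all _ fun x => Real.rpow_nonneg (hY0 x) (1 - a)) (hL hX hX0 ha) (hL hY hY0 (by linarith))
  refine h1.trans_eq ?_
  have e1 : ∀ x, (X x ^ a) ^ a⁻¹ = X x := fun x => Real.rpow_rpow_inv (hX0 x) ha.ne'
  have e2 : ∀ x, (Y x ^ (1 - a)) ^ (1 - a)⁻¹ = Y x :=
    fun x => Real.rpow_rpow_inv (hY0 x) (by linarith)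
  simp_rw [e1, e2, one_div, inv_inv]

lemma toReal_eLpNorm_ofReal {v : Space n → ℂ} {q : ℝ} (hq : 0 < q)
    (hv : MemLp v (ENNReal.ofReal q) volume) :
    (eLpNorm v (ENNReal.ofReal q) volume).toReal = (∫ x, ‖v x‖ ^ q) ^ q⁻¹ := by
  rw [hv.eLpNorm_eq_integral_rpow_norm (by simpa using hq) ENNReal.ofReal_ne_top,
    ENNReal.toReal_ofReal hq.le, ENNReal.toReal_ofReal]
  exact Real.rpow_nonneg (integral_nonneg fun x => by positivity) _

lemma integrable_norm_rpow_of_memLp {v : Space n → ℂ} {q : ℝ} (hq : 0 < q)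
    (hv : MemLp v (ENNReal.ofReal q) volume) : Integrable fun x => ‖v x‖ ^ q := by
  have := (integrable_norm_rpow_iff hv.1 (by simpa using hq) ENNReal.ofReal_ne_top).2 hv
  rwa [ENNReal.toReal_ofReal hq.le] at this

lemma norm_integral_nonlin_mul_le_eLpNorm {p : ℝ} (hp : 1 < p) {u v : Space n → ℂ}
    (hu : MemLp u (ENNReal.ofReal (p + 1)) volume) (hv : MemLp v (ENNReal.ofReal (p + 1)) volume) :
    ‖∫ x, nonlin p (u x) * v x‖ ≤ (eLpNorm u (ENNReal.ofReal (p + 1)) volume).toReal ^ p *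
      (eLpNorm v (ENNReal.ofReal (p + 1)) volume).toReal := by
  have hp0 : 0 < p + 1 := by linarith
  rw [toReal_eLpNorm_ofReal hp0 hu, toReal_eLpNorm_ofReal hp0 hv]
  have h1 := integral_rpow_mul_rpow_le (integrable_norm_rpow_of_memLp hp0 hu)
    (integrable_norm_rpow_of_memLp hp0 hv) (fun x => by positivity) (fun x => by positivity)
    -- Hölder's inequality with the conjugate exponents `(p+1)/p` and `p+1`.
    (a := p / (p + 1)) (by positivity) (by rw [div_lt_one hp0]; linarith)
  have ha : 1 - p / (p + 1) = (p + 1)⁻¹ := by field_simp; ring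
  rw [ha] at h1
  refine (norm_integral_le_integral_norm _).trans ?_
  refine le_of_eq_of_le ?_ (h1.trans_eq ?_)
  · congr 1
    ext x
    rw [norm_mul, norm_nonlin hp, ← Real.rpow_mul (norm_nonneg _), ← Real.rpow_mul (norm_nonneg _),
      mul_div_cancel₀ _ hp0.ne', mul_inv_cancel₀ hp0.ne', Real.rpow_one]
  · congr 1
    rw [← Real.rpow_mul (integral_nonneg fun x => by positivity)]
    congr 1
    field_simp

/-- The energy with a cutoff. -/
def cutEnergy (R : ℝ) (v : Space n → ℂ) : ℝ := ∫ x, cutoff R x * ‖v x‖ ^ 2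

lemma integrable_norm_sq {v : Space n → ℂ} (hv : MemLp v 2 volume) : Integrable fun x => ‖v x‖ ^ 2 :=
  hv.integrable_norm_pow (by norm_num)

lemma cutEnergy_nonneg (R : ℝ) (v : Space n → ℂ) : 0 ≤ cutEnergy R v :=
  integral_nonneg fun x => mul_nonneg (cutoff_nonneg R x) (by positivity)

lemma integrable_cutoff_mul_norm_sq (R : ℝ) {v : Space n → ℂ} (hv : MemLp v 2 volume) :
    Integrable fun x => cutoff R x * ‖v x‖ ^ 2 := by
  refine (integrable_norm_sq hv).mono ((continuous_cutoff R).aestronglyMeasurable.mul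
    (integrable_norm_sq hv).1) (ae_of_all _ fun x => ?_)
  rw [norm_mul, Real.norm_of_nonneg (cutoff_nonneg R x)]
  exact mul_le_of_le_one_left (norm_nonneg _) (cutoff_le_one R x)

lemma cutEnergy_le (R : ℝ) {v : Space n → ℂ} (hv : MemLp v 2 volume) : cutEnergy R v ≤ nrm v ^ 2 := by
  rw [nrm_sq hv]
  exact integral_mono (integrable_cutoff_mul_norm_sq R hv) (integrable_norm_sq hv) fun x =>
    mul_le_of_le_one_left (by positivity) (cutoff_le_one R x)

lemma tendsto_cutEnergy {v : Space n → ℂ} (hv : MemLp v 2 volume) :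
    Tendsto (fun R => cutEnergy R v) atTop (𝓝 (nrm v ^ 2)) := by
  rw [nrm_sq hv]
  refine tendsto_integral_filter_of_dominated_convergence (fun x => ‖v x‖ ^ 2)
    (Eventually.of_forall fun R => (integrable_cutoff_mul_norm_sq R hv).1)
    (Eventually.of_forall fun R => ae_of_all _ fun x => ?_) (integrable_norm_sq hv)
    (ae_of_all _ fun x => ?_)
  · rw [norm_mul, Real.norm_of_nonneg (cutoff_nonneg R x), Real.norm_of_nonneg (by positivity)]
    exact mul_le_of_le_one_left (by positivity) (cutoff_le_one R x)
  · simpa using (tendsto_cutoff x).mul_const (‖v x‖ ^ 2)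

lemma tendsto_regEnergy {ρ : ℕ → ContDiffBump (0 : Space n)}
    (hρ : Tendsto (fun m => (ρ m).rOut) atTop (𝓝 0)) {R : ℝ} (hR : 0 < R) {v : Space n → ℂ}
    (hv : MemLp v 2 volume) : Tendsto (fun m => regEnergy (ρ m) R v) atTop (𝓝 (cutEnergy R v)) := by
  have hc := memLp_conj hv
  have h1 := (ENNReal.tendsto_toReal ENNReal.zero_ne_top).comp
    (tendsto_eLpNorm_smoother_sub hρ R hc (by norm_num) (by norm_num))
  rw [ENNReal.toReal_zero] at h1
  have h2 := tendsto_integral_mul (memLp_cutoff_mul R hc)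
    (fun m => (isTest_conjSmoother (ρ m) hR hv).memLp 2) hv h1
  have e : ∫ x, (cutoff R x : ℂ) * (starRingEnd ℂ) (v x) * v x = (cutEnergy R v : ℂ) := by
    rw [cutEnergy, ← integral_complex_ofReal]
    congr 1
    ext x
    rw [mul_assoc, mul_comm ((starRingEnd ℂ) (v x)), Complex.mul_conj, Complex.normSq_eq_norm_sq]
    push_cast; rfl
  rw [e] at h2
  have h3 := (Complex.continuous_re.tendsto _).comp h2
  simp only [Complex.ofReal_re] at h3
  refine h3.congr fun m => ?_
  simp only [Function.comp, regEnergy]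
  simp_rw [mul_comm]

namespace LocalSolution

variable {p : ℝ} {h : Space n → ℝ} {b : ℝ} {w : ℝ → Space n → ℂ}

lemma integrable_prod_rpow (lw : LocalSolution p h b w) (hp : 1 < p) (hh : Continuous h) (R : ℝ) :
    Integrable (fun q : ℝ × Space n => ‖(h q.2 : ℂ) * w q.1 q.2‖ ^ (p + 1))
      ((volume.restrict (Set.Icc 0 b)).prod (volume.restrict (Metric.closedBall 0 R))) := by
  have hm : Measurable fun q : ℝ × Space n => w q.1 q.2 := lw.meas.measurable
  have hm2 : Measurable fun q : ℝ × Space n => ‖(h q.2 : ℂ) * w q.1 q.2‖ₑ ^ (p + 1) := by fun_prop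
  have hm3 : Measurable fun q : ℝ × Space n => ‖(h q.2 : ℂ) * w q.1 q.2‖ ^ (p + 1) := by fun_prop
  refine ⟨hm3.aestronglyMeasurable, ?_⟩
  unfold HasFiniteIntegral
  have e : ∀ z : ℂ, ‖‖z‖ ^ (p + 1)‖ₑ = ‖z‖ₑ ^ (p + 1) := fun z => by
    rw [← ofReal_norm, Real.norm_of_nonneg (by positivity), ← ofReal_norm,
      ENNReal.ofReal_rpow_of_nonneg (norm_nonneg _) (by linarith)]
  simp_rw [e]
  rw [lintegral_prod _ hm2.aemeasurable]
  exact lw.integ R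

/-- The local `L^(p+1)` mass of the solution. -/
def powerMass (p : ℝ) (h : Space n → ℝ) (w : ℝ → Space n → ℂ) (R τ : ℝ) : ℝ :=
  ∫ x in Metric.closedBall 0 R, ‖(h x : ℂ) * w τ x‖ ^ (p + 1)

lemma integrableOn_powerMass (lw : LocalSolution p h b w) (hp : 1 < p) (hh : Continuous h) (R : ℝ) :
    IntegrableOn (powerMass p h w R) (Set.Icc 0 b) :=
  (lw.integrable_prod_rpow hp hh R).integral_prod_left

/-- The solution restricted to a ball. -/
def restr (h : Space n → ℝ) (w : ℝ → Space n → ℂ) (R τ : ℝ) : Space n → ℂ :=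
  (Metric.closedBall 0 R).indicator fun x => (h x : ℂ) * w τ x

lemma ae_memLp_restr (lw : LocalSolution p h b w) (hp : 1 < p) (hh : Continuous h) (R : ℝ) :
    ∀ᵐ τ ∂(volume.restrict (Set.Icc 0 b)), MemLp (restr h w R τ) (ENNReal.ofReal (p + 1)) volume := by
  have hp0 : 0 < p + 1 := by linarith
  filter_upwards [(lw.integrable_prod_rpow hp hh R).prod_right_ae] with τ hτ
  have hm : AEStronglyMeasurable (fun x => (h x : ℂ) * w τ x)
      (volume.restrict (Metric.closedBall 0 R)) :=
    ((by fun_prop : Continuous fun x => (h x : ℂ)).aestronglyMeasurable.mul (lw.memLp τ).1).restrict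
  refine (memLp_indicator_iff_restrict Metric.isClosed_closedBall.measurableSet).2 ?_
  rw [← integrable_norm_rpow_iff hm (by simpa using hp0) ENNReal.ofReal_ne_top,
    ENNReal.toReal_ofReal hp0.le]
  exact hτ

lemma rpow_eLpNorm_restr (hp : 1 < p) {R τ : ℝ}
    (hτ : MemLp (restr h w R τ) (ENNReal.ofReal (p + 1)) volume) :
    (eLpNorm (restr h w R τ) (ENNReal.ofReal (p + 1)) volume).toReal ^ (p + 1) =
      powerMass p h w R τ := by
  have hp0 : 0 < p + 1 := by linarith
  rw [toReal_eLpNorm_ofReal hp0 hτ, Real.rpow_inv_rpow (integral_nonneg fun x => by positivity) hp0.ne',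
    powerMass, ← integral_indicator Metric.isClosed_closedBall.measurableSet]
  congr 1
  ext x
  by_cases hx : x ∈ Metric.closedBall (0 : Space n) R
  · simp only [restr, Set.indicator_of_mem hx]
  · simp only [restr, Set.indicator_of_notMem hx, norm_zero]
    rw [Real.zero_rpow hp0.ne']

/-- The limit of `nonlinRate` as the mollification is removed. -/
def cutRate (p : ℝ) (h : Space n → ℝ) (w : ℝ → Space n → ℂ) (R τ : ℝ) : ℝ :=
  (∫ x, nonlin p ((h x : ℂ) * w τ x) * ((cutoff R x : ℂ) * (starRingEnd ℂ) (w τ x) / h x)).re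

lemma integral_nonlin_mul_eq_restr {R τ : ℝ} {ψ : Space n → ℂ} (hR : ∀ x, R < ‖x‖ → ψ x = 0) :
    ∫ x, nonlin p ((h x : ℂ) * w τ x) * ψ x = ∫ x, nonlin p (restr h w R τ x) * ψ x := by
  congr 1
  ext x
  by_cases hx : x ∈ Metric.closedBall (0 : Space n) R
  · simp only [restr, Set.indicator_of_mem hx]
  · rw [hR x (by simpa using hx), mul_zero, mul_zero]

/-- The complex conjugate of the weighted solution restricted to a ball. -/
def restrConj (w : ℝ → Space n → ℂ) (R τ : ℝ) : Space n → ℂ :=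
  (Metric.closedBall 0 R).indicator fun x => (starRingEnd ℂ) (w τ x)

/-- Boundedness of `1/h` gives `|w| ≤ m |h w|`, which transfers the local `L^(p+1)` integrability of
`u` to `w`. -/
lemma norm_restrConj_le (hne : ∀ x, h x ≠ 0) {m : ℝ} (hm : ∀ x, |(h x)⁻¹| ≤ m) (R τ : ℝ)
    (x : Space n) : ‖restrConj w R τ x‖ ≤ m * ‖restr h w R τ x‖ := by
  by_cases hx : x ∈ Metric.closedBall (0 : Space n) R
  · simp only [restr, restrConj, Set.indicator_of_mem hx]
    rw [RCLike.norm_conj, norm_mul, Complex.norm_real, ← mul_assoc, Real.norm_eq_abs]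
    have h1 : 1 ≤ m * |h x| := by
      have h2 := mul_le_mul_of_nonneg_right (hm x) (abs_nonneg (h x))
      rwa [← abs_mul, inv_mul_cancel₀ (hne x), abs_one] at h2
    exact le_mul_of_one_le_left (norm_nonneg _) h1
  · simp only [restr, restrConj, Set.indicator_of_notMem hx, norm_zero, mul_zero, le_refl]

lemma memLp_restrConj (lw : LocalSolution p h b w) (hne : ∀ x, h x ≠ 0) {m : ℝ}
    (hm : ∀ x, |(h x)⁻¹| ≤ m) {R τ : ℝ} {q : ℝ≥0∞} (hτ : MemLp (restr h w R τ) q volume) :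
    MemLp (restrConj w R τ) q volume :=
  hτ.of_le_mul (((memLp_conj (lw.memLp τ)).1).indicator Metric.isClosed_closedBall.measurableSet)
    (ae_of_all _ (norm_restrConj_le hne hm R τ))

lemma toReal_eLpNorm_div_le {m : ℝ} (hm : ∀ x, |(h x)⁻¹| ≤ m) {v : Space n → ℂ} {q : ℝ≥0∞}
    (hv : MemLp v q volume) :
    (eLpNorm (fun x => v x / (h x : ℂ)) q volume).toReal ≤ m * (eLpNorm v q volume).toReal := by
  have hm0 : 0 ≤ m := (abs_nonneg _).trans (hm 0)
  have h1 : eLpNorm (fun x => v x / (h x : ℂ)) q volume ≤ ENNReal.ofReal m * eLpNorm v q volume := by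
    refine eLpNorm_le_mul_eLpNorm_of_ae_le_mul (ae_of_all _ fun x => ?_) q
    rw [div_eq_mul_inv, norm_mul, ← Complex.ofReal_inv, Complex.norm_real, Real.norm_eq_abs, mul_comm]
    exact mul_le_mul_of_nonneg_right (hm x) (norm_nonneg _)
  have h2 := ENNReal.toReal_mono (ENNReal.mul_ne_top ENNReal.ofReal_ne_top hv.eLpNorm_ne_top) h1
  rwa [ENNReal.toReal_mul, ENNReal.toReal_ofReal hm0] at h2

lemma memLp_div {m : ℝ} (hh : Continuous h) (hne : ∀ x, h x ≠ 0) (hm : ∀ x, |(h x)⁻¹| ≤ m)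
    {v : Space n → ℂ} {q : ℝ≥0∞} (hv : MemLp v q volume) :
    MemLp (fun x => v x / (h x : ℂ)) q volume := by
  have hc : Continuous fun x => ((h x : ℂ))⁻¹ :=
    (by fun_prop : Continuous fun x => (h x : ℂ)).inv₀ fun x => by exact_mod_cast hne x
  have h1 : AEStronglyMeasurable (fun x => v x / (h x : ℂ)) volume := by
    simp_rw [div_eq_mul_inv]
    exact hv.1.mul hc.aestronglyMeasurable
  refine hv.of_le_mul (c := m) h1 (ae_of_all _ fun x => ?_)
  rw [div_eq_mul_inv, norm_mul, ← Complex.ofReal_inv, Complex.norm_real, Real.norm_eq_abs, mul_comm]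
  exact mul_le_mul_of_nonneg_right (hm x) (norm_nonneg _)

lemma conjSmoother_eq_smoother_restrConj {ρ : ContDiffBump (0 : Space n)} {R : ℝ} (hR : 0 < R)
    (hρ : ρ.rOut ≤ 1) (τ : ℝ) :
    conjSmoother ρ R (w τ) = smoother ρ R (restrConj w (2 * R + 1) τ) :=
  smoother_eq_smoother_indicator hR hρ _

/-- A bound independent of `ρ`, because the smoothing operator contracts `L^(p+1)`. It provides the
dominating function in time when the mollification is removed; the two factors `m` come from
dividing by `h` and from passing from `u` to `w`. -/
lemma abs_nonlinRate_le (lw : LocalSolution p h b w) (hp : 1 < p) (hh : Continuous h)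
    (hne : ∀ x, h x ≠ 0) {m : ℝ} (hm : ∀ x, |(h x)⁻¹| ≤ m) {ρ : ContDiffBump (0 : Space n)} {R : ℝ}
    (hR : 0 < R) (hρ : ρ.rOut ≤ 1) {τ : ℝ}
    (hτ : MemLp (restr h w (2 * R + 1) τ) (ENNReal.ofReal (p + 1)) volume) :
    |nonlinRate p h w ρ R τ| ≤ m ^ 2 * powerMass p h w (2 * R + 1) τ := by
  have hm0 : 0 ≤ m := (abs_nonneg _).trans (hm 0)
  have hq1 : 1 ≤ ENNReal.ofReal (p + 1) := by
    rw [ENNReal.one_le_ofReal]; linarith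
  have hrc := lw.memLp_restrConj hne hm hτ
  have hS : MemLp (conjSmoother ρ R (w τ)) (ENNReal.ofReal (p + 1)) volume :=
    (isTest_conjSmoother ρ hR (lw.memLp τ)).memLp _
  have hzero : ∀ x, 2 * R + 1 < ‖x‖ → conjSmoother ρ R (w τ) x / (h x : ℂ) = 0 :=
    fun x hx => by rw [conjSmoother, smoother_eq_zero hR hρ _ hx, zero_div]
  refine (Complex.abs_re_le_norm _).trans ?_
  rw [integral_nonlin_mul_eq_restr hzero]
  refine (norm_integral_nonlin_mul_le_eLpNorm hp hτ (memLp_div hh hne hm hS)).trans ?_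
  rw [← rpow_eLpNorm_restr hp hτ]
  set N := (eLpNorm (restr h w (2 * R + 1) τ) (ENNReal.ofReal (p + 1)) volume).toReal with hN
  have hN0 : 0 ≤ N := ENNReal.toReal_nonneg
  have h1 : (eLpNorm (conjSmoother ρ R (w τ)) (ENNReal.ofReal (p + 1)) volume).toReal ≤ m * N := by
    rw [conjSmoother_eq_smoother_restrConj hR hρ]
    have h2 := eLpNorm_smoother_le ρ R hrc hq1 ENNReal.ofReal_ne_top
    have h3 : eLpNorm (restrConj w (2 * R + 1) τ) (ENNReal.ofReal (p + 1)) volume ≤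
        ENNReal.ofReal m * eLpNorm (restr h w (2 * R + 1) τ) (ENNReal.ofReal (p + 1)) volume :=
      eLpNorm_le_mul_eLpNorm_of_ae_le_mul (ae_of_all _ (norm_restrConj_le hne hm _ τ)) _
    have h4 := ENNReal.toReal_mono (ENNReal.mul_ne_top ENNReal.ofReal_ne_top hτ.eLpNorm_ne_top)
      (h2.trans h3)
    rwa [ENNReal.toReal_mul, ENNReal.toReal_ofReal hm0] at h4
  have h5 := toReal_eLpNorm_div_le hm hS
  rcases hN0.eq_or_lt with h0 | hpos
  · rw [← h0, Real.zero_rpow (by linarith), Real.zero_rpow (by linarith)]; simp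
  rw [Real.rpow_add_one hpos.ne']
  calc N ^ p * _ ≤ N ^ p * (m * (m * N)) := by gcongr; exact h5.trans (by gcongr)
    _ = _ := by ring

/-- At almost every time the smoothed conjugate converges in `L^(p+1)`, which is exactly dual to the
integrability of the nonlinearity. This is where the assumption of local `L^(p+1)` integrability is
decisive. -/
lemma tendsto_nonlinRate (lw : LocalSolution p h b w) (hp : 1 < p) (hh : Continuous h)
    (hne : ∀ x, h x ≠ 0) {m : ℝ} (hm : ∀ x, |(h x)⁻¹| ≤ m) {ρ : ℕ → ContDiffBump (0 : Space n)}
    (hρ : Tendsto (fun m => (ρ m).rOut) atTop (𝓝 0)) (hρ1 : ∀ m, (ρ m).rOut ≤ 1) {R : ℝ}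
    (hR : 0 < R) {τ : ℝ} (hτ : MemLp (restr h w (2 * R + 1) τ) (ENNReal.ofReal (p + 1)) volume) :
    Tendsto (fun k => nonlinRate p h w (ρ k) R τ) atTop (𝓝 (cutRate p h w R τ)) := by
  have hq1 : 1 ≤ ENNReal.ofReal (p + 1) := by
    rw [ENNReal.one_le_ofReal]; linarith
  have hrc := lw.memLp_restrConj hne hm hτ
  have hχ := memLp_cutoff_mul R hrc
  have hS : ∀ k, MemLp (smoother (ρ k) R (restrConj w (2 * R + 1) τ)) (ENNReal.ofReal (p + 1)) volume :=
    fun k => by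
      rw [← conjSmoother_eq_smoother_restrConj hR (hρ1 k)]
      exact (isTest_conjSmoother (ρ k) hR (lw.memLp τ)).memLp _
  have hnl : ∀ {v : Space n → ℂ}, MemLp v (ENNReal.ofReal (p + 1)) volume →
      Integrable fun x => nonlin p (restr h w (2 * R + 1) τ x) * (v x / h x) := by
    intro v hv
    have hv' := memLp_div hh hne hm hv
    have hp0 : 0 < p + 1 := by linarith
    have hi := (integrable_norm_rpow_of_memLp hp0 hτ).add (integrable_norm_rpow_of_memLp hp0 hv')
    refine hi.mono' (((measurable_nonlin p).comp_aemeasurable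
      hτ.1.aemeasurable).aestronglyMeasurable.mul hv'.1) (ae_of_all _ fun x => ?_)
    rw [norm_mul, norm_nonlin hp]
    simp only [Pi.add_apply]
    have a0 := norm_nonneg (restr h w (2 * R + 1) τ x)
    have b0 := norm_nonneg (v x / (h x : ℂ))
    generalize ‖restr h w (2 * R + 1) τ x‖ = a at *
    generalize ‖v x / (h x : ℂ)‖ = c at *
    have key : ∀ y : ℝ, 0 ≤ y → y ^ p * y = y ^ (p + 1) := fun y hy => by
      rw [Real.rpow_add_one' hy hp0.ne']
    rcases le_total a c with hac | hac
    · calc a ^ p * c ≤ c ^ p * c := by gcongr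
        _ = c ^ (p + 1) := key c b0
        _ ≤ _ := le_add_of_nonneg_left (by positivity)
    · calc a ^ p * c ≤ a ^ p * a := by gcongr
        _ = a ^ (p + 1) := key a a0
        _ ≤ _ := le_add_of_nonneg_right (by positivity)
  have e1 : ∀ k, nonlinRate p h w (ρ k) R τ = (∫ x, nonlin p (restr h w (2 * R + 1) τ x) *
      (smoother (ρ k) R (restrConj w (2 * R + 1) τ) x / h x)).re := by
    intro k
    unfold nonlinRate
    rw [integral_nonlin_mul_eq_restr (R := 2 * R + 1)
      fun x hx => by rw [conjSmoother, smoother_eq_zero hR (hρ1 k) _ hx, zero_div],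
      conjSmoother_eq_smoother_restrConj hR (hρ1 k)]
  have e2 : cutRate p h w R τ = (∫ x, nonlin p (restr h w (2 * R + 1) τ x) *
      ((cutoff R x : ℂ) * restrConj w (2 * R + 1) τ x / h x)).re := by
    unfold cutRate
    rw [integral_nonlin_mul_eq_restr (R := 2 * R + 1)
      fun x hx => by rw [cutoff_eq_zero hR (by linarith)]; simp]
    congr 3
    ext x
    by_cases hx : x ∈ Metric.closedBall (0 : Space n) (2 * R + 1)
    · simp only [restrConj, Set.indicator_of_mem hx]
    · rw [cutoff_eq_zero hR (by have : 2 * R + 1 < ‖x‖ := by simpa using hx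
                                linarith)]
      simp
  rw [tendsto_iff_norm_sub_tendsto_zero]
  have h1 := (ENNReal.tendsto_toReal ENNReal.zero_ne_top).comp
    (tendsto_eLpNorm_smoother_sub hρ R hrc hq1 ENNReal.ofReal_ne_top)
  rw [ENNReal.toReal_zero] at h1
  have h2 := (h1.const_mul m).const_mul
    ((eLpNorm (restr h w (2 * R + 1) τ) (ENNReal.ofReal (p + 1)) volume).toReal ^ p)
  rw [mul_zero, mul_zero] at h2
  refine squeeze_zero (fun k => norm_nonneg _) (fun k => ?_) h2
  rw [e1, e2, ← Complex.sub_re, ← integral_sub (hnl (hS k)) (hnl hχ)]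
  simp_rw [← mul_sub, ← sub_div]
  have hd : MemLp (fun x => smoother (ρ k) R (restrConj w (2 * R + 1) τ) x -
    (cutoff R x : ℂ) * restrConj w (2 * R + 1) τ x) (ENNReal.ofReal (p + 1)) volume := (hS k).sub hχ
  refine (Complex.abs_re_le_norm _).trans
    ((norm_integral_nonlin_mul_le_eLpNorm hp hτ (memLp_div hh hne hm hd)).trans ?_)
  gcongr
  exact toReal_eLpNorm_div_le hm hd

end LocalSolution

/-! ### The energy inequality -/

lemma measurable_cutEnergy (R : ℝ) {w : ℝ → Space n → ℂ}
    (hw : StronglyMeasurable (Function.uncurry w)) :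
    StronglyMeasurable fun τ => cutEnergy R (w τ) := by
  unfold cutEnergy
  have h1 : Measurable fun q : ℝ × Space n => w q.1 q.2 := hw.measurable
  have h2 : Measurable fun q : ℝ × Space n => cutoff R q.2 :=
    (by fun_prop : Continuous fun q : ℝ × Space n => cutoff R q.2).measurable
  exact (h2.mul (h1.norm.pow_const 2)).stronglyMeasurable.integral_prod_right

lemma integral_cutoff_mul_inv_sq_le {h : Space n → ℝ} (htwo : MemLp (fun x => (h x)⁻¹) 2 volume)
    (R : ℝ) : (Integrable fun x => cutoff R x * (h x)⁻¹ ^ 2) ∧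
      ∫ x, cutoff R x * (h x)⁻¹ ^ 2 ≤ (eLpNorm (fun x => (h x)⁻¹) 2 volume).toReal ^ 2 := by
  have hi : Integrable fun x => (h x)⁻¹ ^ 2 := htwo.integrable_sq
  have hci : Integrable fun x => cutoff R x * (h x)⁻¹ ^ 2 := by
    refine hi.mono ((continuous_cutoff R).aestronglyMeasurable.mul hi.1) (ae_of_all _ fun x => ?_)
    rw [norm_mul, Real.norm_of_nonneg (cutoff_nonneg R x)]
    exact mul_le_of_le_one_left (norm_nonneg _) (cutoff_le_one R x)
  refine ⟨hci, ?_⟩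
  have e : (eLpNorm (fun x => (h x)⁻¹) 2 volume).toReal ^ 2 = ∫ x, (h x)⁻¹ ^ 2 := by
    rw [htwo.eLpNorm_eq_integral_rpow_norm (by simp) (by simp)]
    have h0 : 0 ≤ ∫ x, ‖(h x)⁻¹‖ ^ 2 := integral_nonneg fun x => by positivity
    simp only [ENNReal.toReal_ofNat, Real.rpow_ofNat]
    rw [ENNReal.toReal_ofReal (by positivity), ← Real.rpow_natCast, ← Real.rpow_mul h0]
    norm_num
  rw [e]
  exact integral_mono hci hi fun x => mul_le_of_le_one_left (by positivity) (cutoff_le_one R x)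

namespace LocalSolution

variable {p : ℝ} {h : Space n → ℝ} {b : ℝ} {w : ℝ → Space n → ℂ}

/-- Because `hw · conj(w) / h = |hw|² / h²`, the limiting nonlinear term has a nonnegative density.
-/
lemma cutRate_eq (hp : 1 < p) (hne : ∀ x, h x ≠ 0) (R τ : ℝ) :
    cutRate p h w R τ = ∫ x, cutoff R x * ‖(h x : ℂ) * w τ x‖ ^ (p + 1) * (h x)⁻¹ ^ 2 := by
  unfold cutRate
  rw [← Complex.ofReal_re (∫ x, cutoff R x * ‖(h x : ℂ) * w τ x‖ ^ (p + 1) * (h x)⁻¹ ^ 2),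
    ← integral_complex_ofReal]
  congr 2
  ext x
  have hx : (h x : ℂ) ≠ 0 := by exact_mod_cast hne x
  have e1 : ‖(h x : ℂ) * w τ x‖ ^ (p + 1) =
      ‖(h x : ℂ) * w τ x‖ ^ (p - 1) * ‖(h x : ℂ) * w τ x‖ ^ 2 := by
    rw [← Real.rpow_add_natCast' (norm_nonneg _) (by push_cast; linarith)]
    congr 1; push_cast; ring
  have e2 : ((‖(h x : ℂ) * w τ x‖ ^ 2 : ℝ) : ℂ) = h x ^ 2 * (w τ x * (starRingEnd ℂ) (w τ x)) := by
    rw [norm_mul, mul_pow, Complex.norm_real, Real.norm_eq_abs, sq_abs, Complex.mul_conj,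
      Complex.normSq_eq_norm_sq]
    push_cast; rfl
  rw [e1, nonlin]
  rw [Complex.ofReal_mul, Complex.ofReal_mul, Complex.ofReal_mul, e2]
  push_cast
  field_simp

/-- Hölder's inequality with respect to the measure `χ h⁻² dx`, whose mass is at most `B²`, applied
to `|hw|²`. -/
lemma cutEnergy_rpow_le (lw : LocalSolution p h b w) (hp : 1 < p) (hh : Continuous h)
    (hne : ∀ x, h x ≠ 0) {m : ℝ} (hm : ∀ x, |(h x)⁻¹| ≤ m)
    (htwo : MemLp (fun x => (h x)⁻¹) 2 volume) {R : ℝ} (hR : 0 < R) {τ : ℝ}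
    (hτ : MemLp (restr h w (2 * R + 1) τ) (ENNReal.ofReal (p + 1)) volume) :
    cutEnergy R (w τ) ^ ((p + 1) / 2) ≤
      cutRate p h w R τ * (eLpNorm (fun x => (h x)⁻¹) 2 volume).toReal ^ (p - 1) := by
  have hp0 : 0 < p + 1 := by linarith
  set B := (eLpNorm (fun x => (h x)⁻¹) 2 volume).toReal with hB
  have hB0 : 0 ≤ B := ENNReal.toReal_nonneg
  set X : Space n → ℝ := fun x => cutoff R x * ‖(h x : ℂ) * w τ x‖ ^ (p + 1) * (h x)⁻¹ ^ 2 with hX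
  set Y : Space n → ℝ := fun x => cutoff R x * (h x)⁻¹ ^ 2 with hY
  obtain ⟨hYi, hYle⟩ : Integrable Y ∧ ∫ x, Y x ≤ B ^ 2 := integral_cutoff_mul_inv_sq_le htwo R
  have hX0 : ∀ x, 0 ≤ X x := fun x => by have := cutoff_nonneg R x; positivity
  have hY0 : ∀ x, 0 ≤ Y x := fun x => by have := cutoff_nonneg R x; positivity
  have hXi : Integrable X := by
    have h1 := (integrable_norm_rpow_of_memLp hp0 hτ).const_mul (m ^ 2)
    have hw : AEStronglyMeasurable (fun x => ‖(h x : ℂ) * w τ x‖ ^ (p + 1)) volume :=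
      ((by fun_prop : Continuous fun x => (h x : ℂ)).aestronglyMeasurable.mul
        (lw.memLp τ).1).norm.aemeasurable.pow_const _ |>.aestronglyMeasurable
    have hc : Continuous fun x => (h x)⁻¹ ^ 2 := (hh.inv₀ hne).pow 2
    refine h1.mono' (((continuous_cutoff R).aestronglyMeasurable.mul hw).mul
      hc.aestronglyMeasurable) (ae_of_all _ fun x => ?_)
    rw [Real.norm_of_nonneg (hX0 x)]
    by_cases hx : x ∈ Metric.closedBall (0 : Space n) (2 * R + 1)
    · simp only [restr, Set.indicator_of_mem hx, hX]
      have h2 : (h x)⁻¹ ^ 2 ≤ m ^ 2 := by rw [← sq_abs]; gcongr; exact hm x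
      have h3 := cutoff_le_one R x
      have h4 := cutoff_nonneg R x
      calc cutoff R x * ‖(h x : ℂ) * w τ x‖ ^ (p + 1) * (h x)⁻¹ ^ 2
          ≤ 1 * ‖(h x : ℂ) * w τ x‖ ^ (p + 1) * m ^ 2 := by gcongr
        _ = _ := by ring
    · simp only [hX]
      rw [cutoff_eq_zero hR (by have : 2 * R + 1 < ‖x‖ := by simpa using hx
                                linarith)]
      simp only [zero_mul]
      positivity
  have ha1 : 2 / (p + 1) < 1 := by rw [div_lt_one hp0]; linarith
  -- With this exponent the geometric mean of `X` and `Y` is exactly the density `χ|w|²` of the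
  -- cut-off energy.
  have h1 := integral_rpow_mul_rpow_le hXi hYi hX0 hY0 (a := 2 / (p + 1)) (by positivity) ha1
  have e1 : ∀ x, X x ^ (2 / (p + 1)) * Y x ^ (1 - 2 / (p + 1)) = cutoff R x * ‖w τ x‖ ^ 2 := by
    intro x
    have h4 := cutoff_nonneg R x
    have hXe : X x = ‖(h x : ℂ) * w τ x‖ ^ (p + 1) * Y x := by simp only [hX, hY]; ring
    rw [hXe, Real.mul_rpow (by positivity) (hY0 x), mul_assoc]
    rw [← Real.rpow_add' (hY0 x) (by norm_num), ← Real.rpow_mul (norm_nonneg _),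
      mul_div_cancel₀ _ hp0.ne', add_sub_cancel, Real.rpow_one]
    simp only [hY]
    rw [Real.rpow_ofNat, norm_mul, Complex.norm_real, Real.norm_eq_abs, mul_pow, sq_abs]
    have := hne x
    field_simp
  simp_rw [e1] at h1
  have hcut : cutRate p h w R τ = ∫ x, X x := cutRate_eq hp hne R τ
  rw [hcut]
  have hP0 : 0 ≤ ∫ x, X x := integral_nonneg hX0
  have h2 : (∫ x, Y x) ^ (1 - 2 / (p + 1)) ≤ (B ^ 2) ^ (1 - 2 / (p + 1)) :=
    Real.rpow_le_rpow (integral_nonneg hY0) hYle (by linarith)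
  have h3 : cutEnergy R (w τ) ≤ (∫ x, X x) ^ (2 / (p + 1)) * (B ^ 2) ^ (1 - 2 / (p + 1)) :=
    h1.trans (by gcongr)
  refine (Real.rpow_le_rpow (cutEnergy_nonneg R _) h3 (by positivity : 0 ≤ (p + 1) / 2)).trans_eq ?_
  rw [Real.mul_rpow (by positivity) (by positivity), ← Real.rpow_mul hP0, ← Real.rpow_natCast B 2,
    ← Real.rpow_mul hB0, ← Real.rpow_mul hB0]
  have e2 : 2 / (p + 1) * ((p + 1) / 2) = 1 := by field_simp
  have e3 : ((2 : ℕ) : ℝ) * (1 - 2 / (p + 1)) * ((p + 1) / 2) = p - 1 := by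
    push_cast; field_simp; ring
  rw [e2, e3, Real.rpow_one]

lemma integrableOn_cutEnergy_rpow (lw : LocalSolution p h b w) (R : ℝ) {r : ℝ} (hr : 0 ≤ r) :
    IntegrableOn (fun τ => cutEnergy R (w τ) ^ r) (Set.Icc 0 b) := by
  obtain ⟨M, hM0, hM⟩ := lw.exists_nrm_le
  refine Measure.integrableOn_of_bounded (M := (M ^ 2) ^ r) measure_Icc_lt_top.ne
    ((measurable_cutEnergy R lw.meas).measurable.pow_const r).aestronglyMeasurable ?_
  filter_upwards [ae_restrict_mem measurableSet_Icc] with τ hτ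
  rw [Real.norm_of_nonneg (Real.rpow_nonneg (cutEnergy_nonneg R _) r)]
  refine Real.rpow_le_rpow (cutEnergy_nonneg R _) ((cutEnergy_le R (lw.memLp τ)).trans ?_) hr
  have := hM τ hτ
  have := nrm_nonneg (w τ)
  gcongr

/-- The energy inequality with a cutoff. -/
lemma integral_le_cutEnergy_sub (lw : LocalSolution p h b w) (hn : 1 ≤ n) (hp : 1 < p)
    {K : ℝ≥0} (hK : LipschitzWith K h) (hA : commNorm h ≠ ⊤) (hne : ∀ x, h x ≠ 0) {m : ℝ}
    (hm : ∀ x, |(h x)⁻¹| ≤ m) (htwo : MemLp (fun x => (h x)⁻¹) 2 volume) {B : ℝ}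
    (hB : B = (eLpNorm (fun x => (h x)⁻¹) 2 volume).toReal) (hBpos : 0 < B) {R : ℝ} (hR : 0 < R)
    {s t : ℝ} (hs : 0 ≤ s) (hst : s ≤ t) (ht : t ≤ b) :
    ∫ τ in s..t, (-(2 * (Real.pi * cutoffConst (cutoffSchwartz (n := n) hR)) +
        2 * (commNorm h).toReal) * nrm (w τ) ^ 2 +
          2 * (B ^ (1 - p) * cutEnergy R (w τ) ^ ((p + 1) / 2))) ≤
      cutEnergy R (w t) - cutEnergy R (w s) := by
  obtain ⟨ρ, hρ1, hρ⟩ := exists_bump_seq (n := n)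
  have hh := hK.continuous
  set c := -(2 * (Real.pi * cutoffConst (cutoffSchwartz (n := n) hR)) +
    2 * (commNorm h).toReal) with hc
  have hsub : Set.Icc s t ⊆ Set.Icc 0 b := Set.Icc_subset_Icc hs ht
  have hii : ∀ {f : ℝ → ℝ}, IntegrableOn f (Set.Icc 0 b) → IntervalIntegrable f volume s t :=
    fun hf => (intervalIntegrable_iff_integrableOn_Icc_of_le hst).2 (hf.mono_set hsub)
  have hgood := ae_restrict_of_ae_restrict_of_subset hsub (lw.ae_memLp_restr hp hh (2 * R + 1))
  have hgood' : ∀ᵐ τ, τ ∈ Set.uIoc s t →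
      MemLp (restr h w (2 * R + 1) τ) (ENNReal.ofReal (p + 1)) volume := by
    rw [Set.uIoc_of_le hst]
    filter_upwards [(ae_restrict_iff' measurableSet_Icc).1 hgood] with τ h1 h2
    exact h1 (Set.Ioc_subset_Icc_self h2)
  have hcn := lw.continuous_nrm
  have hNi : ∀ k, IntegrableOn (nonlinRate p h w (ρ k) R) (Set.Icc 0 b) := fun k =>
    lw.integrableOn_nonlinRate hp hh hm hR (hρ1 k)
  have hbound := (lw.integrableOn_powerMass hp hh (2 * R + 1)).const_mul (m ^ 2)
  have hlimN : Tendsto (fun k => ∫ τ in s..t, nonlinRate p h w (ρ k) R τ) atTop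
      (𝓝 (∫ τ in s..t, cutRate p h w R τ)) := by
    refine intervalIntegral.tendsto_integral_filter_of_dominated_convergence
      (fun τ => m ^ 2 * powerMass p h w (2 * R + 1) τ) (Eventually.of_forall fun k => ?_)
      (Eventually.of_forall fun k => ?_) (hii hbound) ?_
    · exact (hii (hNi k)).def'.aestronglyMeasurable
    · filter_upwards [hgood'] with τ h1 h2
      exact lw.abs_nonlinRate_le hp hh hne hm hR (hρ1 k) (h1 h2)
    · filter_upwards [hgood'] with τ h1 h2
      exact lw.tendsto_nonlinRate hp hh hne hm hρ hρ1 hR (h1 h2)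
  -- Measurability in time and the integrable bound are both inherited from the approximating rates
  -- through almost everywhere convergence.
  have hcutI : IntervalIntegrable (cutRate p h w R) volume s t := by
    refine (hii hbound).mono_fun ?_ ?_
    · refine aestronglyMeasurable_of_tendsto_ae (u := atTop)
        (f := fun k => nonlinRate p h w (ρ k) R) (fun k => (hii (hNi k)).def'.aestronglyMeasurable) ?_
      rw [Set.uIoc_of_le hst]
      filter_upwards [ae_restrict_of_ae_restrict_of_subset Set.Ioc_subset_Icc_self hgood] with τ h1
      exact lw.tendsto_nonlinRate hp hh hne hm hρ hρ1 hR h1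
    · rw [Set.uIoc_of_le hst]
      filter_upwards [ae_restrict_of_ae_restrict_of_subset Set.Ioc_subset_Icc_self hgood] with τ h1
      refine le_trans ?_ (le_abs_self _)
      exact le_of_tendsto (lw.tendsto_nonlinRate hp hh hne hm hρ hρ1 hR h1).norm
        (Eventually.of_forall fun k => lw.abs_nonlinRate_le hp hh hne hm hR (hρ1 k) h1)
  have hsq : IntervalIntegrable (fun τ => c * nrm (w τ) ^ 2) volume s t :=
    Continuous.intervalIntegrable (by fun_prop) _ _
  have h1 : ∫ τ in s..t, (c * nrm (w τ) ^ 2 + 2 * cutRate p h w R τ) ≤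
      cutEnergy R (w t) - cutEnergy R (w s) := by
    rw [intervalIntegral.integral_add hsq (hcutI.const_mul 2),
      intervalIntegral.integral_const_mul (2 : ℝ)]
    refine le_of_tendsto_of_tendsto (tendsto_const_nhds.add (hlimN.const_mul 2))
      ((tendsto_regEnergy hρ hR (lw.memLp t)).sub (tendsto_regEnergy hρ hR (lw.memLp s)))
      (Eventually.of_forall fun k => ?_)
    have h2 := lw.integral_regRate_le hn hp hK hA hne hm hR (hρ1 k) hs hst ht
    unfold regRate at h2
    rwa [intervalIntegral.integral_add hsq ((hii (hNi k)).const_mul 2),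
      intervalIntegral.integral_const_mul (2 : ℝ)] at h2
  refine le_trans ?_ h1
  have hEi := lw.integrableOn_cutEnergy_rpow R (by linarith : 0 ≤ (p + 1) / 2)
  refine intervalIntegral.integral_mono_ae_restrict hst
    (hsq.add (((hii hEi).const_mul _).const_mul 2)) (hsq.add (hcutI.const_mul 2)) ?_
  filter_upwards [hgood] with τ hτ
  have h2 := lw.cutEnergy_rpow_le hp hh hne hm htwo hR hτ
  rw [← hB] at h2
  have h3 : B ^ (1 - p) * cutEnergy R (w τ) ^ ((p + 1) / 2) ≤ cutRate p h w R τ := by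
    calc _ ≤ B ^ (1 - p) * (cutRate p h w R τ * B ^ (p - 1)) := by gcongr
      _ = cutRate p h w R τ * (B ^ (1 - p) * B ^ (p - 1)) := by ring
      _ = _ := by rw [← Real.rpow_add hBpos]; simp
  linarith

/-- The energy inequality. -/
lemma integral_le_nrm_sq_sub (lw : LocalSolution p h b w) (hn : 1 ≤ n) (hp : 1 < p)
    {K : ℝ≥0} (hK : LipschitzWith K h) (hA : commNorm h ≠ ⊤) (hne : ∀ x, h x ≠ 0) {m : ℝ}
    (hm : ∀ x, |(h x)⁻¹| ≤ m) (htwo : MemLp (fun x => (h x)⁻¹) 2 volume) {B : ℝ}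
    (hB : B = (eLpNorm (fun x => (h x)⁻¹) 2 volume).toReal) (hBpos : 0 < B)
    {s t : ℝ} (hs : 0 ≤ s) (hst : s ≤ t) (ht : t ≤ b) :
    ∫ τ in s..t, (-(2 * (commNorm h).toReal) * nrm (w τ) ^ 2 +
        2 * (B ^ (1 - p) * (nrm (w τ) ^ 2) ^ ((p + 1) / 2))) ≤
      nrm (w t) ^ 2 - nrm (w s) ^ 2 := by
  set A := (commNorm h).toReal with hAd
  have hA0 : 0 ≤ A := ENNReal.toReal_nonneg
  have hr : 0 ≤ (p + 1) / 2 := by linarith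
  set c₁ := cutoffConst (cutoffSchwartz (n := n) one_pos) with hc₁
  obtain ⟨M, hM0, hM⟩ := lw.exists_nrm_le
  have hsub : Set.Icc s t ⊆ Set.Icc 0 b := Set.Icc_subset_Icc hs ht
  have hcn := lw.continuous_nrm
  have hBp : 0 ≤ B ^ (1 - p) := by positivity
  -- By scaling, the commutator with the cutoff contributes a constant times `R⁻¹`, so only the term
  -- with `A` survives as `R → ∞`.
  have hle : ∀ᶠ R in atTop, ∫ τ in s..t, (-(2 * (Real.pi * (R⁻¹ * c₁)) + 2 * A) * nrm (w τ) ^ 2 +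
        2 * (B ^ (1 - p) * cutEnergy R (w τ) ^ ((p + 1) / 2))) ≤
      cutEnergy R (w t) - cutEnergy R (w s) := by
    filter_upwards [eventually_gt_atTop 0] with R hR
    have := lw.integral_le_cutEnergy_sub hn hp hK hA hne hm htwo hB hBpos hR hs hst ht
    rwa [cutoffConst_cutoffSchwartz hR] at this
  refine le_of_tendsto_of_tendsto ?_
    ((tendsto_cutEnergy (lw.memLp t)).sub (tendsto_cutEnergy (lw.memLp s))) hle
  refine intervalIntegral.tendsto_integral_filter_of_dominated_convergence
    (fun _ => (2 * (Real.pi * |c₁|) + 2 * A) * M ^ 2 + 2 * (B ^ (1 - p) * (M ^ 2) ^ ((p + 1) / 2)))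
    (Eventually.of_forall fun R => ?_) ?_ intervalIntegrable_const (ae_of_all _ fun τ _ => ?_)
  · have h1 := ((measurable_cutEnergy R lw.meas).measurable.pow_const ((p + 1) / 2)).const_mul
      (B ^ (1 - p))
    have h2 : Measurable fun τ => -(2 * (Real.pi * (R⁻¹ * c₁)) + 2 * A) * nrm (w τ) ^ 2 :=
      (by fun_prop : Continuous fun τ =>
        -(2 * (Real.pi * (R⁻¹ * c₁)) + 2 * A) * nrm (w τ) ^ 2).measurable
    exact (h2.add (h1.const_mul 2)).aestronglyMeasurable
  · filter_upwards [eventually_ge_atTop 1] with R hR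
    refine ae_of_all _ fun τ hτ => ?_
    rw [Set.uIoc_of_le hst] at hτ
    have hMτ := hM τ (hsub (Set.Ioc_subset_Icc_self hτ))
    have n0 := nrm_nonneg (w τ)
    have hE := cutEnergy_le R (lw.memLp τ)
    have hE0 := cutEnergy_nonneg R (w τ)
    have hc : |R⁻¹ * c₁| ≤ |c₁| := by
      rw [abs_mul, abs_of_nonneg (by positivity)]
      exact mul_le_of_le_one_left (abs_nonneg _) (inv_le_one_of_one_le₀ hR)
    refine (norm_add_le _ _).trans (add_le_add ?_ ?_)
    · rw [norm_mul, norm_neg, Real.norm_of_nonneg (sq_nonneg (nrm (w τ)))]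
      refine mul_le_mul ?_ (by gcongr) (by positivity) (by positivity)
      refine (norm_add_le _ _).trans ?_
      rw [Real.norm_of_nonneg (by positivity : 0 ≤ 2 * A), norm_mul, norm_mul, Real.norm_eq_abs,
        Real.norm_eq_abs, Real.norm_eq_abs, abs_of_pos Real.pi_pos, abs_two]
      gcongr
    · rw [Real.norm_of_nonneg (by positivity)]
      gcongr
      exact hE.trans (by gcongr)
  · have h1 : Tendsto (fun R : ℝ => -(2 * (Real.pi * (R⁻¹ * c₁)) + 2 * A) * nrm (w τ) ^ 2) atTop
        (𝓝 (-(2 * (Real.pi * (0 * c₁)) + 2 * A) * nrm (w τ) ^ 2)) :=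
      (((((tendsto_inv_atTop_zero.mul_const c₁).const_mul Real.pi).const_mul 2).add_const
        (2 * A)).neg).mul_const _
    simp only [zero_mul, mul_zero, zero_add] at h1
    exact h1.add ((((tendsto_cutEnergy (lw.memLp τ)).rpow_const (Or.inr hr)).const_mul _).const_mul 2)

end LocalSolution

/-! ### The integral inequality -/

/-- Consider the last time up to `t` at which `Δ` is nonnegative. After it `Δ` is nonpositive, so
the hypothesis makes the increment nonnegative, and `Δ t` cannot be negative. No differentiability
is required. -/
lemma nonneg_of_integral_le_sub {Δ : ℝ → ℝ} (hΔ : Continuous Δ) (h0 : Δ 0 = 0) {a b : ℝ} (ha : 0 ≤ a)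
    (h : ∀ s t, 0 ≤ s → s ≤ t → t ≤ b → -a * (∫ τ in s..t, Δ τ) ≤ Δ t - Δ s) {t : ℝ} (ht : 0 ≤ t)
    (htb : t ≤ b) : 0 ≤ Δ t := by
  by_contra! hneg
  set S : Set ℝ := {s | s ∈ Set.Icc 0 t ∧ 0 ≤ Δ s} with hS
  have hScl : IsClosed S := isClosed_Icc.inter (isClosed_le continuous_const hΔ)
  have hS0 : (0 : ℝ) ∈ S := ⟨⟨le_rfl, ht⟩, h0.ge⟩
  have hSb : BddAbove S := ⟨t, fun s hs => hs.1.2⟩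
  obtain ⟨⟨h1, h2⟩, h3⟩ := hScl.csSup_mem ⟨0, hS0⟩ hSb
  have hle : ∫ τ in (sSup S)..t, Δ τ ≤ 0 := by
    have h4 : ∫ τ in (sSup S)..t, Δ τ ≤ ∫ τ in (sSup S)..t, (0 : ℝ) := by
      refine intervalIntegral.integral_mono_on_of_le_Ioo h2 (hΔ.intervalIntegrable _ _)
        intervalIntegrable_const fun τ hτ => ?_
      by_contra! hpos
      exact absurd (le_csSup hSb (show τ ∈ S from ⟨⟨h1.trans hτ.1.le, hτ.2.le⟩, hpos.le⟩))
        (not_le.2 hτ.1)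
    simpa using h4
  have := h _ t h1 h2 htb
  nlinarith

/-- The lower bound for a function `E` with `E' ≥ -2 A E + 2 β E ^ r` in integrated form. -/
lemma lower_bound_of_integral_le_sub {E : ℝ → ℝ} (hE : Continuous E) (hE0 : ∀ t, 0 ≤ E t)
    (hpos : 0 < E 0) {A β r b : ℝ} (hA : 0 < A) (hβ : 0 ≤ β) (hr : 1 < r)
    (h : ∀ s t, 0 ≤ s → s ≤ t → t ≤ b →
      ∫ τ in s..t, (-(2 * A) * E τ + 2 * (β * E τ ^ r)) ≤ E t - E s) {t : ℝ} (ht : 0 ≤ t)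
    (htb : t ≤ b) :
    0 < E 0 ^ (1 - r) + A⁻¹ * β * (Real.exp (-(2 * A * (r - 1)) * t) - 1) ∧
      Real.exp (-(2 * A) * t) *
        (E 0 ^ (1 - r) + A⁻¹ * β * (Real.exp (-(2 * A * (r - 1)) * t) - 1)) ^ (-(r - 1)⁻¹) ≤ E t := by
  have hEr : Continuous fun τ => E τ ^ r := hE.rpow_const fun _ => Or.inr (by linarith)
  have hgc : Continuous fun τ => 2 * (β * (Real.exp (2 * A * τ) * E τ ^ r)) := by fun_prop
  -- Duhamel's formula: `e^(-2At) v` solves the linear equation with damping `2A`, initial value `E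
  -- 0` and the forcing `2βE^r` computed from `E` itself. Comparison gives `e^(-2At) v ≤ E`, and
  -- `v`, unlike `E`, is differentiable.
  set v : ℝ → ℝ := fun t => E 0 + ∫ τ in (0 : ℝ)..t, 2 * (β * (Real.exp (2 * A * τ) * E τ ^ r)) with hv
  have hvd : ∀ t, HasDerivAt v (2 * (β * (Real.exp (2 * A * t) * E t ^ r))) t := fun t =>
    (intervalIntegral.integral_hasDerivAt_right (hgc.intervalIntegrable _ _)
      (hgc.stronglyMeasurableAtFilter _ _) hgc.continuousAt).const_add _
  have hvc : Continuous v := continuous_iff_continuousAt.2 fun t => (hvd t).continuousAt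
  have hv0 : v 0 = E 0 := by simp [hv]
  have hed : ∀ c t : ℝ, HasDerivAt (fun t => Real.exp (c * t)) (c * Real.exp (c * t)) t := by
    intro c t
    have h1 := ((hasDerivAt_id t).const_mul c).exp
    simpa [mul_comm] using h1
  have hvE : ∀ t, 0 ≤ t → t ≤ b → Real.exp (-(2 * A) * t) * v t ≤ E t := by
    intro t ht htb
    set H : ℝ → ℝ := fun t => Real.exp (-(2 * A) * t) * v t with hH
    have hHd : ∀ t, HasDerivAt H (-(2 * A) * H t + 2 * (β * E t ^ r)) t := by
      intro t
      refine ((hed (-(2 * A)) t).mul (hvd t)).congr_deriv ?_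
      have e : Real.exp (-(2 * A) * t) * Real.exp (2 * A * t) = 1 := by
        rw [← Real.exp_add]; simp
      simp only [hH]
      linear_combination (2 * (β * E t ^ r)) * e
    have hHc : Continuous H := continuous_iff_continuousAt.2 fun t => (hHd t).continuousAt
    have hint : ∀ s t, ∫ τ in s..t, (-(2 * A) * H τ + 2 * (β * E τ ^ r)) = H t - H s := fun s t =>
      intervalIntegral.integral_eq_sub_of_hasDerivAt (fun τ _ => hHd τ)
        (Continuous.intervalIntegrable (by fun_prop) _ _)
    have := nonneg_of_integral_le_sub (Δ := fun t => E t - H t) (hE.sub hHc)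
      (by simp [hH, hv0]) (a := 2 * A) (b := b) (by positivity) (fun s t hs hst ht => ?_) ht htb
    · exact sub_nonneg.1 this
    · have h1 := h s t hs hst ht
      have h2 := hint s t
      have h3 : -(2 * A) * ∫ τ in s..t, (E τ - H τ) =
          (∫ τ in s..t, (-(2 * A) * E τ + 2 * (β * E τ ^ r))) -
            ∫ τ in s..t, (-(2 * A) * H τ + 2 * (β * E τ ^ r)) := by
        rw [← intervalIntegral.integral_sub (Continuous.intervalIntegrable (by fun_prop) _ _)
          (Continuous.intervalIntegrable (by fun_prop) _ _), ← intervalIntegral.integral_const_mul]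
        congr 1; ext τ; ring
      rw [h3]
      linarith
  have hvpos : ∀ t, 0 ≤ t → 0 < v t := by
    intro t ht
    refine add_pos_of_pos_of_nonneg hpos (intervalIntegral.integral_nonneg ht fun τ _ => ?_)
    have := Real.rpow_nonneg (hE0 τ) r
    positivity
  -- The comparison gives `v' ≥ 2β e^(-2A(r-1)t) v^r`, a separable inequality. Dividing by `v^r` and
  -- integrating amounts to `φ` being nonincreasing.
  set φ : ℝ → ℝ := fun t => v t ^ (1 - r) - A⁻¹ * β * Real.exp (-(2 * A * (r - 1)) * t) with hφ
  have hφd : ∀ t, 0 ≤ t → HasDerivAt φ ((2 * (β * (Real.exp (2 * A * t) * E t ^ r))) * (1 - r) *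
      v t ^ (1 - r - 1) - A⁻¹ * β * (-(2 * A * (r - 1)) * Real.exp (-(2 * A * (r - 1)) * t))) t :=
    fun t ht => ((hvd t).rpow_const (Or.inl (hvpos t ht).ne')).sub ((hed _ t).const_mul _)
  have hanti : AntitoneOn φ (Set.Icc 0 b) := by
    refine antitoneOn_of_deriv_nonpos (convex_Icc 0 b)
      (fun t ht => (hφd t ht.1).continuousAt.continuousWithinAt) (fun t ht => ?_) fun t ht => ?_
    · rw [interior_Icc] at ht
      exact (hφd t ht.1.le).differentiableAt.differentiableWithinAt
    · rw [interior_Icc] at ht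
      rw [(hφd t ht.1.le).deriv]
      have hvp := hvpos t ht.1.le
      have h1 : Real.exp (-(2 * A * (r - 1)) * t) ≤
          Real.exp (2 * A * t) * E t ^ r * v t ^ (1 - r - 1) := by
        have h2 : (Real.exp (-(2 * A) * t) * v t) ^ r ≤ E t ^ r :=
          Real.rpow_le_rpow (by positivity) (hvE t ht.1.le ht.2.le) (by linarith)
        rw [Real.mul_rpow (by positivity) hvp.le, ← Real.exp_mul] at h2
        calc Real.exp (-(2 * A * (r - 1)) * t)
            = Real.exp (2 * A * t) * (Real.exp (-(2 * A) * t * r) * v t ^ r) * v t ^ (1 - r - 1) := by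
              have e1 : v t ^ r * v t ^ (1 - r - 1) = 1 := by
                rw [← Real.rpow_add hvp]; simp
              have e2 : Real.exp (2 * A * t) * Real.exp (-(2 * A) * t * r) =
                  Real.exp (-(2 * A * (r - 1)) * t) := by
                rw [← Real.exp_add]; congr 1; ring
              rw [← e2]
              linear_combination (-(Real.exp (2 * A * t) * Real.exp (-(2 * A) * t * r))) * e1
          _ ≤ _ := by gcongr
      have e : (2 * (β * (Real.exp (2 * A * t) * E t ^ r))) * (1 - r) * v t ^ (1 - r - 1) -
          A⁻¹ * β * (-(2 * A * (r - 1)) * Real.exp (-(2 * A * (r - 1)) * t)) =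
          2 * β * (r - 1) * (Real.exp (-(2 * A * (r - 1)) * t) -
            Real.exp (2 * A * t) * E t ^ r * v t ^ (1 - r - 1)) := by
        field_simp; ring
      rw [e]
      exact mul_nonpos_of_nonneg_of_nonpos (mul_nonneg (by positivity) (by linarith)) (by linarith)
  have hZ : v t ^ (1 - r) ≤
      E 0 ^ (1 - r) + A⁻¹ * β * (Real.exp (-(2 * A * (r - 1)) * t) - 1) := by
    have h1 := hanti ⟨le_rfl, ht.trans htb⟩ ⟨ht, htb⟩ ht
    simp only [hφ, hv0, mul_zero, Real.exp_zero] at h1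
    linarith
  have hvp := hvpos t ht
  have hvr : 0 < v t ^ (1 - r) := Real.rpow_pos_of_pos hvp _
  refine ⟨hvr.trans_le hZ, le_trans ?_ (hvE t ht htb)⟩
  gcongr
  -- The exponent is negative, so the upper bound on `v^(1-r)` becomes the lower bound on `v`.
  have h1 := Real.rpow_le_rpow_of_nonpos hvr hZ (z := -(r - 1)⁻¹)
    (neg_nonpos.2 (inv_nonneg.2 (by linarith)))
  refine h1.trans_eq ?_
  have : r - 1 ≠ 0 := by linarith
  rw [← Real.rpow_mul hvp.le]
  have e : (1 - r) * -(r - 1)⁻¹ = 1 := by field_simp; ring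
  rw [e, Real.rpow_one]

/-! ### The solution -/

/-- For continuous `f` the set where the essential bound fails is open and null, hence empty. -/
lemma exists_abs_le_of_memLp_top {f : Space n → ℝ} (hf : Continuous f) (hm : MemLp f ⊤ volume) :
    ∃ m : ℝ, ∀ x, |f x| ≤ m := by
  refine ⟨(eLpNorm f ⊤ volume).toReal, fun x => ?_⟩
  have hae : ∀ᵐ x, |f x| ≤ (eLpNorm f ⊤ volume).toReal := by
    filter_upwards [ae_le_eLpNormEssSup (f := f) (μ := volume)] with x hx
    rw [eLpNorm_exponent_top, ← Real.norm_eq_abs, ← toReal_enorm]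
    exact ENNReal.toReal_mono (by simpa using hm.eLpNorm_ne_top) hx
  have hopen : IsOpen {x | (eLpNorm f ⊤ volume).toReal < |f x|} := isOpen_lt continuous_const hf.abs
  have hnull : volume {x | (eLpNorm f ⊤ volume).toReal < |f x|} = 0 := by
    have := ae_iff.1 hae
    simpa using this
  have := hopen.measure_eq_zero_iff volume |>.1 hnull
  by_contra! hx
  exact (this ▸ (show x ∈ {x | (eLpNorm f ⊤ volume).toReal < |f x|} from hx) : x ∈ (∅ : Set (Space n)))

/-- The Bernoulli bound for `E = ‖w‖²` with `r = (p+1)/2` and `β = B^(1-p)`. Taking the square root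
halves the exponents: the prefactor becomes `e^(-At)` and the outer power `-1/(p-1)`. -/
lemma IsSolution.lower_bound (hn : 1 ≤ n) {p : ℝ} (hp : 1 < p) {h : Space n → ℝ} {K : ℝ≥0}
    (hK : LipschitzWith K h) (hne : ∀ x, h x ≠ 0) (hinf : MemLp (fun x => (h x)⁻¹) ⊤ volume)
    (htwo : MemLp (fun x => (h x)⁻¹) 2 volume) {u₀ : Space n → ℂ} {T : EReal}
    {u : ℝ → Space n → ℂ} (hu : IsSolution p h T u₀ u) (hAt : commNorm h ≠ ⊤) {A B y₀ : ℝ}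
    (hA : A = (commNorm h).toReal) (hB : B = (eLpNorm (fun x => (h x)⁻¹) 2 volume).toReal)
    (hy₀ : y₀ = (wnorm h u₀).toReal) (hApos : 0 < A) (hBpos : 0 < B) (hypos : 0 < y₀) {t : ℝ}
    (ht : 0 ≤ t) (htT : (t : EReal) < T) :
    0 < y₀ ^ (-p + 1) + A⁻¹ * B ^ (-p + 1) * (Real.exp (-A * (p - 1) * t) - 1) ∧
      Real.exp (-A * t) *
          (y₀ ^ (-p + 1) + A⁻¹ * B ^ (-p + 1) * (Real.exp (-A * (p - 1) * t) - 1))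
            ^ (-(1 / (p - 1))) ≤ (wnorm h (u t)).toReal := by
  obtain ⟨m, hm⟩ := exists_abs_le_of_memLp_top (hK.continuous.inv₀ hne) hinf
  obtain ⟨w, lw, hw⟩ := hu.exists_localSolution hne ht htT
  have hw0 : nrm (w 0) = y₀ := by
    rw [hw 0 ⟨le_rfl, ht⟩, hy₀, wnorm, wnorm]
    congr 1
    refine eLpNorm_congr_ae ?_
    filter_upwards [hu.initial] with x hx
    rw [hx]
  have h1 := lower_bound_of_integral_le_sub (E := fun τ => nrm (w τ) ^ 2) (A := A)
    (β := B ^ (1 - p)) (r := (p + 1) / 2) (b := t) (lw.continuous_nrm.pow 2) (fun τ => by positivity)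
    (by rw [hw0]; positivity) hApos (by positivity) (by linarith) (fun s t' hs hst ht' => by
      rw [hA]; exact lw.integral_le_nrm_sq_sub hn hp hK hAt hne hm htwo hB hBpos hs hst ht') ht le_rfl
  simp only [hw0, hw t ⟨ht, le_rfl⟩] at h1
  have e1 : (y₀ ^ 2) ^ (1 - (p + 1) / 2) = y₀ ^ (-p + 1) := by
    rw [← Real.rpow_natCast, ← Real.rpow_mul hypos.le]; congr 1; push_cast; ring
  have e2 : -(2 * A * ((p + 1) / 2 - 1)) * t = -A * (p - 1) * t := by ring
  have e3 : 1 - p = -p + 1 := by ring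
  rw [e1, e2, e3] at h1
  obtain ⟨hZ, hle⟩ := h1
  refine ⟨hZ, ?_⟩
  set Z := y₀ ^ (-p + 1) + A⁻¹ * B ^ (-p + 1) * (Real.exp (-A * (p - 1) * t) - 1) with hZd
  refine le_of_sq_le_sq ?_ ENNReal.toReal_nonneg
  refine le_of_eq_of_le ?_ hle
  have hp1 : p - 1 ≠ 0 := by linarith
  rw [mul_pow, ← Real.exp_nat_mul, ← Real.rpow_natCast (Z ^ _), ← Real.rpow_mul hZ.le]
  congr 2
  · push_cast; ring
  · have : (p + 1) / 2 - 1 = (p - 1) / 2 := by ring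
    rw [this]; push_cast; field_simp

end FracGL

end

/-! ### The lower bound and the lifespan estimate -/

theorem proposition1p1 (n : ℕ) (hn : 1 ≤ n) (p : ℝ) (hp : 1 < p)
    (h : FracGL.Space n → ℝ) (hLip : ∃ K : ℝ≥0, LipschitzWith K h)
    (hne : ∀ x, h x ≠ 0) (hinf : MemLp (fun x => (h x)⁻¹) ⊤ volume)
    (htwo : MemLp (fun x => (h x)⁻¹) 2 volume)
    (hconv : FracGL.ConvolutionBound h)
    (u₀ : FracGL.Space n → ℂ) (hu₀ : FracGL.MemWeighted h u₀)
    (hlarge : FracGL.commNorm h ^ (1 / (p - 1)) * eLpNorm (fun x => (h x)⁻¹) 2 volume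
      ≤ FracGL.wnorm h u₀)
    (T : EReal) (hT : 0 < T) (u : ℝ → FracGL.Space n → ℂ)
    (hu : FracGL.IsSolution p h T u₀ u)
    (A B y₀ : ℝ) (hA : A = (FracGL.commNorm h).toReal)
    (hB : B = (eLpNorm (fun x => (h x)⁻¹) 2 volume).toReal)
    (hy₀ : y₀ = (FracGL.wnorm h u₀).toReal) :
    (∀ t : ℝ, 0 ≤ t → (t : EReal) < T →
      0 < y₀ ^ (-p + 1) + A⁻¹ * B ^ (-p + 1) * (Real.exp (-A * (p - 1) * t) - 1) ∧
      Real.exp (-2 * A * t) *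
          (y₀ ^ (-p + 1) + A⁻¹ * B ^ (-p + 1) * (Real.exp (-A * (p - 1) * t) - 1))
            ^ (-(1 / (p - 1)))
        ≤ (FracGL.wnorm h (u t)).toReal) ∧
    (FracGL.commNorm h ^ (1 / (p - 1)) * eLpNorm (fun x => (h x)⁻¹) 2 volume
        < FracGL.wnorm h u₀ →
      T ≤ ((-(2 / (p - 1)) * A⁻¹ * Real.log (1 - A * B ^ (p - 1) * y₀ ^ (-p + 1)) : ℝ) :
        EReal)) := by
  obtain ⟨K, hK⟩ := hLip
  have hp1 : 0 < p - 1 := by linarith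
  have hBne : eLpNorm (fun x => (h x)⁻¹) 2 volume ≠ 0 := by
    intro h0
    rw [eLpNorm_eq_zero_iff htwo.1 (by norm_num)] at h0
    obtain ⟨x, hx⟩ := h0.exists
    exact inv_ne_zero (hne x) hx
  have hBtop := htwo.eLpNorm_ne_top
  have hytop : FracGL.wnorm h u₀ ≠ ⊤ := hu₀.eLpNorm_ne_top
  have hA0 := FracGL.commNorm_ne_zero hn hK hne htwo
  -- If the commutator norm were infinite, the size condition together with `B > 0` would force `y₀
  -- = ∞`.
  have hAtop : FracGL.commNorm h ≠ ⊤ := by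
    intro htop
    rw [htop, ENNReal.top_rpow_of_pos (by positivity), ENNReal.top_mul hBne, top_le_iff] at hlarge
    exact hytop hlarge
  have hApow : FracGL.commNorm h ^ (1 / (p - 1)) ≠ 0 := fun h0 => by
    rcases ENNReal.rpow_eq_zero_iff.1 h0 with h0 | h0
    exacts [hA0 h0.1, hAtop h0.1]
  have hApos : 0 < A := hA ▸ ENNReal.toReal_pos hA0 hAtop
  have hBpos : 0 < B := hB ▸ ENNReal.toReal_pos hBne hBtop
  have hypos : 0 < y₀ := hy₀ ▸ ENNReal.toReal_pos
    (fun h0 => mul_ne_zero hApow hBne (le_bot_iff.1 (hlarge.trans_eq h0))) hytop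
  have main : ∀ t : ℝ, 0 ≤ t → (t : EReal) < T → _ := fun t ht htT =>
    hu.lower_bound hn hp hK hne hinf htwo hAtop hA hB hy₀ hApos hBpos hypos ht htT
  refine ⟨fun t ht htT => ⟨(main t ht htT).1, le_trans ?_ (main t ht htT).2⟩, fun hlt => ?_⟩
  · have hZ := (main t ht htT).1
    gcongr
    nlinarith
  · have hreal : A ^ (1 / (p - 1)) * B < y₀ := by
      have h1 := (ENNReal.toReal_lt_toReal (ENNReal.mul_ne_top
        (ENNReal.rpow_ne_top_of_nonneg (by positivity) hAtop) hBtop) hytop).2 hlt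
      rwa [ENNReal.toReal_mul, ← ENNReal.toReal_rpow, ← hA, ← hB, ← hy₀] at h1
    set θ := A * B ^ (p - 1) * y₀ ^ (-p + 1) with hθ
    have hθ0 : 0 < θ := by positivity
    -- This is the strict size condition raised to the power `p - 1`; it makes the logarithm finite
    -- and negative.
    have hθ1 : θ < 1 := by
      have h1 := Real.rpow_lt_rpow (by positivity) hreal hp1
      rw [Real.mul_rpow (by positivity) hBpos.le, ← Real.rpow_mul hApos.le,
        one_div_mul_cancel hp1.ne', Real.rpow_one] at h1
      have e : y₀ ^ (-p + 1) = (y₀ ^ (p - 1))⁻¹ := by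
        rw [← Real.rpow_neg hypos.le]; congr 1; ring
      rw [hθ, e, ← div_eq_mul_inv, div_lt_one (by positivity)]
      exact h1
    have hlog : Real.log (1 - θ) < 0 := Real.log_neg (by linarith) (by linarith)
    by_contra! hTlt
    -- The time at which the bracket vanishes, half of the claimed bound on `T`. If the solution
    -- lived longer than that bound, the bracket would have to be positive at `t₀`.
    set t₀ : ℝ := -(1 / (p - 1)) * A⁻¹ * Real.log (1 - θ) with ht₀
    have ht₀pos : 0 < t₀ := by
      rw [ht₀, neg_mul, neg_mul, neg_pos]
      exact mul_neg_of_pos_of_neg (by positivity) hlog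
    have hle : t₀ ≤ -(2 / (p - 1)) * A⁻¹ * Real.log (1 - θ) := by
      have e : -(2 / (p - 1)) * A⁻¹ * Real.log (1 - θ) = 2 * t₀ := by rw [ht₀]; ring
      rw [e]; linarith
    have hZ := (main t₀ ht₀pos.le (lt_of_le_of_lt (EReal.coe_le_coe_iff.2 hle) hTlt)).1
    have e1 : -A * (p - 1) * t₀ = Real.log (1 - θ) := by
      rw [ht₀]; field_simp
    have e2 : B ^ (-p + 1) * B ^ (p - 1) = 1 := by
      rw [← Real.rpow_add hBpos]; simp
    have e3 : A⁻¹ * B ^ (-p + 1) * θ = y₀ ^ (-p + 1) := by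
      rw [hθ]
      calc _ = (A⁻¹ * A) * (B ^ (-p + 1) * B ^ (p - 1)) * y₀ ^ (-p + 1) := by ring
        _ = _ := by rw [e2, inv_mul_cancel₀ hApos.ne']; ring
    rw [e1, Real.exp_log (by linarith)] at hZ
    nlinarith
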